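/- Let $\mathbb A$ be a nonempty finite set, and let $(\sigma,\tau)$ be a weighted substitution on $\mathbb A$: each $a\in\mathbb A$ has a word $\sigma(a)=\sigma(a)_0\cdots\sigma(a)_{\ell_a-1}$ of length $\ell_a\ge 1$ over $\mathbb A$ and weights $\tau(a)_i\in(0,1)$, $0\le i<\ell_a$, with $\sum_i\tau(a)_i=1$. Let $\sigma^n(a)$ be the iterated words, and let $\tau^n(a)$ be the corresponding weights, multiplied along the iteration (with $\tau^0(a)=1$). Assume that $\sigma$ is primitive: for some $n\ge1$ every letter occurs in $\sigma^n(a)$ for every $a$. Let $G$ be the closed multiplicative subgroup of $\mathbb R_+=(0,\infty)$ generated by all $\tau^n(a)_i$ with $n\ge0$ and $\sigma^n(a)_i=a$, and let $g:\mathbb A\to\mathbb R_+$ satisfy $g(\sigma(a)_i)G=g(a)\tau(a)_iG$ for all $a$ and $i$. A tile is an open rectangle $R=(x_1,x_2)\times(y_1,y_2)$ with $0<y_1<y_2$ and $x_2-x_1=y_1$. A colored tiling is a set $\omega$ of pairs $(R,a)$, with $R$ a tile and $a\in\mathbb A$, such that distinct pairs have disjoint rectangles and the closures of the rectangles have union the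 upper half plane. A net $\omega_n$ converges to $\omega$ if every $(R,a)\in\omega$ is the limit, in the Hausdorff metric, of tiles $R_n$ with $(R_n,a_n)\in\omega_n$ and eventually $a_n=a$. For $\lambda>0$ put $\lambda\omega=\{(\lambda R,a):(R,a)\in\omega\}$. Let $\Omega'$ be the set of colored tilings $\omega$ such that for every $((x_1,x_2)\times(y_1,y_2),a)\in\omega$ one has $y_1\in g(a)G$ and, for every $i$, $(R^i,\sigma(a)_i)\in\omega$, where $$R^i=\Big(x_1+(x_2-x_1)\sum_{j<i}\tau(a)_j,\;x_1+(x_2-x_1)\sum_{j\le i}\tau(a)_j\Big)\times(\tau(a)_iy_1,\,y_1).$$ Let $\Omega$ be the closure, in the space of colored tilings, of the set of those $\omega\in\Omega'$ for which every vertical line meets some tile of $\omega$. Let $\Theta$ be the set of closed orbits, that is, of the sets $\xi=G\omega$ with $\omega\in\Omega$ such that $\lambda\omega=\omega$ for some $\lambda\in G$, $\lambda>1$; let $c(\xi)$ be the least such $\lambda$. Let $M_\alpha=\big(\sum_{i:\,\sigma(a)_i=a'}\tau(a)_i^{\alpha}\big)_{a,a'\in\mathbb A}$ for $\alpha\in\mathbb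 C$. **Theorem 4.2.** The product $\prod_{\xi\in\Theta}(1-c(\xi)^{-\alpha})^{-1}$ converges for $\operatorname{Re}\alpha>1$ and extends uniquely to a meromorphic function $\zeta_\Omega$ on $\mathbb C$. Moreover: (i) $\zeta_\Omega$ has no zero $\alpha$ with $\operatorname{Re}\alpha\ne0$. (ii) For every $\alpha$ with $\operatorname{Re}\alpha\neq0$ and every $k=1,2,\dots$, $\alpha$ is a pole of $\zeta_\Omega$ of multiplicity $k$ if and only if $\alpha$ is a zero of $\det(I-M_\alpha)$ of multiplicity $k$. (iii) $\alpha=1$ is a simple pole of $\zeta_\Omega$. -/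

import Mathlib

open scoped Pointwise

namespace Kamae

/-- The multiplicative group of positive real numbers, with its usual topology. -/
abbrev RPos : Type := {x : ℝ // 0 < x}

/-! ### Admissible tiles and colored tilings of the upper half plane -/

/-- An admissible tile `(x₁, x₂) × (y₁, y₂)` of the upper half plane, given by its coordinates:
a nonempty open rectangle whose width equals the ordinate of its lower side. -/
@[ext]
structure Tile where
  x₁ : ℝ
  x₂ : ℝ
  y₁ : ℝ
  y₂ : ℝ
  y₁_pos : 0 < y₁
  y₁_lt_y₂ : y₁ < y₂
  width_eq : x₂ - x₁ = y₁

namespace Tile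

/-- The open rectangle, as a subset of the complex plane. -/
def toSet (R : Tile) : Set ℂ := Set.Ioo R.x₁ R.x₂ ×ℂ Set.Ioo R.y₁ R.y₂

/-- The tile `l R`. -/
def scale (l : RPos) (R : Tile) : Tile where
  x₁ := l * R.x₁
  x₂ := l * R.x₂
  y₁ := l * R.y₁
  y₂ := l * R.y₂
  y₁_pos := mul_pos l.2 R.y₁_pos
  y₁_lt_y₂ := mul_lt_mul_of_pos_left R.y₁_lt_y₂ l.2
  width_eq := by rw [← mul_sub, R.width_eq]

theorem mem_toSet {R : Tile} {z : ℂ} :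
    z ∈ R.toSet ↔ (R.x₁ < z.re ∧ z.re < R.x₂) ∧ (R.y₁ < z.im ∧ z.im < R.y₂) := Iff.rfl

theorem x₁_lt_x₂ (R : Tile) : R.x₁ < R.x₂ := by
  have := R.width_eq
  have := R.y₁_pos
  linarith

theorem mem_closure_toSet {R : Tile} {z : ℂ} :
    z ∈ closure R.toSet ↔ (R.x₁ ≤ z.re ∧ z.re ≤ R.x₂) ∧ (R.y₁ ≤ z.im ∧ z.im ≤ R.y₂) := by
  rw [toSet, Complex.closure_reProdIm, closure_Ioo R.x₁_lt_x₂.ne, closure_Ioo R.y₁_lt_y₂.ne]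
  exact Iff.rfl

theorem mem_toSet_scale {l : RPos} {R : Tile} {z : ℂ} :
    z ∈ (R.scale l).toSet ↔ z / ((l : ℝ) : ℂ) ∈ R.toSet := by
  have hl : (0 : ℝ) < l := l.2
  simp only [mem_toSet, scale, Complex.div_ofReal_re, Complex.div_ofReal_im, lt_div_iff₀ hl,
    div_lt_iff₀ hl, mul_comm]

theorem mem_closure_toSet_scale {l : RPos} {R : Tile} {z : ℂ} :
    z ∈ closure (R.scale l).toSet ↔ z / ((l : ℝ) : ℂ) ∈ closure R.toSet := by
  have hl : (0 : ℝ) < l := l.2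
  simp only [mem_closure_toSet, scale, Complex.div_ofReal_re, Complex.div_ofReal_im,
    le_div_iff₀ hl, div_le_iff₀ hl, mul_comm]

end Tile

/-- A colored tiling: a set of colored tiles such that distinct colored tiles are disjoint
rectangles and the closures of the tiles cover exactly the upper half plane. -/
@[ext]
structure ColoredTiling (A : Type*) where
  tiles : Set (Tile × A)
  disjoint : ∀ p ∈ tiles, ∀ q ∈ tiles, p ≠ q → Disjoint p.1.toSet q.1.toSet
  cover : (⋃ p ∈ tiles, closure p.1.toSet) = {z : ℂ | 0 < z.im}

namespace ColoredTiling

variable {A : Type*}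

/-- The topology on colored tilings. A subbasis is given by the sets of the tilings which have
a tile of color `a` at Hausdorff distance less than `ε` from the tile `R`. By the triangle
inequality, the sets of this kind with `(R, a)` in `ω` form a neighborhood subbasis at `ω`, so a
net of tilings converges to `ω` iff every `(R, a) ∈ ω` is the limit, in the Hausdorff distance,
of tiles of the net which eventually have the color `a`. -/
instance : TopologicalSpace (ColoredTiling A) :=
  TopologicalSpace.generateFrom
    {U | ∃ (R : Tile) (a : A) (ε : ℝ), 0 < ε ∧
      U = {ω | ∃ R' : Tile, (R', a) ∈ ω.tiles ∧ Metric.hausdorffDist R.toSet R'.toSet < ε}}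

/-- The multiplicative action `l ω = {(l R, a) ; (R, a) ∈ ω}`. -/
def scale (l : RPos) (ω : ColoredTiling A) : ColoredTiling A where
  tiles := (fun p : Tile × A => (p.1.scale l, p.2)) '' ω.tiles
  disjoint := by
    rintro _ ⟨p, hp, rfl⟩ _ ⟨q, hq, rfl⟩ hne
    have hpq : p ≠ q := fun h => hne (by rw [h])
    refine Set.disjoint_left.2 fun z hz hz' => ?_
    exact Set.disjoint_left.1 (ω.disjoint p hp q hq hpq) (Tile.mem_toSet_scale.1 hz)
      (Tile.mem_toSet_scale.1 hz')
  cover := by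
    have hl : (0 : ℝ) < l := l.2
    ext z
    have h := Set.ext_iff.1 ω.cover (z / ((l : ℝ) : ℂ))
    simp only [Set.mem_iUnion, Set.mem_ofPred_eq, exists_prop, Complex.div_ofReal_im,
      div_pos_iff_of_pos_right hl] at h
    simp only [Set.biUnion_image, Set.mem_iUnion, exists_prop, Set.mem_ofPred_eq,
      Tile.mem_closure_toSet_scale]
    exact h

/-- The tiling has a separating line: a vertical line which meets no (open) tile. -/
def HasSeparatingLine (ω : ColoredTiling A) : Prop :=
  ∃ x : ℝ, ∀ p ∈ ω.tiles, Disjoint p.1.toSet {z : ℂ | z.re = x}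

end ColoredTiling

/-! ### Weighted substitutions -/

/-- A weighted substitution `(σ, τ)` on `A`: the word `σ(a)` has `len a ≥ 1` letters `σ a i`, with
weights `τ a i ∈ (0, 1)` that add up to `1`. -/
structure WeightedSubstitution (A : Type*) where
  len : A → ℕ
  len_pos : ∀ a, 0 < len a
  σ : (a : A) → Fin (len a) → A
  τ : (a : A) → Fin (len a) → ℝ
  τ_pos : ∀ a i, 0 < τ a i
  τ_lt_one : ∀ a i, τ a i < 1
  τ_sum : ∀ a, ∑ i, τ a i = 1

namespace WeightedSubstitution

variable {A : Type*} (S : WeightedSubstitution A)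

/-- The weight `τ(a)_i` as a positive real number. -/
def weight (a : A) (i : Fin (S.len a)) : RPos := ⟨S.τ a i, S.τ_pos a i⟩

/-- The word `(σⁿ(a)_k, τⁿ(a)_k)_k` of the letters of `σⁿ(a)` together with their weights. -/
def iterWord : ℕ → A → List (A × RPos)
  | 0, a => [(a, 1)]
  | n + 1, a => (List.ofFn fun i => (S.σ a i, S.weight a i)).flatMap fun p =>
      (iterWord n p.1).map fun q => (q.1, p.2 * q.2)

/-- Primitivity of `σ`: for some `n ≥ 1` every letter occurs in `σⁿ(a)` for every letter `a`. -/
def IsPrimitive : Prop := ∃ n : ℕ, 0 < n ∧ ∀ a a' : A, ∃ w : RPos, (a', w) ∈ S.iterWord n a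

/-- The base set `B(σ, τ)`: the closed subgroup of the positive real numbers generated by all
weights `τⁿ(a)_i` with `σⁿ(a)_i = a`. -/
noncomputable def baseSet : Subgroup RPos :=
  sInf {H : Subgroup RPos | IsClosed (H : Set RPos) ∧
    ∀ (n : ℕ) (a : A) (w : RPos), (a, w) ∈ S.iterWord n a → w ∈ H}

/-- The condition `g(σ(a)_i) G = g(a) τ(a)_i G` on `g`, where `G = B(σ, τ)`. -/
def IsCompatible (g : A → RPos) : Prop :=
  ∀ (a : A) (i : Fin (S.len a)),
    g (S.σ a i) • (S.baseSet : Set RPos) = (g a * S.weight a i) • (S.baseSet : Set RPos)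

/-- The `i`-th child of a tile `R = (x₁, x₂) × (y₁, y₂)` of color `a`. -/
def child (R : Tile) (a : A) (i : Fin (S.len a)) : Tile where
  x₁ := R.x₁ + (R.x₂ - R.x₁) * ∑ j ∈ Finset.Iio i, S.τ a j
  x₂ := R.x₁ + (R.x₂ - R.x₁) * ∑ j ∈ Finset.Iic i, S.τ a j
  y₁ := S.τ a i * R.y₁
  y₂ := R.y₁
  y₁_pos := mul_pos (S.τ_pos a i) R.y₁_pos
  y₁_lt_y₂ := mul_lt_of_lt_one_left R.y₁_pos (S.τ_lt_one a i)
  width_eq := by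
    rw [← Finset.sum_Iio_add_eq_sum_Iic, R.width_eq]
    ring

/-- `Ω(σ, τ, g)'`: the tilings such that every tile of color `a` has its lower side at an ordinate
in `g(a) G`, and has its `i`-th child, with the color `σ(a)_i`, in the tiling for every `i`. -/
def tilings' (g : A → RPos) : Set (ColoredTiling A) :=
  {ω | ∀ (R : Tile) (a : A), (R, a) ∈ ω.tiles →
    (∃ h ∈ S.baseSet, R.y₁ = g a * h) ∧ ∀ i, (S.child R a i, S.σ a i) ∈ ω.tiles}

/-- `Ω(σ, τ, g)''`: the elements of `Ω(σ, τ, g)'` without separating line. -/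
def tilings'' (g : A → RPos) : Set (ColoredTiling A) :=
  {ω | ω ∈ S.tilings' g ∧ ¬ ω.HasSeparatingLine}

/-- `Ω(σ, τ, g)`: the closure of `Ω(σ, τ, g)''`. -/
def tilingSpace (g : A → RPos) : Set (ColoredTiling A) := closure (S.tilings'' g)

/-! ### Closed orbits and the zeta function -/

/-- The orbit `G ω`, where `G = B(σ, τ)`. -/
def orbit (ω : ColoredTiling A) : Set (ColoredTiling A) :=
  {ω' | ∃ l ∈ S.baseSet, ω' = ω.scale l}

/-- The set `Θ` of the closed orbits of `Ω(σ, τ, g)`: the orbits `G ω`, `ω ∈ Ω(σ, τ, g)`, such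
that `l ω = ω` for some `l ∈ G`, `l > 1`. -/
def closedOrbits (g : A → RPos) : Set (Set (ColoredTiling A)) :=
  {ξ | ∃ ω ∈ S.tilingSpace g,
    (∃ l ∈ S.baseSet, 1 < (l : ℝ) ∧ ω.scale l = ω) ∧ ξ = S.orbit ω}

/-- The multiplicative cycles of `ξ`: the `l ∈ G`, `l > 1`, with `l ω = ω` for `ω ∈ ξ`. (For an
orbit of the commutative group `G`, one `ω ∈ ξ` has this property iff all of them have it.) -/
def cycles (ξ : Set (ColoredTiling A)) : Set ℝ :=
  {x | 1 < x ∧ ∃ l ∈ S.baseSet, (l : ℝ) = x ∧ ∀ ω ∈ ξ, ω.scale l = ω}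

/-- `c(ξ)`: the minimum multiplicative cycle of the closed orbit `ξ`. -/
noncomputable def minCycle (ξ : Set (ColoredTiling A)) : ℝ := sInf (S.cycles ξ)

/-- `Z` is the zeta function of the action of `G` on `Ω(σ, τ, g)`: for `Re α > 1` the product of
the factors `(1 - c(ξ)^(-α))⁻¹` over the closed orbits `ξ` converges to `Z α`, and `Z` is
meromorphic on the whole complex plane. (Normal form: `Z` is analytic at every point where it has
no pole, and takes the conventional value `0` at its poles; this makes `Z` unique.) -/
structure IsZeta (g : A → RPos) (Z : ℂ → ℂ) : Prop where
  hasProd : ∀ α : ℂ, 1 < α.re →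
    HasProd (fun ξ : S.closedOrbits g => (1 - (S.minCycle ξ.1 : ℂ) ^ (-α))⁻¹) (Z α)
  meromorphic : MeromorphicNFOn Z Set.univ

/-- The matrix `M_α`, with entries `∑_{i ; σ(a)_i = a'} τ(a)_i ^ α`. -/
noncomputable def matrix [DecidableEq A] (α : ℂ) : Matrix A A ℂ :=
  Matrix.of fun a a' => ∑ i : Fin (S.len a), if S.σ a i = a' then (S.τ a i : ℂ) ^ α else 0

end WeightedSubstitution

end Kamae

/-! A closed orbit is read off along the axis x = 0, which every scaling preserves. Let lω = ω with
l > 1, and suppose that a tile of ω crosses the axis. The tiles crossing it form a two-sided chain,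
each a child of the previous one, and so give a two-sided path of positions (a, i) in the words
σ(a); invariance under l makes this path periodic. Conversely the path fixes the chain up to one
scaling, and going back along the chain its tiles grow to exhaust the half plane, so their
descendants are all of ω. Such orbits therefore correspond to cyclic paths, and 1/c(ξ) is the
product of the weights over the minimal period (`exists_equiv_closedOrbits`, `minCycle_orbit`). The
only cyclic paths left out always take the first letter or always the last one, and they are finite
in number (`finite_extremal_cyclicPaths`).

The Euler product over all cyclic paths is 1/det(I - M_α): tr Nᵏ is a sum over closed walks,
grouping the walks by cycle turns Σ tr Nᵏ/k into a sum of logarithms of Euler factors, and exp(Σ tr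
Nᵏ/k) = 1/det(I - N) (`hasProd_cyclicSeq`). Here N is indexed by edges and satisfies det(I - N) =
det(I - M_α) (`det_one_sub_edgeWeight`).

The closed orbits without a tile crossing the axis are also finite in number
(`finite_closedOrbits_not_hasCrossing`). Each side of such a tiling is fixed by one tile touching
the axis; what remains is the relative size of the two sides. It is a limit of ratios seen in
tilings without separating line, where two neighbouring tiles have a common ancestor, and the
logarithms of these ratios lie in finitely many arithmetic progressions.

Hence ζ is 1/det(I - M_α) times a finite product of factors 1 - w^α or their inverses, w ≠ 1
positive, and these vanish only for Re α = 0. This gives the continuation and the comparison of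
zeros and poles. At α = 1 the determinant vanishes because the rows of M_1 sum to 1; a maximum
principle with primitivity makes the diagonal cofactors nonzero, and comparing the determinant with
a cofactor as α decreases to 1 shows that the zero is simple (`deriv_det_ne_zero`). -/

namespace Kamae

/-! ### Traces of powers and the determinant -/

section TraceDet

attribute [local instance] Matrix.linftyOpNormedRing Matrix.linftyOpNormedAlgebra

variable {n : Type*} [Fintype n] [DecidableEq n]

theorem linftyOpNorm_le_of_sum_norm_le {N : Matrix n n ℂ} {ρ : ℝ} (hρ : 0 ≤ ρ)
    (h : ∀ i, ∑ j, ‖N i j‖ ≤ ρ) : ‖N‖ ≤ ρ := by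
  lift ρ to NNReal using hρ
  rw [Matrix.linfty_opNorm_def, NNReal.coe_le_coe]
  refine Finset.sup_le fun i _ => ?_
  rw [← NNReal.coe_le_coe]
  simpa using h i

theorem norm_trace_le_card_mul_norm (N : Matrix n n ℂ) :
    ‖N.trace‖ ≤ Fintype.card n * ‖N‖ := by
  have h : ∀ i, ‖N i i‖ ≤ ‖N‖ := fun i => by
    rw [Matrix.linfty_opNorm_def]
    have h1 : ‖N i i‖₊ ≤ ∑ j, ‖N i j‖₊ :=
      Finset.single_le_sum (f := fun j => ‖N i j‖₊) (fun _ _ => zero_le) (Finset.mem_univ i)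
    exact_mod_cast h1.trans (Finset.le_sup (f := fun i => ∑ j, ‖N i j‖₊) (Finset.mem_univ i))
  calc ‖N.trace‖ ≤ ∑ i, ‖N i i‖ := norm_sum_le _ _
    _ ≤ ∑ _i : n, ‖N‖ := Finset.sum_le_sum fun i _ => h i
    _ = _ := by simp

theorem norm_trace_pow_le {N : Matrix n n ℂ} {ρ : ℝ} (hρ : 0 ≤ ρ)
    (h : ∀ i, ∑ j, ‖N i j‖ ≤ ρ) (k : ℕ) :
    ‖(N ^ (k + 1)).trace‖ ≤ Fintype.card n * ρ ^ (k + 1) := by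
  refine (norm_trace_le_card_mul_norm _).trans ?_
  gcongr
  exact (norm_pow_le' _ k.succ_pos).trans
    (pow_le_pow_left₀ (norm_nonneg _) (linftyOpNorm_le_of_sum_norm_le hρ h) _)

/-- Jacobi's formula, with the inverse of `1 - t • N` expanded in a geometric series so that the
logarithmic derivative becomes the power series of the traces. -/
theorem hasDerivAt_det_one_sub_smul {N : Matrix n n ℂ} {t : ℂ} (ht : ‖t • N‖ < 1) :
    HasDerivAt (fun t : ℂ => (1 - t • N).det)
      (-(∑' k : ℕ, (N ^ (k + 1)).trace * t ^ k) * (1 - t • N).det) t := by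
  have : CompleteSpace (Matrix n n ℂ) := FiniteDimensional.complete ℂ _
  obtain ⟨B, hB⟩ : ∃ B, B = ∑' k : ℕ, (t • N) ^ k := ⟨_, rfl⟩
  have hs : HasSum (fun k : ℕ => (t • N) ^ k) B :=
    hB ▸ (summable_geometric_of_norm_lt_one ht).hasSum
  have hinv : B * (1 - t • N) = 1 := by
    rw [hB]
    exact geom_series_mul_neg _ ht
  have htr : (N * B).trace = ∑' k : ℕ, (N ^ (k + 1)).trace * t ^ k := by
    have h2 : HasSum (fun k : ℕ => N * (t • N) ^ k) (N * B) := hs.mul_left N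
    have h3 := h2.map (Matrix.traceAddMonoidHom n ℂ) continuous_id.matrix_trace
    refine Eq.trans h3.tsum_eq.symm ?_
    refine tsum_congr fun k => ?_
    simp only [Function.comp, Matrix.traceAddMonoidHom_apply]
    rw [smul_pow, Matrix.mul_smul, Matrix.trace_smul, ← pow_succ', smul_eq_mul, mul_comm]
  -- det(1 + hM) = 1 + tr(M) h + Q(h) h² with a polynomial Q, so only the trace survives at h = 0.
  have hpoly : HasDerivAt (fun h : ℂ => (1 + h • (-(N * B))).det) (-(N * B)).trace 0 := by
    have := ((hasDerivAt_id (0 : ℂ)).const_mul (-(N * B)).trace).const_add 1 |>.add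
      (((Polynomial.hasDerivAt (Matrix.det (1 + (Polynomial.X : Polynomial ℂ) •
        (-(N * B)).map Polynomial.C)).divX.divX 0).mul ((hasDerivAt_id (0 : ℂ)).pow 2)))
    refine (this.congr_deriv (by simp)).congr_of_eventuallyEq (Filter.Eventually.of_forall ?_)
    intro h
    simp only [Pi.add_apply, Pi.mul_apply, Pi.pow_apply, id]
    rw [Matrix.det_one_add_smul, add_assoc]
  have hcomp : HasDerivAt (fun s : ℂ => (1 + (s - t) • (-(N * B))).det)
      (-(N * B)).trace t := by
    have h0 : HasDerivAt (fun h : ℂ => (1 + h • (-(N * B))).det) (-(N * B)).trace (t - t) := by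
      rwa [sub_self]
    exact h0.comp_sub_const t t
  have := hcomp.mul_const (1 - t • N).det
  rw [← htr, ← Matrix.trace_neg]
  -- Since B inverts 1 - tN, one has 1 - sN = (1 - (s - t) N B)(1 - tN).
  refine this.congr_of_eventuallyEq (Filter.Eventually.of_forall fun s => ?_)
  simp only
  rw [← Matrix.det_mul, add_mul, one_mul, smul_mul_assoc, neg_mul, mul_assoc, hinv, mul_one,
    sub_smul]
  congr 1
  simp only [smul_neg]
  abel

/-- With tN in place of N the left side has zero derivative in t by Jacobi's formula, and it equals
1 at t = 0. -/
theorem exp_tsum_trace_pow_mul_det {N : Matrix n n ℂ} {ρ : ℝ} (hρ : 0 ≤ ρ) (hρ1 : ρ < 1)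
    (h : ∀ i, ∑ j, ‖N i j‖ ≤ ρ) :
    Complex.exp (∑' k : ℕ, (N ^ (k + 1)).trace / (k + 1)) * (1 - N).det = 1 := by
  -- A radius above 1 puts t = 1 inside the disc, while rρ < 1 keeps the trace series convergent on
  -- it.
  obtain ⟨r, hr1, hr⟩ : ∃ r : ℝ, 1 < r ∧ r * ρ < 1 := by
    refine ⟨2 / (1 + ρ), ?_, ?_⟩
    · rw [lt_div_iff₀ (by linarith)]; linarith
    · rw [div_mul_eq_mul_div, div_lt_one (by linarith)]; linarith
  have hN := linftyOpNorm_le_of_sum_norm_le hρ h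
  have hball : ∀ t ∈ Metric.ball (0 : ℂ) r, ‖t • N‖ < 1 := fun t ht => by
    rw [mem_ball_zero_iff] at ht
    rw [norm_smul]
    calc ‖t‖ * ‖N‖ ≤ r * ρ := by gcongr
      _ < 1 := hr
  have hL : ∀ t ∈ Metric.ball (0 : ℂ) r,
      HasDerivAt (fun t : ℂ => ∑' k : ℕ, (N ^ (k + 1)).trace / (k + 1) * t ^ (k + 1))
        (∑' k : ℕ, (N ^ (k + 1)).trace * t ^ k) t := by
    intro t ht
    have hu : Summable fun k : ℕ => Fintype.card n * ρ * (r * ρ) ^ k :=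
      (summable_geometric_of_lt_one (by positivity) hr).mul_left _
    refine hasDerivAt_tsum_of_isPreconnected (𝕜 := ℂ)
      (g := fun (k : ℕ) (t : ℂ) => (N ^ (k + 1)).trace / ((k : ℂ) + 1) * t ^ (k + 1))
      (g' := fun (k : ℕ) (t : ℂ) => (N ^ (k + 1)).trace * t ^ k) (t := Metric.ball (0 : ℂ) r)
      (y₀ := 0) hu
      Metric.isOpen_ball (convex_ball (0 : ℂ) r).isPreconnected ?_ ?_
      (Metric.mem_ball_self (by linarith)) ?_ ht
    · intro k y _
      have := (hasDerivAt_pow (k + 1) y).const_mul ((N ^ (k + 1)).trace / ((k : ℂ) + 1))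
      refine this.congr_deriv ?_
      have : (k : ℂ) + 1 ≠ 0 := Nat.cast_add_one_ne_zero k
      push_cast
      field_simp
    · intro k y hy
      rw [mem_ball_zero_iff] at hy
      rw [norm_mul, norm_pow]
      calc _ ≤ (Fintype.card n * ρ ^ (k + 1)) * r ^ k := by
            gcongr
            exact norm_trace_pow_le hρ h k
        _ = _ := by ring
    · simp only [zero_pow (Nat.succ_ne_zero _), mul_zero]
      exact summable_zero
  have hconst : ∀ t ∈ Metric.ball (0 : ℂ) r,
      HasDerivAt (fun t : ℂ => Complex.exp (∑' k : ℕ, (N ^ (k + 1)).trace / (k + 1) * t ^ (k + 1))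
        * (1 - t • N).det) 0 t := by
    intro t ht
    refine ((hL t ht).cexp.mul (hasDerivAt_det_one_sub_smul (hball t ht))).congr_deriv ?_
    ring
  have h1 : (1 : ℂ) ∈ Metric.ball (0 : ℂ) r := by simpa using hr1
  have h0 : (0 : ℂ) ∈ Metric.ball (0 : ℂ) r := Metric.mem_ball_self (by linarith)
  have := Metric.isOpen_ball.is_const_of_deriv_eq_zero (𝕜 := ℂ)
    (f := fun t : ℂ => Complex.exp (∑' k : ℕ, (N ^ (k + 1)).trace / (k + 1) * t ^ (k + 1))
        * (1 - t • N).det) (convex_ball (0 : ℂ) r).isPreconnected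
    (fun t ht => (hconst t ht).differentiableAt.differentiableWithinAt)
    (fun t ht => (hconst t ht).deriv) h1 h0
  simpa using this

end TraceDet

end Kamae

namespace Kamae

/-! ### Periodic sequences and the Euler product of a matrix -/

/-- The two-sided periodic sequences with values in `E`. -/
abbrev PeriodicSeq (E : Type*) : Type _ := {x : ℤ → E // ∃ k : ℕ, 0 < k ∧ ∀ n, x (n + k) = x n}

namespace PeriodicSeq

variable {E : Type*}

/-- The shift of the periodic sequences. -/
def shift : Equiv.Perm (PeriodicSeq E) where
  toFun x := ⟨fun n => x.1 (n + 1), by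
    obtain ⟨k, hk, h⟩ := x.2
    refine ⟨k, hk, fun n => ?_⟩
    simp only
    rw [add_right_comm, h]⟩
  invFun x := ⟨fun n => x.1 (n - 1), by
    obtain ⟨k, hk, h⟩ := x.2
    refine ⟨k, hk, fun n => ?_⟩
    simp only
    rw [add_sub_right_comm, h]⟩
  left_inv x := by ext n; simp
  right_inv x := by ext n; simp

@[simp] theorem shift_apply (x : PeriodicSeq E) (n : ℤ) : (shift x).1 n = x.1 (n + 1) := rfl

theorem shift_pow_apply (x : PeriodicSeq E) (m : ℕ) (n : ℤ) :
    ((shift ^ m) x).1 n = x.1 (n + m) := by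
  induction m generalizing n with
  | zero => simp
  | succ m ih =>
    rw [pow_succ', Equiv.Perm.mul_apply, shift_apply, ih]
    exact congrArg x.1 (by push_cast; ring)

theorem shift_zpow_apply (x : PeriodicSeq E) (m n : ℤ) :
    ((shift ^ m) x).1 n = x.1 (n + m) := by
  obtain ⟨k, rfl | rfl⟩ := m.eq_nat_or_neg
  · rw [zpow_natCast, shift_pow_apply]
  · have h := shift_pow_apply ((shift ^ (-(k : ℤ))) x) k (n - k)
    rw [← zpow_natCast, ← Equiv.Perm.mul_apply, ← zpow_add, add_neg_cancel, zpow_zero] at h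
    rw [← sub_eq_add_neg, ← show (1 : Equiv.Perm (PeriodicSeq E)) x = x from rfl, h]
    simp

theorem isPeriodicPt_iff {x : PeriodicSeq E} {k : ℕ} :
    Function.IsPeriodicPt shift k x ↔ ∀ n, x.1 (n + k) = x.1 n := by
  rw [Function.IsPeriodicPt, Function.IsFixedPt, Equiv.Perm.iterate_eq_pow, Subtype.ext_iff,
    funext_iff]
  simp only [shift_pow_apply]

theorem minimalPeriod_pos (x : PeriodicSeq E) : 0 < Function.minimalPeriod shift x := by
  obtain ⟨k, hk, h⟩ := x.2
  exact Function.IsPeriodicPt.minimalPeriod_pos hk (isPeriodicPt_iff.2 h)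

theorem minimalPeriod_zpow (x : PeriodicSeq E) (m : ℤ) :
    Function.minimalPeriod shift ((shift ^ m) x) = Function.minimalPeriod shift x := by
  refine Function.minimalPeriod_eq_minimalPeriod_iff.2 fun k => ?_
  rw [isPeriodicPt_iff, isPeriodicPt_iff]
  simp only [shift_zpow_apply]
  refine ⟨fun h n => ?_, fun h n => ?_⟩
  · have := h (n - m)
    rwa [sub_add_cancel, add_right_comm, sub_add_cancel] at this
  · rw [add_right_comm, h]

/-- The product of the weights `N` along the first `k` transitions of `x`. -/
def weight {R : Type*} [CommMonoid R] (N : E → E → R) (k : ℕ) (x : PeriodicSeq E) : R :=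
  ∏ i ∈ Finset.range k, N (x.1 i) (x.1 (i + 1))

theorem weight_shift {R : Type*} [CommMonoid R] (N : E → E → R) {k : ℕ} {x : PeriodicSeq E}
    (h : Function.IsPeriodicPt shift k x) : weight N k (shift x) = weight N k x := by
  rcases k with _ | k
  · simp [weight]
  · rw [isPeriodicPt_iff] at h
    simp only [weight, shift_apply]
    rw [Finset.prod_range_succ, Finset.prod_range_succ' (n := k)]
    have h0 := h 0
    have h1 := h 1
    push_cast at h0 h1 ⊢
    rw [zero_add] at h0
    rw [h0, add_comm ((k : ℤ) + 1) 1, h1]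

theorem weight_shift_zpow {R : Type*} [CommMonoid R] (N : E → E → R) {k : ℕ} {x : PeriodicSeq E}
    (h : Function.IsPeriodicPt shift k x) (m : ℤ) :
    weight N k ((shift ^ m) x) = weight N k x := by
  have hper : ∀ m : ℤ, Function.IsPeriodicPt shift k ((shift ^ m) x) := fun m => by
    rw [isPeriodicPt_iff] at h ⊢
    intro n
    rw [shift_zpow_apply, shift_zpow_apply, add_right_comm, h]
  induction m with
  | zero => rfl
  | succ i ih =>
    rw [← ih, add_comm, zpow_add, zpow_one, Equiv.Perm.mul_apply, weight_shift _ (hper _)]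
  | pred i ih =>
    rw [← ih, ← weight_shift _ (hper (-i - 1)), ← Equiv.Perm.mul_apply, ← zpow_one_add]
    exact congrArg (fun m : ℤ => PeriodicSeq.weight N k ((shift ^ m) x)) (by ring)

theorem weight_mul {R : Type*} [CommMonoid R] (N : E → E → R) {k : ℕ} {x : PeriodicSeq E}
    (h : Function.IsPeriodicPt shift k x) (j : ℕ) : weight N (k * j) x = weight N k x ^ j := by
  induction j with
  | zero => simp [weight]
  | succ j ih =>
    rw [pow_succ, ← ih, Nat.mul_succ, weight, Finset.prod_range_add]
    congr 1
    have h' := isPeriodicPt_iff.1 (h.mul_const j)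
    refine Finset.prod_congr rfl fun i _ => ?_
    rw [← h' i, ← h' (i + 1)]
    exact congrArg₂ N (congrArg x.1 (by push_cast; ring)) (congrArg x.1 (by push_cast; ring))

end PeriodicSeq

/-- The orbits of the shift on the periodic sequences. -/
abbrev CyclicSeq (E : Type*) : Type _ :=
  Quotient (Equiv.Perm.SameCycle.setoid (PeriodicSeq.shift (E := E)))

namespace CyclicSeq

open PeriodicSeq

variable {E : Type*}

/-- The product of the weights `N` along the minimal period of a cyclic sequence. -/
noncomputable def weight {R : Type*} [CommMonoid R] (N : E → E → R) : CyclicSeq E → R :=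
  Quotient.lift (fun x => PeriodicSeq.weight N (Function.minimalPeriod shift x) x) (by
    rintro x y ⟨m, rfl⟩
    simp only [minimalPeriod_zpow]
    rw [weight_shift_zpow _ (Function.isPeriodicPt_minimalPeriod _ _)])

theorem weight_mk {R : Type*} [CommMonoid R] (N : E → E → R) (x : PeriodicSeq E) :
    weight N (Quotient.mk _ x) = PeriodicSeq.weight N (Function.minimalPeriod shift x) x := rfl

end CyclicSeq

/-! ### Closed walks, cyclic sequences and the Euler product -/

section Euler

open PeriodicSeq

variable {E : Type*}

/-- The last transition, to `b`, stays outside the product so that `b = a` closes the walk in the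
trace. -/
theorem matrix_pow_succ_apply [Fintype E] [DecidableEq E] {R : Type*} [CommSemiring R]
    (N : Matrix E E R) (k : ℕ) (a b : E) :
    (N ^ (k + 1)) a b = ∑ u : Fin (k + 1) → E, if u 0 = a then
      (∏ i : Fin k, N (u i.castSucc) (u i.succ)) * N (u (Fin.last k)) b else 0 := by
  induction k generalizing b with
  | zero =>
    rw [← (Equiv.funUnique (Fin 1) E).symm.sum_comp]
    simp
  | succ k ih =>
    rw [pow_succ, Matrix.mul_apply, ← (Fin.snocEquiv fun _ : Fin (k + 2) => E).sum_comp,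
      Fintype.sum_prod_type]
    refine Finset.sum_congr rfl fun c _ => ?_
    rw [ih, Finset.sum_mul]
    refine Finset.sum_congr rfl fun u _ => ?_
    have h0 : Fin.snocEquiv (fun _ : Fin (k + 2) => E) (c, u) 0 = u 0 :=
      Fin.snoc_castSucc (α := fun _ => E) c u 0
    have h1 : ∀ i : Fin (k + 1), Fin.snocEquiv (fun _ : Fin (k + 2) => E) (c, u) i.castSucc = u i :=
      fun i => Fin.snoc_castSucc (α := fun _ => E) c u i
    have h2 : Fin.snocEquiv (fun _ : Fin (k + 2) => E) (c, u) (Fin.last _) = c :=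
      Fin.snoc_last (α := fun _ => E) c u
    rw [h0, ite_mul, zero_mul, h2, Fin.prod_univ_castSucc]
    simp only [← Fin.castSucc_succ, Fin.succ_last, h1, h2]

theorem trace_pow_succ [Fintype E] [DecidableEq E] {R : Type*} [CommSemiring R]
    (N : Matrix E E R) (k : ℕ) :
    (N ^ (k + 1)).trace = ∑ u : Fin (k + 1) → E, ∏ i, N (u i) (u (i + 1)) := by
  simp only [Matrix.trace, Matrix.diag_apply, matrix_pow_succ_apply]
  rw [Finset.sum_comm]
  refine Finset.sum_congr rfl fun u _ => ?_
  rw [Finset.sum_ite_eq, if_pos (Finset.mem_univ _), Fin.prod_univ_castSucc]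
  simp

/-- The sequences of period `k + 1` are given by their first `k + 1` terms. -/
def periodicSeqEquiv (k : ℕ) :
    {x : PeriodicSeq E // Function.IsPeriodicPt shift (k + 1) x} ≃ (Fin (k + 1) → E) where
  toFun x i := x.1.1 (i : ℕ)
  invFun u :=
    -- `ZMod (k + 1)` unfolds to `Fin (k + 1)`, so an integer reduced modulo k + 1 indexes `u`
    -- directly.
    have h : ∀ n : ℤ, u (((n + (k + 1 : ℕ) : ℤ) : ZMod (k + 1)) : ZMod (k + 1)) =
        u ((n : ZMod (k + 1)) : ZMod (k + 1)) := fun n => congrArg u (by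
      rw [Int.cast_add, Int.cast_natCast, CharP.cast_eq_zero (ZMod (k + 1)) (k + 1), add_zero])
    ⟨⟨fun n => u ((n : ZMod (k + 1)) : ZMod (k + 1)), k + 1, k.succ_pos, h⟩,
      isPeriodicPt_iff.2 h⟩
  left_inv x := by
    ext n
    have h := isPeriodicPt_iff.1 x.2
    show x.1.1 ((((n : ZMod (k + 1)) : ZMod (k + 1)).val : ℕ) : ℤ) = x.1.1 n
    rw [ZMod.val_intCast]
    have hz : Function.Periodic x.1.1 ((k + 1 : ℕ) : ℤ) := h
    conv_rhs => rw [← Int.emod_add_mul_ediv n ((k + 1 : ℕ) : ℤ)]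
    rw [mul_comm]
    exact (hz.int_mul _ _).symm
  right_inv u := by
    ext i
    show u _ = u i
    congr 1
    exact ZMod.natCast_zmod_val (n := k + 1) i

theorem weight_periodicSeqEquiv {R : Type*} [CommMonoid R] (N : E → E → R) (k : ℕ)
    (x : {x : PeriodicSeq E // Function.IsPeriodicPt shift (k + 1) x}) :
    PeriodicSeq.weight N (k + 1) x.1 =
      ∏ i, N (periodicSeqEquiv k x i) (periodicSeqEquiv k x (i + 1)) := by
  rw [PeriodicSeq.weight, ← Fin.prod_univ_eq_prod_range (fun i => N (x.1.1 i) (x.1.1 (i + 1)))]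
  refine Finset.prod_congr rfl fun i _ => ?_
  show N _ _ = N (x.1.1 (i : ℕ)) (x.1.1 ((i + 1 : Fin (k + 1)) : ℕ))
  congr 1
  rw [Fin.val_add_one]
  split_ifs with h
  · subst h
    have := isPeriodicPt_iff.1 x.2 0
    simpa using this
  · push_cast; rfl

/-- The pairs of a period `k + 1` and a sequence of this period. -/
abbrev PeriodPair (E : Type*) : Type _ :=
  Σ k : ℕ, {x : PeriodicSeq E // Function.IsPeriodicPt shift (k + 1) x}

theorem hasSum_weight_eq_trace_pow [Fintype E] [DecidableEq E] (N : E → E → ℂ) (k : ℕ) :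
    HasSum (fun x : {x : PeriodicSeq E // Function.IsPeriodicPt shift (k + 1) x} =>
      PeriodicSeq.weight N (k + 1) x.1) (Matrix.of N ^ (k + 1)).trace := by
  rw [trace_pow_succ, ← (periodicSeqEquiv k).symm.hasSum_iff]
  convert hasSum_fintype _ using 2 with u
  exact ((weight_periodicSeqEquiv N k _).trans
    (by simp only [Equiv.apply_symm_apply, Matrix.of_apply])).symm

/-- Replacing the entries by their absolute values turns the sum of the norms at a fixed period into
a trace, which decays geometrically in the period. -/
theorem summable_norm_weight_div [Fintype E] [DecidableEq E] {N : E → E → ℂ} {ρ : ℝ}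
    (hρ : 0 ≤ ρ) (hρ1 : ρ < 1) (h : ∀ i, ∑ j, ‖N i j‖ ≤ ρ) :
    Summable fun q : PeriodPair E =>
      ‖PeriodicSeq.weight N (q.1 + 1) q.2.1 / ((q.1 : ℂ) + 1)‖ := by
  obtain ⟨N', hN'⟩ : ∃ N' : E → E → ℂ, N' = fun i j => (‖N i j‖ : ℂ) := ⟨_, rfl⟩
  have h' : ∀ i, ∑ j, ‖Matrix.of N' i j‖ ≤ ρ := by simpa [hN'] using h
  have hw : ∀ k x, PeriodicSeq.weight N' k x = (‖PeriodicSeq.weight N k x‖ : ℂ) := by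
    intro k x
    simp [PeriodicSeq.weight, hN']
  have hs : ∀ k : ℕ, HasSum (fun x : {x : PeriodicSeq E // Function.IsPeriodicPt shift (k + 1) x} =>
      ‖PeriodicSeq.weight N (k + 1) x.1‖) (Matrix.of N' ^ (k + 1)).trace.re := fun k => by
    have := Complex.hasSum_re (hasSum_weight_eq_trace_pow N' k)
    simpa only [hw, Complex.ofReal_re] using this
  have hle : ∀ k : ℕ, ∑' x : {x : PeriodicSeq E // Function.IsPeriodicPt shift (k + 1) x},
      ‖PeriodicSeq.weight N (k + 1) x.1‖ ≤ Fintype.card E * ρ ^ (k + 1) := fun k => by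
    rw [(hs k).tsum_eq]
    exact (Complex.re_le_norm _).trans (norm_trace_pow_le hρ h' k)
  have hle1 : ∀ (k : ℕ) (x : PeriodicSeq E), ‖PeriodicSeq.weight N (k + 1) x / ((k : ℂ) + 1)‖ ≤
      ‖PeriodicSeq.weight N (k + 1) x‖ := fun k x => by
    rw [norm_div]
    refine div_le_self (norm_nonneg _) ?_
    rw [← Nat.cast_add_one, Complex.norm_natCast]
    exact_mod_cast Nat.le_add_left 1 k
  refine Summable.of_nonneg_of_le (fun _ => norm_nonneg _) (fun q => hle1 q.1 q.2.1) ?_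
  rw [summable_sigma_of_nonneg fun _ => norm_nonneg _]
  refine ⟨fun k => (hs k).summable, ?_⟩
  refine Summable.of_nonneg_of_le (fun _ => tsum_nonneg fun _ => norm_nonneg _) hle ?_
  exact ((summable_nat_add_iff 1).2 (summable_geometric_of_lt_one hρ hρ1)).mul_left _

/-- The pairs of a period and a sequence in the orbit of `x`. -/
noncomputable def orbitPeriodPair (x : PeriodicSeq E) (p : ℕ × Fin (Function.minimalPeriod shift x)) :
    {q : PeriodPair E // (Quotient.mk _ q.2.1 : CyclicSeq E) = Quotient.mk _ x} :=
  -- The first component of a `PeriodPair` is the period minus one.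
  ⟨⟨Function.minimalPeriod shift x * (p.1 + 1) - 1, (shift ^ (p.2 : ℤ)) x, by
    rw [Nat.sub_add_cancel (Nat.mul_pos (minimalPeriod_pos x) p.1.succ_pos)]
    have := Function.isPeriodicPt_minimalPeriod shift ((shift ^ ((p.2 : ℕ) : ℤ)) x)
    rw [minimalPeriod_zpow] at this
    exact this.mul_const _⟩,
    Quotient.sound (Equiv.Perm.SameCycle.symm ⟨_, rfl⟩)⟩

theorem orbitPeriodPair_bijective (x : PeriodicSeq E) :
    Function.Bijective (orbitPeriodPair x) := by
  have hp := minimalPeriod_pos x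
  constructor
  · rintro ⟨j, i⟩ ⟨j', i'⟩ hEq
    replace hEq := congrArg Subtype.val hEq
    have h1 := congrArg Sigma.fst hEq
    have h2 := congrArg (fun q : PeriodPair E => q.2.1) hEq
    simp only [orbitPeriodPair] at h1 h2
    have hj : j = j' := by
      have a1 := Nat.mul_pos hp j.succ_pos
      have a2 := Nat.mul_pos hp j'.succ_pos
      have : Function.minimalPeriod shift x * (j + 1) = Function.minimalPeriod shift x * (j' + 1) := by
        simp only [Nat.succ_eq_add_one] at a1 a2
        omega
      have := Nat.eq_of_mul_eq_mul_left hp this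
      omega
    have hi : (i : ℕ) = i' := by
      rw [zpow_natCast, zpow_natCast, ← Equiv.Perm.iterate_eq_pow, ← Equiv.Perm.iterate_eq_pow] at h2
      exact Function.iterate_injOn_Iio_minimalPeriod i.2 i'.2 h2
    rw [hj, Fin.ext hi]
  · rintro ⟨⟨k, y, hy⟩, hxy⟩
    obtain ⟨m, rfl⟩ := Equiv.Perm.SameCycle.symm (Quotient.eq.1 hxy)
    have hk : Function.minimalPeriod shift x ∣ k + 1 := by
      rw [← minimalPeriod_zpow x m]
      exact Function.IsPeriodicPt.minimalPeriod_dvd hy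
    obtain ⟨j, hj⟩ := hk
    have hj0 : j ≠ 0 := by rintro rfl; omega
    obtain ⟨j, rfl⟩ := Nat.exists_eq_succ_of_ne_zero hj0
    have hm0 := Int.emod_nonneg m (b := Function.minimalPeriod shift x) (by omega)
    have hm1 := Int.emod_lt_of_pos m (b := Function.minimalPeriod shift x) (by omega)
    have hmx : (shift ^ (m % (Function.minimalPeriod shift x : ℤ))) x = (shift ^ m) x := by
      have h1 : (shift ^ ((Function.minimalPeriod shift x : ℤ) *
          (m / (Function.minimalPeriod shift x : ℤ)))) x = x := by
        have h2 : (shift ^ (Function.minimalPeriod shift x)) x = x := by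
          rw [← Equiv.Perm.iterate_eq_pow]
          exact Function.isPeriodicPt_minimalPeriod shift x
        rw [zpow_mul, zpow_natCast]
        exact Equiv.Perm.zpow_apply_eq_self_of_apply_eq_self h2 _
      conv_rhs => rw [← Int.emod_add_mul_ediv m (Function.minimalPeriod shift x : ℤ), zpow_add,
        Equiv.Perm.mul_apply, h1]
    refine ⟨(j, ⟨(m % (Function.minimalPeriod shift x : ℤ)).toNat, by omega⟩), ?_⟩
    have hk' : Function.minimalPeriod shift x * (j + 1) - 1 = k := by
      simp only [Nat.succ_eq_add_one] at hj
      omega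
    subst hk'
    refine Subtype.ext (Sigma.ext rfl (heq_of_eq (Subtype.ext ?_)))
    simp only [orbitPeriodPair]
    rw [Int.toNat_of_nonneg hm0, hmx]

/-- With p the minimal period and w the weight over it, the pair (j, i) has period p(j + 1) and
weight w^(j+1). The p shifts i compensate the factor 1/p, which leaves the series of -log(1 - w). -/
theorem weight_orbitPeriodPair (N : E → E → ℂ) (x : PeriodicSeq E)
    (p : ℕ × Fin (Function.minimalPeriod shift x)) :
    PeriodicSeq.weight N ((orbitPeriodPair x p).1.1 + 1) (orbitPeriodPair x p).1.2.1 /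
      (((orbitPeriodPair x p).1.1 : ℂ) + 1) =
    CyclicSeq.weight N (Quotient.mk _ x) ^ (p.1 + 1) / ((p.1 + 1 : ℕ) : ℂ) *
      (1 / Function.minimalPeriod shift x) := by
  have hp := minimalPeriod_pos x
  have hp' : (Function.minimalPeriod shift x : ℂ) ≠ 0 := by exact_mod_cast hp.ne'
  have hj : (p.1 : ℂ) + 1 ≠ 0 := Nat.cast_add_one_ne_zero p.1
  have hnat : Function.minimalPeriod shift x * (p.1 + 1) - 1 + 1 =
    Function.minimalPeriod shift x * (p.1 + 1) :=
    Nat.sub_add_cancel (Nat.mul_pos hp p.1.succ_pos)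
  simp only [orbitPeriodPair]
  rw [← Nat.cast_add_one (R := ℂ), hnat, weight_shift_zpow _
    ((Function.isPeriodicPt_minimalPeriod _ _).mul_const _),
    weight_mul _ (Function.isPeriodicPt_minimalPeriod _ _), CyclicSeq.weight_mk]
  push_cast
  field_simp

theorem hasSum_pow_div_mul_fin {w : ℂ} (hw : ‖w‖ < 1) {n : ℕ} (hn : 0 < n) :
    HasSum (fun p : ℕ × Fin n => w ^ (p.1 + 1) / ((p.1 + 1 : ℕ) : ℂ) * (1 / n))
      (-Complex.log (1 - w)) := by
  have hn' : (n : ℂ) ≠ 0 := by exact_mod_cast hn.ne'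
  have hlog := Complex.hasSum_taylorSeries_neg_log hw
  rw [← hasSum_nat_add_iff' 1] at hlog
  simp only [Finset.range_one, Finset.sum_singleton, Nat.cast_zero, div_zero, sub_zero] at hlog
  have hfin := hasSum_fintype (fun _ : Fin n => 1 / (n : ℂ))
  have hone : ∑ _ : Fin n, 1 / (n : ℂ) = 1 := by simp [hn']
  rw [hone] at hfin
  have hsm : Summable fun p : ℕ × Fin n => w ^ (p.1 + 1) / ((p.1 + 1 : ℕ) : ℂ) * (1 / (n : ℂ)) :=
    summable_mul_of_summable_norm (f := fun k : ℕ => w ^ (k + 1) / ((k + 1 : ℕ) : ℂ))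
      (g := fun _ : Fin n => 1 / (n : ℂ)) hlog.summable.norm hfin.summable.norm
  have := HasSum.mul hlog hfin hsm
  rwa [mul_one] at this

theorem hasSum_orbitPeriodPair {N : E → E → ℂ} (x : PeriodicSeq E)
    (hw : ‖CyclicSeq.weight N (Quotient.mk _ x)‖ < 1) :
    HasSum (fun q : {q : PeriodPair E // (Quotient.mk _ q.2.1 : CyclicSeq E) = Quotient.mk _ x} =>
      PeriodicSeq.weight N (q.1.1 + 1) q.1.2.1 / ((q.1.1 : ℂ) + 1))
      (-Complex.log (1 - CyclicSeq.weight N (Quotient.mk _ x))) := by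
  refine ((Equiv.ofBijective _ (orbitPeriodPair_bijective x)).hasSum_iff (f :=
    fun q : {q : PeriodPair E // (Quotient.mk _ q.2.1 : CyclicSeq E) = Quotient.mk _ x} =>
      PeriodicSeq.weight N (q.1.1 + 1) q.1.2.1 / ((q.1.1 : ℂ) + 1))).1 ?_
  exact (hasSum_pow_div_mul_fin hw (minimalPeriod_pos x)).congr_fun fun p =>
    weight_orbitPeriodPair N x p

theorem norm_cyclicWeight_lt_one {N : E → E → ℂ} {ρ : ℝ} (hρ : 0 ≤ ρ) (hρ1 : ρ < 1)
    (h : ∀ i j, ‖N i j‖ ≤ ρ) (γ : CyclicSeq E) : ‖CyclicSeq.weight N γ‖ < 1 := by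
  induction γ using Quotient.inductionOn with | _ x
  rw [CyclicSeq.weight_mk, PeriodicSeq.weight, norm_prod]
  calc _ ≤ ∏ _i ∈ Finset.range (Function.minimalPeriod shift x), ρ :=
        Finset.prod_le_prod (fun _ _ => norm_nonneg _) fun _ _ => h _ _
    _ = ρ ^ Function.minimalPeriod shift x := by simp
    _ < 1 := pow_lt_one₀ hρ hρ1 (minimalPeriod_pos x).ne'

/-- The Euler product `∏ (1 - N(γ))⁻¹` over the cyclic sequences `γ` equals `det (1 - N)⁻¹`. -/
theorem hasProd_cyclicSeq [Fintype E] [DecidableEq E] {N : E → E → ℂ} {ρ : ℝ}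
    (hρ : 0 ≤ ρ) (hρ1 : ρ < 1) (h : ∀ i, ∑ j, ‖N i j‖ ≤ ρ) :
    HasProd (fun γ : CyclicSeq E => (1 - CyclicSeq.weight N γ)⁻¹) (1 - Matrix.of N).det⁻¹ := by
  have hw1 := norm_cyclicWeight_lt_one hρ hρ1 fun i j =>
    (Finset.single_le_sum (f := fun j => ‖N i j‖) (fun _ _ => norm_nonneg _)
      (Finset.mem_univ j)).trans (h i)
  have hne : ∀ γ : CyclicSeq E, 1 - CyclicSeq.weight N γ ≠ 0 := fun γ h0 => by
    have := hw1 γ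
    rw [← sub_eq_zero.1 h0] at this
    simp at this
  have hsum := (summable_norm_weight_div hρ hρ1 h).of_norm
  have hs := hsum.hasSum
  -- Summed period by period, the series gives Σ tr Nᵏ/k; `sigmaFiberEquiv` then regroups the same
  -- series by cyclic sequence, which produces the logarithms of the Euler factors.
  have hT := hs.sigma fun k => (hasSum_weight_eq_trace_pow N k).div_const ((k : ℂ) + 1)
  rw [← hT.tsum_eq] at hs
  let π : PeriodPair E → CyclicSeq E := fun q => Quotient.mk _ q.2.1
  have hs' := ((Equiv.sigmaFiberEquiv π).hasSum_iff).2 hs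
  have hlogs : HasSum (fun γ : CyclicSeq E => -Complex.log (1 - CyclicSeq.weight N γ))
      (∑' k : ℕ, (Matrix.of N ^ (k + 1)).trace / (k + 1)) := by
    refine hs'.sigma fun γ => ?_
    induction γ using Quotient.inductionOn with | _ x
    exact hasSum_orbitPeriodPair x (hw1 _)
  have hfinal := hlogs.cexp
  rw [eq_inv_of_mul_eq_one_left (exp_tsum_trace_pow_mul_det (N := Matrix.of N) hρ hρ1 h)] at hfinal
  convert hfinal using 2 with γ
  rw [Function.comp, Complex.exp_neg, Complex.exp_log (hne γ)]

end Euler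

end Kamae

namespace Kamae

namespace WeightedSubstitution

/-! ### The determinant of `1 - M_α` -/

variable {A : Type*} (S : WeightedSubstitution A)

/-- The positions `(a, i)` of the letters of the words `σ(a)`. -/
abbrev Edge : Type _ := Σ a, Fin (S.len a)

/-- The letter `σ(a)_i`. -/
def Edge.tgt {S : WeightedSubstitution A} (e : S.Edge) : A := S.σ e.1 e.2

/-- The weight `τ(a)_i`. -/
def Edge.wt {S : WeightedSubstitution A} (e : S.Edge) : ℝ := S.τ e.1 e.2

theorem Edge.wt_pos {S : WeightedSubstitution A} (e : S.Edge) : 0 < e.wt := S.τ_pos _ _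

theorem Edge.wt_lt_one {S : WeightedSubstitution A} (e : S.Edge) : e.wt < 1 := S.τ_lt_one _ _

theorem exists_le_weight [Finite A] : ∃ δ : ℝ, 0 < δ ∧ ∀ e : S.Edge, δ ≤ e.wt := by
  rcases isEmpty_or_nonempty S.Edge with h | h
  · exact ⟨1, one_pos, fun e => h.elim e⟩
  · obtain ⟨e, he⟩ := Finite.exists_min (fun e : S.Edge => e.wt)
    exact ⟨e.wt, e.wt_pos, he⟩

theorem exists_weight_le [Finite A] : ∃ ρ : ℝ, 0 < ρ ∧ ρ < 1 ∧ ∀ e : S.Edge, e.wt ≤ ρ := by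
  rcases isEmpty_or_nonempty S.Edge with h | h
  · exact ⟨1 / 2, by norm_num, by norm_num, fun e => h.elim e⟩
  · obtain ⟨e, he⟩ := Finite.exists_max (fun e : S.Edge => e.wt)
    exact ⟨e.wt, e.wt_pos, e.wt_lt_one, he⟩

/-- Split |τ^α| = τ · τ^(Re α - 1) and use that the weights of a word sum to 1. This bound is what
makes everything converge for Re α > 1. -/
theorem sum_norm_cpow_le {ρ : ℝ} (h : ∀ e : S.Edge, e.wt ≤ ρ) {α : ℂ}
    (hα : 1 ≤ α.re) (a : A) : ∑ i, ‖(S.τ a i : ℂ) ^ α‖ ≤ ρ ^ (α.re - 1) := by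
  calc ∑ i, ‖(S.τ a i : ℂ) ^ α‖ = ∑ i, S.τ a i * S.τ a i ^ (α.re - 1) := by
        refine Finset.sum_congr rfl fun i _ => ?_
        rw [Complex.norm_cpow_eq_rpow_re_of_pos (S.τ_pos a i), ← Real.rpow_one_add' (S.τ_pos a i).le]
        · congr 1; ring
        · linarith
    _ ≤ ∑ i, S.τ a i * ρ ^ (α.re - 1) := by
        refine Finset.sum_le_sum fun i _ => mul_le_mul_of_nonneg_left ?_ (S.τ_pos a i).le
        exact Real.rpow_le_rpow (S.τ_pos a i).le (h ⟨a, i⟩) (by linarith)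
    _ = ρ ^ (α.re - 1) := by rw [← Finset.sum_mul, S.τ_sum, one_mul]

/-- Under primitivity, a nonempty set of letters stable under σ is therefore everything; the maximum
principle below relies on this. -/
theorem mem_of_mem_iterWord {U : Set A} (hU : ∀ a ∈ U, ∀ i, S.σ a i ∈ U) (n : ℕ) {a a' : A}
    {w : RPos} (ha : a ∈ U) (h : (a', w) ∈ S.iterWord n a) : a' ∈ U := by
  induction n generalizing a w with
  | zero =>
    simp only [iterWord, List.mem_singleton, Prod.mk.injEq] at h
    rwa [h.1]
  | succ n ih =>
    simp only [iterWord, List.mem_flatMap, List.mem_ofFn, List.mem_map, Prod.mk.injEq] at h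
    obtain ⟨p, ⟨i, rfl⟩, q, hq, rfl, rfl⟩ := h
    exact ih (hU a ha i) hq

theorem continuous_matrix_apply [DecidableEq A] : Continuous fun z : ℂ => S.matrix z := by
  refine continuous_matrix fun a b => ?_
  simp only [matrix, Matrix.of_apply]
  refine continuous_finsetSum _ fun i _ => ?_
  split_ifs
  · exact continuous_id.const_cpow (Or.inl (by exact_mod_cast (S.τ_pos a i).ne'))
  · exact continuous_const

variable [Fintype A] [DecidableEq A]

/-- The weights of the transitions between edges. -/
noncomputable def edgeWeight (α : ℂ) (e f : S.Edge) : ℂ :=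
  if e.tgt = f.1 then (f.wt : ℂ) ^ α else 0

theorem sum_norm_edgeWeight_le {ρ : ℝ} (h : ∀ e : S.Edge, e.wt ≤ ρ) {α : ℂ}
    (hα : 1 ≤ α.re) (e : S.Edge) : ∑ f, ‖S.edgeWeight α e f‖ ≤ ρ ^ (α.re - 1) := by
  refine le_trans (le_of_eq ?_) (S.sum_norm_cpow_le h hα e.tgt)
  rw [Fintype.sum_sigma, Finset.sum_eq_single e.tgt]
  · exact Finset.sum_congr rfl fun i _ => by rw [edgeWeight, if_pos rfl]; rfl
  · intro b _ hb
    exact Finset.sum_eq_zero fun i _ => by rw [edgeWeight, if_neg (Ne.symm hb), norm_zero]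
  · simp

/-- An entry of M_α may add up several positions, whereas a pair of edges allows at most one
transition, so that closed walks of edges are single paths. Both matrices are products of the same
two rectangular matrices in opposite orders, and det(1 - XY) = det(1 - YX). -/
theorem det_one_sub_edgeWeight (α : ℂ) :
    (1 - Matrix.of (S.edgeWeight α)).det = (1 - S.matrix α).det := by
  have h1 : Matrix.of (S.edgeWeight α) =
      (Matrix.of fun (e : S.Edge) (a : A) => if e.tgt = a then (1 : ℂ) else 0) *
      (Matrix.of fun (a : A) (f : S.Edge) => if a = f.1 then (f.wt : ℂ) ^ α else 0) := by
    ext e f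
    simp [Matrix.mul_apply, edgeWeight]
  have h2 : S.matrix α =
      (Matrix.of fun (a : A) (f : S.Edge) => if a = f.1 then (f.wt : ℂ) ^ α else 0) *
      (Matrix.of fun (e : S.Edge) (a : A) => if e.tgt = a then (1 : ℂ) else 0) := by
    ext a b
    rw [Matrix.mul_apply, Fintype.sum_sigma, Finset.sum_eq_single a]
    · simp only [matrix, Matrix.of_apply, if_true]
      refine Finset.sum_congr rfl fun i _ => ?_
      by_cases h : S.σ a i = b
      · rw [if_pos h, if_pos (show Edge.tgt ⟨a, i⟩ = b from h), mul_one]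
        rfl
      · rw [if_neg h, if_neg (show ¬ Edge.tgt ⟨a, i⟩ = b from h), mul_zero]
    · intro c _ hc
      simp [Ne.symm hc]
    · simp
  rw [h1, h2, Matrix.det_one_sub_mul_comm]

theorem det_one_sub_matrix_ne_zero {α : ℂ} (hα : 1 < α.re) : (1 - S.matrix α).det ≠ 0 := by
  obtain ⟨ρ, hρ, hρ1, h⟩ := S.exists_weight_le
  rw [← det_one_sub_edgeWeight]
  exact right_ne_zero_of_mul_eq_one (exp_tsum_trace_pow_mul_det (N := Matrix.of (S.edgeWeight α))
    (Real.rpow_nonneg hρ.le _) (Real.rpow_lt_one hρ.le hρ1 (sub_pos.2 hα))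
    (S.sum_norm_edgeWeight_le h hα.le))

theorem matrix_mulVec (α : ℂ) (v : A → ℂ) (a : A) :
    (S.matrix α).mulVec v a = ∑ i, (S.τ a i : ℂ) ^ α * v (S.σ a i) := by
  simp only [Matrix.mulVec, dotProduct, matrix, Matrix.of_apply, Finset.sum_mul, ite_mul, zero_mul]
  rw [Finset.sum_comm]
  simp

theorem differentiable_det : Differentiable ℂ fun z : ℂ => (1 - S.matrix z).det := by
  have h : ∀ a b, Differentiable ℂ fun z : ℂ => (1 - S.matrix z) a b := by
    intro a b
    simp only [Matrix.sub_apply, matrix, Matrix.of_apply]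
    refine (differentiable_const _).sub (Differentiable.fun_sum fun i _ => ?_)
    split_ifs
    · exact differentiable_id.const_cpow (Or.inl (by exact_mod_cast (S.τ_pos a i).ne'))
    · exact differentiable_const _
  simp only [Matrix.det_apply]
  exact Differentiable.fun_sum fun p _ => Differentiable.const_smul
    (Differentiable.fun_finsetProd fun i _ => h _ _) _

/-- The column x of the adjugate satisfies x = Mx + det · e_a. At a coordinate of maximal modulus,
Mx is at most ρ^(Re α - 1) times that modulus. This bounds the determinant from below near α = 1. -/
theorem norm_adjugate_mul_le {ρ : ℝ} (hρ : 0 < ρ) (hρ1 : ρ < 1) (h : ∀ e : S.Edge, e.wt ≤ ρ)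
    {α : ℂ} (hα : 1 ≤ α.re) (a : A) :
    (1 - ρ ^ (α.re - 1)) * ‖(1 - S.matrix α).adjugate a a‖ ≤ ‖(1 - S.matrix α).det‖ := by
  have : Nonempty A := ⟨a⟩
  obtain ⟨x, hx⟩ : ∃ x : A → ℂ, x = fun b => (1 - S.matrix α).adjugate b a := ⟨_, rfl⟩
  obtain ⟨b, hb⟩ := Finite.exists_max fun b => ‖x b‖
  have h1 : ρ ^ (α.re - 1) ≤ 1 := Real.rpow_le_one hρ.le hρ1.le (by linarith)
  have heq : x b = (S.matrix α).mulVec x b + (1 - S.matrix α).det * (1 : Matrix A A ℂ) b a := by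
    have := congrFun (congrFun (Matrix.mul_adjugate (1 - S.matrix α)) b) a
    rw [sub_mul, one_mul, Matrix.sub_apply, Matrix.smul_apply, smul_eq_mul] at this
    rw [← this, hx]
    simp [Matrix.mul_apply, Matrix.mulVec, dotProduct]
  have hle : ‖x b‖ ≤ ρ ^ (α.re - 1) * ‖x b‖ + ‖(1 - S.matrix α).det‖ := by
    conv_lhs => rw [heq]
    refine (norm_add_le _ _).trans (add_le_add ?_ ?_)
    · rw [matrix_mulVec]
      calc _ ≤ ∑ i, ‖(S.τ b i : ℂ) ^ α * x (S.σ b i)‖ := norm_sum_le _ _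
        _ ≤ ∑ i, ‖(S.τ b i : ℂ) ^ α‖ * ‖x b‖ := Finset.sum_le_sum fun i _ => by
            rw [norm_mul]
            exact mul_le_mul_of_nonneg_left (hb _) (norm_nonneg _)
        _ ≤ _ := by
            rw [← Finset.sum_mul]
            exact mul_le_mul_of_nonneg_right (S.sum_norm_cpow_le h hα b) (norm_nonneg _)
    · rw [norm_mul, Matrix.one_apply]
      split_ifs <;> simp
  have hxa : ‖(1 - S.matrix α).adjugate a a‖ ≤ ‖x b‖ := by
    have := hb a
    rwa [hx] at this ⊢
  calc _ ≤ (1 - ρ ^ (α.re - 1)) * ‖x b‖ := mul_le_mul_of_nonneg_left hxa (by linarith)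
    _ ≤ _ := by linarith

/-- The cofactor is the determinant after row a is replaced by e_a. A kernel vector v vanishes at a
and is a weighted mean of its values along σ(b) at every other b. The letters where |v| is maximal
are thus stable under σ, and primitivity leads from them to a, where v = 0. -/
theorem adjugate_ne_zero (hS : S.IsPrimitive) (a : A) : (1 - S.matrix 1).adjugate a a ≠ 0 := by
  rw [Matrix.adjugate_apply]
  intro hdet
  obtain ⟨v, hv0, hv⟩ := Matrix.exists_mulVec_eq_zero_iff.2 hdet
  have : Nonempty A := ⟨a⟩
  have hva : v a = 0 := by
    have := congrFun hv a
    simpa [Matrix.mulVec, Matrix.updateRow_self] using this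
  have hvb : ∀ b, b ≠ a → v b = ∑ i, (S.τ b i : ℂ) * v (S.σ b i) := by
    intro b hb
    have := congrFun hv b
    rw [Matrix.mulVec, Matrix.updateRow_ne hb] at this
    have h2 : (1 - S.matrix 1).mulVec v b = 0 := this
    rw [Matrix.sub_mulVec, Pi.sub_apply, Matrix.one_mulVec, matrix_mulVec, sub_eq_zero] at h2
    simpa using h2
  obtain ⟨b, hb⟩ := Finite.exists_max fun b => ‖v b‖
  have hbpos : 0 < ‖v b‖ := by
    obtain ⟨c, hc⟩ := Function.ne_iff.1 hv0
    exact (norm_pos_iff.2 hc).trans_le (hb c)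
  have hU : ∀ c ∈ {c | ‖v c‖ = ‖v b‖}, ∀ i, S.σ c i ∈ {c | ‖v c‖ = ‖v b‖} := by
    intro c hc i
    have hca : c ≠ a := by
      rintro rfl
      rw [Set.mem_ofPred_eq, hva, norm_zero] at hc
      exact hbpos.ne hc
    by_contra hi
    have hlt : ‖v (S.σ c i)‖ < ‖v b‖ := lt_of_le_of_ne (hb _) hi
    have : ‖v c‖ < ‖v b‖ := by
      calc ‖v c‖ ≤ ∑ j, ‖(S.τ c j : ℂ) * v (S.σ c j)‖ := by rw [hvb c hca]; exact norm_sum_le _ _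
        _ = ∑ j, S.τ c j * ‖v (S.σ c j)‖ := Finset.sum_congr rfl fun j _ => by
            rw [norm_mul, Complex.norm_real, Real.norm_of_nonneg (S.τ_pos c j).le]
        _ < ∑ j, S.τ c j * ‖v b‖ := Finset.sum_lt_sum
            (fun j _ => mul_le_mul_of_nonneg_left (hb _) (S.τ_pos c j).le)
            ⟨i, Finset.mem_univ _, mul_lt_mul_of_pos_left hlt (S.τ_pos c i)⟩
        _ = ‖v b‖ := by rw [← Finset.sum_mul, S.τ_sum, one_mul]
    exact this.ne hc
  obtain ⟨n, -, hn⟩ := hS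
  obtain ⟨w, hw⟩ := hn b a
  have : ‖v a‖ = ‖v b‖ := S.mem_of_mem_iterWord (U := {c | ‖v c‖ = ‖v b‖}) hU n rfl hw
  rw [hva, norm_zero] at this
  exact hbpos.ne this

theorem det_one_sub_matrix_one [Nonempty A] : (1 - S.matrix 1).det = 0 := by
  refine Matrix.exists_mulVec_eq_zero_iff.1 ⟨fun _ => 1, ?_, ?_⟩
  · exact Function.ne_iff.2 ⟨Classical.arbitrary A, one_ne_zero⟩
  · ext a
    rw [Matrix.sub_mulVec, Pi.sub_apply, Matrix.one_mulVec, matrix_mulVec]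
    have := S.τ_sum a
    simp only [Complex.cpow_one, mul_one, Pi.zero_apply]
    rw [← Complex.ofReal_sum, this]
    simp

/-- If the derivative vanished, |det|/(s - 1) would tend to 0 as s decreases to 1. By
`norm_adjugate_mul_le` it is at least (1 - ρ^(s-1))/(s - 1) times the cofactor, whose limit -log ρ ·
|cofactor| is positive. -/
theorem deriv_det_ne_zero [Nonempty A] (hS : S.IsPrimitive) :
    deriv (fun z : ℂ => (1 - S.matrix z).det) 1 ≠ 0 := by
  intro h0
  obtain ⟨ρ, hρ, hρ1, h⟩ := S.exists_weight_le
  let a : A := Classical.arbitrary A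
  have hd : HasDerivAt (fun s : ℝ => (1 - S.matrix (s : ℂ)).det) 0 1 := by
    have h1 := (S.differentiable_det 1).hasDerivAt
    rw [h0] at h1
    exact HasDerivAt.comp_ofReal (z := (1 : ℝ)) (by simpa using h1)
  have hlim1 : Filter.Tendsto (fun s : ℝ => (s - 1)⁻¹ * ‖(1 - S.matrix (s : ℂ)).det‖)
      (nhdsWithin 1 (Set.Ioi 1)) (nhds 0) := by
    have h1 := (hasDerivAt_iff_tendsto_slope.1 hd).mono_left
      (nhdsWithin_mono 1 (fun s (hs : 1 < s) => (hs.ne' : s ≠ 1)))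
    have h2 := h1.norm
    rw [norm_zero] at h2
    refine h2.congr' ?_
    filter_upwards [self_mem_nhdsWithin] with s hs
    have hs : 1 < s := hs
    rw [slope_def_module, norm_smul, Complex.ofReal_one, det_one_sub_matrix_one, sub_zero,
      norm_inv, Real.norm_of_nonneg (by linarith)]
  have hlim2 : Filter.Tendsto (fun s : ℝ => (s - 1)⁻¹ * (1 - ρ ^ (s - 1)) *
      ‖(1 - S.matrix (s : ℂ)).adjugate a a‖) (nhdsWithin 1 (Set.Ioi 1))
      (nhds (-Real.log ρ * ‖(1 - S.matrix 1).adjugate a a‖)) := by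
    refine Filter.Tendsto.mul ?_ ?_
    · have h1 : HasDerivAt (fun s : ℝ => 1 - ρ ^ (s - 1)) (-Real.log ρ) 1 := by
        have := (((hasDerivAt_id (1 : ℝ)).sub_const 1).const_rpow hρ).const_sub 1
        simpa using this
      refine ((hasDerivAt_iff_tendsto_slope.1 h1).mono_left
        (nhdsWithin_mono 1 (fun s (hs : 1 < s) => (hs.ne' : s ≠ 1)))).congr fun s => ?_
      rw [slope_def_module]
      simp
    · refine Filter.Tendsto.norm ?_
      have hc : Continuous fun s : ℝ => (1 - S.matrix (s : ℂ)).adjugate a a :=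
        ((continuous_const.sub (S.continuous_matrix_apply.comp
          Complex.continuous_ofReal)).matrix_adjugate).matrix_elem a a
      have := hc.tendsto 1
      rw [Complex.ofReal_one] at this
      exact this.mono_left nhdsWithin_le_nhds
  have hle := le_of_tendsto_of_tendsto hlim2 hlim1 (by
    filter_upwards [self_mem_nhdsWithin] with s hs
    have hs : 1 < s := hs
    have := S.norm_adjugate_mul_le hρ hρ1 h (α := (s : ℂ)) (by simpa using hs.le) a
    rw [Complex.ofReal_re] at this
    rw [mul_assoc]
    exact mul_le_mul_of_nonneg_left this (inv_nonneg.2 (by linarith)))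
  have hpos : 0 < -Real.log ρ * ‖(1 - S.matrix 1).adjugate a a‖ :=
    mul_pos (neg_pos.2 (Real.log_neg hρ hρ1)) (norm_pos_iff.2 (S.adjugate_ne_zero hS a))
  linarith

theorem analyticOrderAt_det_one [Nonempty A] (hS : S.IsPrimitive) :
    analyticOrderAt (fun z : ℂ => (1 - S.matrix z).det) 1 = 1 := by
  have := (S.differentiable_det.analyticAt 1).analyticOrderAt_sub_eq_one_of_deriv_ne_zero
    (S.deriv_det_ne_zero hS)
  simpa [det_one_sub_matrix_one] using this

end WeightedSubstitution

end Kamae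

/-! ### Sides of tiles, the scaling action, and descendants -/

namespace Kamae

namespace Tile

/-- The outward coordinate of the right side (`s = true`) or of the left side (`s = false`). -/
def out (s : Bool) (R : Tile) : ℝ := bif s then R.x₂ else -R.x₁

@[simp] theorem out_true (R : Tile) : R.out true = R.x₂ := rfl

@[simp] theorem out_false (R : Tile) : R.out false = -R.x₁ := rfl

theorem out_add_out_not (R : Tile) (s : Bool) : R.out s + R.out (!s) = R.y₁ := by
  have := R.width_eq
  cases s <;> simp <;> linarith

theorem out_scale (l : RPos) (R : Tile) (s : Bool) : (R.scale l).out s = l * R.out s := by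
  cases s <;> simp [scale]

theorem ext_out {R R' : Tile} {s : Bool} (h : R.out s = R'.out s) (h1 : R.y₁ = R'.y₁)
    (h2 : R.y₂ = R'.y₂) : R = R' := by
  have := R.width_eq
  have := R'.width_eq
  cases s <;> simp at h <;> ext <;> linarith

theorem not_disjoint_of_overlap {R R' : Tile} (h1 : R.x₁ < R'.x₂) (h2 : R'.x₁ < R.x₂)
    (h3 : R.y₁ < R'.y₂) (h4 : R'.y₁ < R.y₂) : ¬ Disjoint R.toSet R'.toSet := by
  obtain ⟨x, hx1, hx2⟩ := exists_between (show max R.x₁ R'.x₁ < min R.x₂ R'.x₂ from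
    max_lt (lt_min R.x₁_lt_x₂ h1) (lt_min h2 R'.x₁_lt_x₂))
  obtain ⟨y, hy1, hy2⟩ := exists_between (show max R.y₁ R'.y₁ < min R.y₂ R'.y₂ from
    max_lt (lt_min R.y₁_lt_y₂ h3) (lt_min h4 R'.y₁_lt_y₂))
  rw [max_lt_iff] at hx1 hy1
  rw [lt_min_iff] at hx2 hy2
  rw [Set.not_disjoint_iff]
  exact ⟨⟨x, y⟩, mem_toSet.2 ⟨⟨hx1.1, hx2.1⟩, hy1.1, hy2.1⟩,
    mem_toSet.2 ⟨⟨hx1.2, hx2.2⟩, hy1.2, hy2.2⟩⟩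

theorem disjoint_toSet_of_x_le {R R' : Tile} (h : R.x₂ ≤ R'.x₁) : Disjoint R.toSet R'.toSet :=
  Set.disjoint_left.2 fun z h1 h2 => by
    have := (mem_toSet.1 h1).1.2
    have := (mem_toSet.1 h2).1.1
    linarith

theorem disjoint_toSet_of_y_le {R R' : Tile} (h : R.y₂ ≤ R'.y₁) : Disjoint R.toSet R'.toSet :=
  Set.disjoint_left.2 fun z h1 h2 => by
    have := (mem_toSet.1 h1).2.2
    have := (mem_toSet.1 h2).2.1
    linarith

theorem scale_mul (l m : RPos) (R : Tile) : R.scale (l * m) = (R.scale m).scale l := by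
  ext <;> simp [scale, mul_assoc]

theorem scale_one (R : Tile) : R.scale 1 = R := by
  ext <;> simp [scale]

end Tile

namespace ColoredTiling

variable {A : Type*} {ω : ColoredTiling A}

theorem eq_of_overlap {p q : Tile × A} (hp : p ∈ ω.tiles) (hq : q ∈ ω.tiles)
    (h1 : p.1.x₁ < q.1.x₂) (h2 : q.1.x₁ < p.1.x₂) (h3 : p.1.y₁ < q.1.y₂) (h4 : q.1.y₁ < p.1.y₂) :
    p = q := by
  by_contra hne
  exact Tile.not_disjoint_of_overlap h1 h2 h3 h4 (ω.disjoint p hp q hq hne)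

theorem exists_mem_closure (ω : ColoredTiling A) {x y : ℝ} (hy : 0 < y) :
    ∃ p ∈ ω.tiles, (p.1.x₁ ≤ x ∧ x ≤ p.1.x₂) ∧ (p.1.y₁ ≤ y ∧ y ≤ p.1.y₂) := by
  have h : (⟨x, y⟩ : ℂ) ∈ (⋃ p ∈ ω.tiles, closure p.1.toSet) := by
    rw [ω.cover]
    exact hy
  simp only [Set.mem_iUnion, exists_prop] at h
  obtain ⟨p, hp, hz⟩ := h
  exact ⟨p, hp, Tile.mem_closure_toSet.1 hz⟩

/-- A tiling which is contained in another one is equal to it. -/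
theorem eq_of_subset {ω ω' : ColoredTiling A} (h : ω.tiles ⊆ ω'.tiles) : ω = ω' := by
  refine ColoredTiling.ext (h.antisymm fun p hp => ?_)
  obtain ⟨x, hx1, hx2⟩ := exists_between p.1.x₁_lt_x₂
  obtain ⟨y, hy1, hy2⟩ := exists_between p.1.y₁_lt_y₂
  obtain ⟨q, hq, hx, hy⟩ := ω.exists_mem_closure (x := x) (p.1.y₁_pos.trans hy1)
  rwa [eq_of_overlap hp (h hq) (by linarith) (by linarith) (by linarith) (by linarith)]

/-- The scaling of colored tiles. -/
def scaleC (l : RPos) (p : Tile × A) : Tile × A := (p.1.scale l, p.2)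

theorem mem_scale {l : RPos} {p : Tile × A} : p ∈ (ω.scale l).tiles ↔ ∃ q ∈ ω.tiles, scaleC l q = p :=
  Iff.rfl

theorem scaleC_mem_scale {l : RPos} {p : Tile × A} (hp : p ∈ ω.tiles) :
    scaleC l p ∈ (ω.scale l).tiles := ⟨p, hp, rfl⟩

theorem scaleC_mul (l m : RPos) (p : Tile × A) : scaleC (l * m) p = scaleC l (scaleC m p) :=
  Prod.ext (Tile.scale_mul _ _ _) rfl

@[simp] theorem scaleC_one (p : Tile × A) : scaleC 1 p = p := Prod.ext (Tile.scale_one _) rfl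

theorem scale_mul (l m : RPos) (ω : ColoredTiling A) : ω.scale (l * m) = (ω.scale m).scale l := by
  ext p
  simp only [mem_scale, scaleC_mul]
  constructor
  · rintro ⟨q, hq, rfl⟩
    exact ⟨_, ⟨q, hq, rfl⟩, rfl⟩
  · rintro ⟨_, ⟨q, hq, rfl⟩, rfl⟩
    exact ⟨q, hq, rfl⟩

@[simp] theorem scale_one (ω : ColoredTiling A) : ω.scale 1 = ω := by
  ext p
  simp [mem_scale]

theorem scale_pow_eq {l : RPos} (h : ω.scale l = ω) (n : ℕ) : ω.scale (l ^ n) = ω := by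
  induction n with
  | zero => simp
  | succ n ih => rw [pow_succ, scale_mul, h, ih]

theorem scale_inv_eq {l : RPos} (h : ω.scale l = ω) : ω.scale l⁻¹ = ω := by
  conv_lhs => rw [← h]
  rw [← scale_mul, inv_mul_cancel, scale_one]

theorem scaleC_mem {l : RPos} (h : ω.scale l = ω) {p : Tile × A} (hp : p ∈ ω.tiles) :
    scaleC l p ∈ ω.tiles := by
  have := scaleC_mem_scale (l := l) hp
  rwa [h] at this

end ColoredTiling

open ColoredTiling

namespace WeightedSubstitution

variable {A : Type*} (S : WeightedSubstitution A)

/-! ### Descendants -/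

/-- The `i`-th child of a colored tile. -/
def childC (p : Tile × A) (i : Fin (S.len p.2)) : Tile × A := (S.child p.1 p.2 i, S.σ p.2 i)

theorem childC_scaleC (l : RPos) (p : Tile × A) (i : Fin (S.len p.2)) :
    S.childC (scaleC l p) i = scaleC l (S.childC p i) := by
  refine Prod.ext (Tile.ext ?_ ?_ ?_ rfl) rfl
  · show l * p.1.x₁ + (l * p.1.x₂ - l * p.1.x₁) * ∑ j ∈ Finset.Iio i, S.τ p.2 j =
      l * (p.1.x₁ + (p.1.x₂ - p.1.x₁) * ∑ j ∈ Finset.Iio i, S.τ p.2 j)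
    ring
  · show l * p.1.x₁ + (l * p.1.x₂ - l * p.1.x₁) * ∑ j ∈ Finset.Iic i, S.τ p.2 j =
      l * (p.1.x₁ + (p.1.x₂ - p.1.x₁) * ∑ j ∈ Finset.Iic i, S.τ p.2 j)
    ring
  · show S.τ p.2 i * (l * p.1.y₁) = l * (S.τ p.2 i * p.1.y₁)
    ring

/-- The index of the last (`s = true`) or of the first (`s = false`) letter of `σ(a)`. -/
def extIdx (s : Bool) (a : A) : Fin (S.len a) :=
  bif s then ⟨S.len a - 1, Nat.sub_lt (S.len_pos a) one_pos⟩ else ⟨0, S.len_pos a⟩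

theorem sum_add_le_sum {a : A} {s t : Finset (Fin (S.len a))} (h : s ⊆ t) {k : Fin (S.len a)}
    (hk : k ∈ t) (hk' : k ∉ s) : ∑ i ∈ s, S.τ a i + S.τ a k ≤ ∑ i ∈ t, S.τ a i := by
  rw [add_comm, ← Finset.sum_insert hk']
  exact Finset.sum_le_sum_of_subset_of_nonneg (Finset.insert_subset hk h)
    fun i _ _ => (S.τ_pos a i).le

variable {S}

theorem childC_y₂ (p : Tile × A) (i) : (S.childC p i).1.y₂ = p.1.y₁ := rfl

theorem childC_y₁ (p : Tile × A) (i) : (S.childC p i).1.y₁ = S.τ p.2 i * p.1.y₁ := rfl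

theorem childC_x₁ (p : Tile × A) (i) :
    (S.childC p i).1.x₁ = p.1.x₁ + p.1.y₁ * ∑ j ∈ Finset.Iio i, S.τ p.2 j := by
  rw [← p.1.width_eq]; rfl

theorem childC_x₂ (p : Tile × A) (i) :
    (S.childC p i).1.x₂ = p.1.x₁ + p.1.y₁ * ∑ j ∈ Finset.Iic i, S.τ p.2 j := by
  rw [← p.1.width_eq]; rfl

theorem childC_y₁_lt (p : Tile × A) (i) : (S.childC p i).1.y₁ < p.1.y₁ :=
  mul_lt_of_lt_one_left p.1.y₁_pos (S.τ_lt_one p.2 i)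

theorem sum_Iic_le_one (a : A) (i : Fin (S.len a)) : ∑ j ∈ Finset.Iic i, S.τ a j ≤ 1 := by
  rw [← S.τ_sum a]
  exact Finset.sum_le_sum_of_subset_of_nonneg (Finset.subset_univ _) fun j _ _ => (S.τ_pos a j).le

theorem sum_Iio_nonneg (a : A) (i : Fin (S.len a)) : 0 ≤ ∑ j ∈ Finset.Iio i, S.τ a j :=
  Finset.sum_nonneg fun j _ => (S.τ_pos a j).le

theorem out_childC_le (p : Tile × A) (i) (s : Bool) : (S.childC p i).1.out s ≤ p.1.out s := by
  have h0 := p.1.y₁_pos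
  have hw := p.1.width_eq
  cases s
  · rw [Tile.out_false, Tile.out_false, childC_x₁]
    have := mul_nonneg h0.le (S.sum_Iio_nonneg p.2 i)
    linarith
  · rw [Tile.out_true, Tile.out_true, childC_x₂]
    have := mul_le_mul_of_nonneg_left (S.sum_Iic_le_one p.2 i) h0.le
    linarith

theorem out_childC_extIdx (p : Tile × A) (s : Bool) :
    (S.childC p (S.extIdx s p.2)).1.out s = p.1.out s := by
  have hw := p.1.width_eq
  cases s
  · rw [Tile.out_false, Tile.out_false, childC_x₁, Finset.sum_eq_zero]
    · simp
    · intro j hj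
      exact absurd (Finset.mem_Iio.1 hj) (by simp [extIdx, Fin.lt_def])
  · rw [Tile.out_true, Tile.out_true, childC_x₂]
    have : (Finset.Iic (S.extIdx true p.2)) = Finset.univ := by
      ext j
      simp only [Finset.mem_Iic, Finset.mem_univ, iff_true, Fin.le_def]
      exact Nat.le_sub_one_of_lt j.2
    rw [this, S.τ_sum]
    linarith

/-- The extremal child, of width at least δ times that of the parent, lies between this child and
the side. -/
theorem out_childC_add_le {δ : ℝ} (hδ : ∀ e : S.Edge, δ ≤ e.wt) (p : Tile × A) {i} {s : Bool}
    (hi : i ≠ S.extIdx s p.2) : (S.childC p i).1.out s + δ * p.1.y₁ ≤ p.1.out s := by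
  have h0 := p.1.y₁_pos
  have hw := p.1.width_eq
  cases s
  · rw [Tile.out_false, Tile.out_false, childC_x₁]
    have hi0 : S.extIdx false p.2 < i := by
      rw [Fin.lt_def]
      refine Nat.pos_of_ne_zero fun h => hi (Fin.ext h)
    have h1 := S.sum_add_le_sum (Finset.empty_subset (Finset.Iio i)) (Finset.mem_Iio.2 hi0)
      (Finset.notMem_empty _)
    rw [Finset.sum_empty, zero_add] at h1
    have := mul_le_mul_of_nonneg_left ((hδ ⟨_, S.extIdx false p.2⟩).trans h1) h0.le
    linarith
  · rw [Tile.out_true, Tile.out_true, childC_x₂]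
    have hi0 : i < S.extIdx true p.2 := by
      rw [Fin.lt_def]
      have h1 : (i : ℕ) ≠ S.len p.2 - 1 := fun h => hi (Fin.ext h)
      have h2 := i.2
      show (i : ℕ) < S.len p.2 - 1
      omega
    have h1 := S.sum_add_le_sum (Finset.subset_univ (Finset.Iic i)) (Finset.mem_univ
      (S.extIdx true p.2)) (by simpa using hi0)
    rw [S.τ_sum] at h1
    have := hδ ⟨_, S.extIdx true p.2⟩
    have := mul_le_mul_of_nonneg_left ((add_le_add_right this _).trans h1) h0.le
    linarith

theorem childC_x₂_le_x₁ (p : Tile × A) {i j : Fin (S.len p.2)} (h : i < j) :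
    (S.childC p i).1.x₂ ≤ (S.childC p j).1.x₁ := by
  rw [childC_x₁, childC_x₂]
  have : ∑ k ∈ Finset.Iic i, S.τ p.2 k ≤ ∑ k ∈ Finset.Iio j, S.τ p.2 k :=
    Finset.sum_le_sum_of_subset_of_nonneg
      (fun k hk => Finset.mem_Iio.2 ((Finset.mem_Iic.1 hk).trans_lt h))
      fun k _ _ => (S.τ_pos p.2 k).le
  have := mul_le_mul_of_nonneg_left this p.1.y₁_pos.le
  linarith

theorem eq_of_childC_overlap (p : Tile × A) {i j : Fin (S.len p.2)}
    (h1 : (S.childC p i).1.x₁ < (S.childC p j).1.x₂)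
    (h2 : (S.childC p j).1.x₁ < (S.childC p i).1.x₂) : i = j := by
  rcases lt_trichotomy i j with h | h | h
  · exact absurd (childC_x₂_le_x₁ p h) (not_le.2 h2)
  · exact h
  · exact absurd (childC_x₂_le_x₁ p h) (not_le.2 h1)

theorem exists_childC_column (p : Tile × A) {x : ℝ} (h1 : p.1.x₁ ≤ x) (h2 : x ≤ p.1.x₂) :
    ∃ i, (S.childC p i).1.x₁ ≤ x ∧ x ≤ (S.childC p i).1.x₂ := by
  -- If every child misses x, then from the first child onwards each right side is left of x,
  -- including the last one, which is the right side of p.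
  by_contra! hcon
  have hlt : ∀ (n : ℕ) (hn : n < S.len p.2), (S.childC p ⟨n, hn⟩).1.x₂ < x := by
    intro n
    induction n with
    | zero =>
      intro hn
      refine hcon _ ?_
      have := out_childC_extIdx (S := S) p false
      rw [Tile.out_false, Tile.out_false, neg_inj] at this
      exact this.trans_le h1
    | succ n ih =>
      intro hn
      refine hcon _ ?_
      have hI : Finset.Iio (⟨n + 1, hn⟩ : Fin (S.len p.2)) =
          Finset.Iic ⟨n, (Nat.lt_succ_self n).trans hn⟩ := by
        ext k
        rw [Finset.mem_Iio, Finset.mem_Iic, Fin.lt_def, Fin.le_def]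
        exact Nat.lt_succ_iff
      rw [childC_x₁, hI, ← childC_x₂]
      exact (ih _).le
  have h3 := hlt (S.len p.2 - 1) (Nat.sub_lt (S.len_pos p.2) one_pos)
  have h4 := out_childC_extIdx (S := S) p true
  rw [Tile.out_true, Tile.out_true] at h4
  have h5 : (S.childC p (S.extIdx true p.2)).1.x₂ < x := h3
  linarith

variable (S)

/-- `q` is a descendant of `p`. -/
def Desc : Tile × A → Tile × A → Prop := Relation.ReflTransGen fun p q => ∃ i, q = S.childC p i

variable {S}

namespace Desc

theorem refl (p : Tile × A) : S.Desc p p := Relation.ReflTransGen.refl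

theorem trans {p q r : Tile × A} (h : S.Desc p q) (h' : S.Desc q r) : S.Desc p r :=
  Relation.ReflTransGen.trans h h'

theorem childC (p : Tile × A) (i) : S.Desc p (S.childC p i) :=
  Relation.ReflTransGen.single ⟨i, rfl⟩

theorem out_le {p q : Tile × A} (h : S.Desc p q) (s : Bool) : q.1.out s ≤ p.1.out s := by
  induction h with
  | refl => exact le_rfl
  | tail _ h ih =>
    obtain ⟨i, rfl⟩ := h
    exact (out_childC_le _ i s).trans ih

theorem x₁_le {p q : Tile × A} (h : S.Desc p q) : p.1.x₁ ≤ q.1.x₁ := by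
  simpa using h.out_le false

theorem x₂_le {p q : Tile × A} (h : S.Desc p q) : q.1.x₂ ≤ p.1.x₂ := h.out_le true

theorem y₁_le {p q : Tile × A} (h : S.Desc p q) : q.1.y₁ ≤ p.1.y₁ := by
  induction h with
  | refl => exact le_rfl
  | tail _ h ih =>
    obtain ⟨i, rfl⟩ := h
    exact (childC_y₁_lt _ i).le.trans ih

theorem eq_or_exists_childC {p q : Tile × A} (h : S.Desc p q) :
    p = q ∨ ∃ i, S.Desc (S.childC p i) q := by
  rcases Relation.ReflTransGen.cases_head h with h | ⟨_, ⟨i, rfl⟩, h⟩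
  · exact Or.inl h
  · exact Or.inr ⟨i, h⟩

theorem y₂_le_y₁ {p q : Tile × A} (h : S.Desc p q) : p = q ∨ q.1.y₂ ≤ p.1.y₁ := by
  rcases Relation.ReflTransGen.cases_tail h with h | ⟨r, hr, ⟨i, rfl⟩⟩
  · exact Or.inl h.symm
  · exact Or.inr (y₁_le hr)

theorem y₂_le {p q : Tile × A} (h : S.Desc p q) : q.1.y₂ ≤ p.1.y₂ := by
  rcases h.y₂_le_y₁ with rfl | h
  · exact le_rfl
  · exact h.trans p.1.y₁_lt_y₂.le

/-- Two descendants of a tile are equal or disjoint. -/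
theorem eq_or_disjoint {p q q' : Tile × A} (h : S.Desc p q) (h' : S.Desc p q') :
    q = q' ∨ Disjoint q.1.toSet q'.1.toSet := by
  induction h using Relation.ReflTransGen.head_induction_on with
  | refl =>
    rcases h'.y₂_le_y₁ with h | h
    · exact Or.inl h
    · exact Or.inr (Tile.disjoint_toSet_of_y_le h).symm
  | @head a c hac hc ih =>
    obtain ⟨i, rfl⟩ := hac
    rcases h'.eq_or_exists_childC with rfl | ⟨j, hj⟩
    · refine Or.inr (Tile.disjoint_toSet_of_y_le ?_)
      exact Desc.y₂_le hc
    · rcases lt_trichotomy i j with hij | rfl | hij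
      · refine Or.inr (Tile.disjoint_toSet_of_x_le ?_)
        exact (Desc.x₂_le hc).trans ((childC_x₂_le_x₁ _ hij).trans hj.x₁_le)
      · exact ih hj
      · refine Or.inr (Tile.disjoint_toSet_of_x_le ?_).symm
        exact hj.x₂_le.trans ((childC_x₂_le_x₁ _ hij).trans (Desc.x₁_le hc))

end Desc

/-- The descendants of a tile cover the region below it. -/
theorem exists_desc_mem_closure [Finite A] (p : Tile × A) {x y : ℝ} (h1 : p.1.x₁ ≤ x)
    (h2 : x ≤ p.1.x₂) (hy : 0 < y) (hy2 : y ≤ p.1.y₂) :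
    ∃ q, S.Desc p q ∧ (q.1.x₁ ≤ x ∧ x ≤ q.1.x₂) ∧ (q.1.y₁ ≤ y ∧ y ≤ q.1.y₂) := by
  obtain ⟨ρ, hρ, hρ1, hρe⟩ := S.exists_weight_le
  -- Descend in the column of x. Each generation multiplies y₁ by at most ρ, so n bounds the number
  -- of generations needed to reach height y.
  have key : ∀ (n : ℕ) (p : Tile × A), p.1.x₁ ≤ x → x ≤ p.1.x₂ → y ≤ p.1.y₂ →
      ρ ^ n * p.1.y₁ ≤ y →
      ∃ q, S.Desc p q ∧ (q.1.x₁ ≤ x ∧ x ≤ q.1.x₂) ∧ (q.1.y₁ ≤ y ∧ y ≤ q.1.y₂) := by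
    intro n
    induction n with
    | zero =>
      intro p h1 h2 hy2 hn
      rw [pow_zero, one_mul] at hn
      exact ⟨p, Desc.refl p, ⟨h1, h2⟩, hn, hy2⟩
    | succ n ih =>
      intro p h1 h2 hy2 hn
      rcases le_or_gt p.1.y₁ y with h | h
      · exact ⟨p, Desc.refl p, ⟨h1, h2⟩, h, hy2⟩
      · obtain ⟨i, hi1, hi2⟩ := exists_childC_column (S := S) p h1 h2
        obtain ⟨q, hq, hq'⟩ := ih (S.childC p i) hi1 hi2 h.le (by
          refine le_trans ?_ hn
          rw [childC_y₁, pow_succ, mul_assoc]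
          have : S.τ p.2 i ≤ ρ := hρe ⟨p.2, i⟩
          have := p.1.y₁_pos
          gcongr)
        exact ⟨q, (Desc.childC p i).trans hq, hq'⟩
  obtain ⟨n, hn⟩ := exists_pow_lt_of_lt_one (div_pos hy p.1.y₁_pos) hρ1
  rw [lt_div_iff₀ p.1.y₁_pos] at hn
  exact key n p h1 h2 hy2 hn.le

/-! ### Extremal descendants -/

variable (S)

/-- The last or the first letter of `σ(a)`. -/
def extLetter (s : Bool) (a : A) : A := S.σ a (S.extIdx s a)

/-- The rightmost or leftmost descendants of a colored tile. -/
def extDesc (s : Bool) (n : ℕ) : Tile × A → Tile × A := (fun p => S.childC p (S.extIdx s p.2))^[n]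

/-- The product of the weights along the extremal descendants. -/
def extWeight (s : Bool) (n : ℕ) (a : A) : ℝ :=
  ∏ i ∈ Finset.range n, S.τ ((S.extLetter s)^[i] a) (S.extIdx s ((S.extLetter s)^[i] a))

theorem extDesc_succ (s : Bool) (n : ℕ) (p : Tile × A) : S.extDesc s (n + 1) p =
    S.childC (S.extDesc s n p) (S.extIdx s (S.extDesc s n p).2) :=
  Function.iterate_succ_apply' _ _ _

theorem extDesc_snd (s : Bool) (n : ℕ) (p : Tile × A) :
    (S.extDesc s n p).2 = (S.extLetter s)^[n] p.2 := by
  induction n with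
  | zero => rfl
  | succ n ih =>
    rw [extDesc_succ, Function.iterate_succ_apply', ← ih]
    rfl

theorem extDesc_y₁ (s : Bool) (n : ℕ) (p : Tile × A) :
    (S.extDesc s n p).1.y₁ = S.extWeight s n p.2 * p.1.y₁ := by
  induction n with
  | zero => simp [extDesc, extWeight]
  | succ n ih =>
    rw [extDesc_succ, childC_y₁, ih, extWeight, extWeight, Finset.prod_range_succ, extDesc_snd]
    ring

theorem extDesc_out (s : Bool) (n : ℕ) (p : Tile × A) :
    (S.extDesc s n p).1.out s = p.1.out s := by
  induction n with
  | zero => rfl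
  | succ n ih => rw [extDesc_succ, out_childC_extIdx, ih]

theorem desc_extDesc (s : Bool) (n : ℕ) (p : Tile × A) : S.Desc p (S.extDesc s n p) := by
  induction n with
  | zero => exact Desc.refl p
  | succ n ih => rw [extDesc_succ]; exact ih.trans (Desc.childC _ _)

theorem extWeight_pos (s : Bool) (n : ℕ) (a : A) : 0 < S.extWeight s n a :=
  Finset.prod_pos fun _ _ => S.τ_pos _ _

theorem extWeight_add (s : Bool) (m n : ℕ) (a : A) :
    S.extWeight s (m + n) a = S.extWeight s m a * S.extWeight s n ((S.extLetter s)^[m] a) := by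
  rw [extWeight, Finset.prod_range_add]
  simp only [extWeight]
  congr 1
  refine Finset.prod_congr rfl fun i _ => ?_
  rw [← Function.iterate_add_apply, add_comm i m]

variable {S}

/-- A descendant is an extremal descendant or stays away from the side of the ancestor. -/
theorem Desc.extDesc_or {δ : ℝ} (hδ0 : 0 < δ) (hδ : ∀ e : S.Edge, δ ≤ e.wt) {p q : Tile × A}
    (h : S.Desc p q) (s : Bool) :
    (∃ n, q = S.extDesc s n p) ∨ q.1.out s + δ * q.1.y₁ ≤ p.1.out s := by
  induction h with
  | refl => exact Or.inl ⟨0, rfl⟩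
  | @tail b c hb hc ih =>
    obtain ⟨i, rfl⟩ := hc
    have h1 := mul_le_mul_of_nonneg_left (childC_y₁_lt b i).le hδ0.le
    -- Leaving the extremal line costs at least δ times the lower ordinate of the tile left behind,
    -- and later descendants never recover this distance.
    rcases ih with ⟨n, rfl⟩ | ih
    · by_cases hi : i = S.extIdx s (S.extDesc s n p).2
      · exact Or.inl ⟨n + 1, by rw [extDesc_succ, hi]⟩
      · have h2 := out_childC_add_le hδ _ hi
        rw [extDesc_out] at h2
        exact Or.inr (by linarith)
    · have := out_childC_le b i s
      exact Or.inr (by linarith)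

end WeightedSubstitution

end Kamae

namespace Kamae

open ColoredTiling

namespace WeightedSubstitution

variable {A : Type*} {S : WeightedSubstitution A} {g : A → RPos} {ω : ColoredTiling A}

/-! ### Tilings which are closed under taking children -/

theorem childC_mem (hω : ω ∈ S.tilings' g) {p : Tile × A} (hp : p ∈ ω.tiles) (i) :
    S.childC p i ∈ ω.tiles := (hω p.1 p.2 hp).2 i

theorem Desc.mem (hω : ω ∈ S.tilings' g) {p q : Tile × A} (h : S.Desc p q) (hp : p ∈ ω.tiles) :
    q ∈ ω.tiles := by
  induction h with
  | refl => exact hp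
  | tail _ h ih =>
    obtain ⟨i, rfl⟩ := h
    exact childC_mem hω ih i

theorem scale_mem_tilings' (hω : ω ∈ S.tilings' g) {l : RPos} (hl : l ∈ S.baseSet) :
    ω.scale l ∈ S.tilings' g := by
  rintro R a ⟨p, hp, hpR⟩
  obtain ⟨rfl, rfl⟩ := Prod.mk.inj hpR
  obtain ⟨⟨h, hh, hy⟩, hc⟩ := hω p.1 p.2 hp
  refine ⟨⟨l * h, mul_mem hl hh, ?_⟩, fun i => ?_⟩
  · show (l : ℝ) * p.1.y₁ = g p.2 * ((l * h : RPos) : ℝ)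
    rw [hy, Positive.val_mul]
    ring
  · exact ⟨_, hc i, (childC_scaleC S l p i).symm⟩

/-- A tile q covering a point just above p lies entirely above p, since otherwise it would overlap
p. The child of q in the same column overlaps p, hence is p. -/
theorem exists_parent [Finite A] (hω : ω ∈ S.tilings' g) {p : Tile × A} (hp : p ∈ ω.tiles) :
    ∃ q ∈ ω.tiles, ∃ i, p = S.childC q i := by
  obtain ⟨ρ, hρ, hρ1, hρe⟩ := S.exists_weight_le
  obtain ⟨x, hx1, hx2⟩ := exists_between p.1.x₁_lt_x₂
  have hy2 : 0 < p.1.y₂ := p.1.y₁_pos.trans p.1.y₁_lt_y₂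
  -- With y < y₂/ρ, the children of a tile containing height y have their lower sides below the top
  -- of p.
  obtain ⟨y, hy, hyρ⟩ := exists_between (show p.1.y₂ < p.1.y₂ / ρ by
    rw [lt_div_iff₀ hρ]; nlinarith)
  rw [lt_div_iff₀ hρ] at hyρ
  obtain ⟨q, hq, hqx, hqy⟩ := ω.exists_mem_closure (x := x) (hy2.trans hy)
  have hqp : p.1.y₂ ≤ q.1.y₁ := by
    by_contra! hlt
    have := eq_of_overlap hp hq (by linarith) (by linarith)
      (by linarith [p.1.y₁_lt_y₂]) hlt
    subst this
    linarith
  obtain ⟨i, hi1, hi2⟩ := exists_childC_column (S := S) q hqx.1 hqx.2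
  refine ⟨q, hq, i, eq_of_overlap hp (childC_mem hω hq i) (by linarith) (by linarith) ?_ ?_⟩
  · rw [childC_y₂]
    linarith [p.1.y₁_lt_y₂]
  · rw [childC_y₁]
    have : S.τ q.2 i ≤ ρ := hρe ⟨q.2, i⟩
    have := mul_le_mul this hqy.1 q.1.y₁_pos.le hρ.le
    linarith

theorem exists_ancestors [Finite A] (hω : ω ∈ S.tilings' g) {p : Tile × A} (hp : p ∈ ω.tiles) :
    ∃ P : ℕ → Tile × A, P 0 = p ∧ ∀ n, P n ∈ ω.tiles ∧ ∃ i, P n = S.childC (P (n + 1)) i := by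
  choose f hf hfi using fun q : ω.tiles => exists_parent hω q.2
  obtain ⟨Q, hQ0, hQ⟩ : ∃ Q : ℕ → ω.tiles, Q 0 = ⟨p, hp⟩ ∧ ∀ n, Q (n + 1) = ⟨f (Q n), hf (Q n)⟩ :=
    ⟨fun n => (fun q => ⟨f q, hf q⟩)^[n] ⟨p, hp⟩, rfl, fun n => Function.iterate_succ_apply' _ _ _⟩
  refine ⟨fun n => (Q n).1, congrArg Subtype.val hQ0, fun n => ⟨(Q n).2, ?_⟩⟩
  have h := hfi (Q n)
  have e : f (Q n) = (Q (n + 1)).1 := by rw [hQ n]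
  rw [e] at h
  exact h

theorem desc_of_ancestors {P : ℕ → Tile × A} (hP : ∀ n, ∃ i, P n = S.childC (P (n + 1)) i)
    {m n : ℕ} (h : m ≤ n) : S.Desc (P n) (P m) := by
  induction h with
  | refl => exact Desc.refl _
  | @step k _ ih =>
    obtain ⟨i, hi⟩ := hP k
    have hD := Desc.childC (P (k + 1)) i
    rw [← hi] at hD
    exact hD.trans ih

theorem exists_lt_ancestors [Finite A] {P : ℕ → Tile × A}
    (hP : ∀ n, ∃ i, P n = S.childC (P (n + 1)) i) (M : ℝ) : ∃ n, ∀ m, n ≤ m → M < (P m).1.y₁ := by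
  obtain ⟨ρ, hρ, hρ1, hρe⟩ := S.exists_weight_le
  have h : ∀ n, (P 0).1.y₁ ≤ ρ ^ n * (P n).1.y₁ := by
    intro n
    induction n with
    | zero => simp
    | succ n ih =>
      refine ih.trans ?_
      obtain ⟨i, hi⟩ := hP n
      rw [hi, childC_y₁, pow_succ, mul_assoc]
      have : S.τ (P (n + 1)).2 i ≤ ρ := hρe ⟨_, i⟩
      have := (P (n + 1)).1.y₁_pos
      gcongr
  have h0 := (P 0).1.y₁_pos
  obtain ⟨n, hn⟩ := exists_pow_lt_of_lt_one (div_pos h0 (show 0 < |M| + 1 by positivity)) hρ1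
  refine ⟨n, fun m hm => ?_⟩
  rw [lt_div_iff₀ (by positivity)] at hn
  have h1 : ρ ^ n * (|M| + 1) < ρ ^ n * (P n).1.y₁ := hn.trans_le (h n)
  have h2 := lt_of_mul_lt_mul_left h1 (by positivity)
  have h3 := (desc_of_ancestors hP hm).y₁_le
  have := le_abs_self M
  linarith

/-- In a tiling, a lower tile in the column of a tile is one of its descendants. -/
theorem desc_of_overlap [Finite A] (hω : ω ∈ S.tilings' g) {p q : Tile × A} (hp : p ∈ ω.tiles)
    (hq : q ∈ ω.tiles) (h1 : p.1.x₁ < q.1.x₂) (h2 : q.1.x₁ < p.1.x₂) (h3 : p.1.y₁ ≤ q.1.y₁) :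
    S.Desc q p := by
  classical
  obtain ⟨P, rfl, hP⟩ := exists_ancestors hω hp
  -- Climb from p to the last ancestor whose lower side is not above that of q. Its top is above the
  -- lower side of q, so it overlaps q and equals it.
  have hex : ∃ n, q.1.y₁ < (P n).1.y₁ := by
    obtain ⟨n, hn⟩ := exists_lt_ancestors (fun n => (hP n).2) q.1.y₁
    exact ⟨n, hn n le_rfl⟩
  obtain ⟨n, hn⟩ : ∃ n, Nat.find hex = n + 1 := by
    refine Nat.exists_eq_succ_of_ne_zero fun h0 => ?_
    have := Nat.find_spec hex
    rw [h0] at this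
    linarith
  have hn1 := Nat.find_spec hex
  have hn2 := Nat.find_min hex (m := n) (by omega)
  rw [hn] at hn1
  have hD := desc_of_ancestors (fun n => (hP n).2) (Nat.zero_le n)
  have hx1 := hD.x₁_le
  have hx2 := hD.x₂_le
  have hy : (P n).1.y₂ = (P (n + 1)).1.y₁ := by
    obtain ⟨i, hi⟩ := (hP n).2
    rw [hi]; rfl
  have := eq_of_overlap (hP n).1 hq (by linarith) (by linarith)
    (by linarith [q.1.y₁_lt_y₂]) (by linarith)
  rwa [← this]

/-- Side coordinates of the ancestors of a tile leave every half line, if there is no separating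
line. -/
theorem exists_out_ancestors [Finite A] (hω : ω ∈ S.tilings'' g) {P : ℕ → Tile × A}
    (hP : ∀ n, P n ∈ ω.tiles ∧ ∃ i, P n = S.childC (P (n + 1)) i) (s : Bool) (M : ℝ) :
    ∃ n, ∀ m, n ≤ m → M < (P m).1.out s := by
  obtain ⟨δ, hδ0, hδ⟩ := S.exists_le_weight
  have hP' := fun n => (hP n).2
  by_contra! hcon
  have hle : ∀ n, (P n).1.out s ≤ M := fun n => by
    obtain ⟨m, hm, h⟩ := hcon n
    exact ((desc_of_ancestors hP' hm).out_le s).trans h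
  -- Once δ·y₁ exceeds the room left below M, a further ancestor can only share the side s: a
  -- non-extremal step would push the side beyond M.
  obtain ⟨n, hn⟩ := exists_lt_ancestors hP' ((M - (P 0).1.out s) / δ)
  have hconst : ∀ m, n ≤ m → (P m).1.out s = (P n).1.out s := by
    intro m hm
    rcases (desc_of_ancestors hP' hm).extDesc_or hδ0 hδ s with ⟨k, hk⟩ | h
    · rw [hk, extDesc_out]
    · exfalso
      have h1 := hn n le_rfl
      rw [div_lt_iff₀ hδ0] at h1
      have h2 := (desc_of_ancestors hP' (Nat.zero_le n)).out_le s
      have h3 := hle m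
      linarith
  obtain ⟨c, hc⟩ : ∃ c : ℝ, c = bif s then (P n).1.out s else -(P n).1.out s := ⟨_, rfl⟩
  -- The common side lies on a separating line: a tile meeting x = c would descend from a tall
  -- ancestor whose side is on that line.
  refine hω.2 ⟨c, fun p hp => ?_⟩
  rw [Set.disjoint_left]
  intro z hz hzc
  rw [Set.mem_ofPred_eq] at hzc
  obtain ⟨⟨hz1, hz2⟩, -⟩ := Tile.mem_toSet.1 hz
  obtain ⟨m, hm⟩ := exists_lt_ancestors hP' p.1.y₁
  have hm' := hm (max m n) (le_max_left _ _)
  have hcm := hconst (max m n) (le_max_right _ _)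
  have hw := (P (max m n)).1.x₁_lt_x₂
  have hD : S.Desc (P (max m n)) p := by
    refine desc_of_overlap hω.1 hp (hP _).1 ?_ ?_ hm'.le <;> cases s <;>
      simp only [Tile.out_false, Tile.out_true, cond_false, cond_true, neg_neg] at hc hcm <;>
      linarith
  have := hD.out_le s
  cases s <;> simp only [Tile.out_false, Tile.out_true, cond_false, cond_true, neg_neg]
    at hc hcm this <;> linarith

/-- Two tiles of a tiling without separating line have a common ancestor. -/
theorem exists_common_ancestor [Finite A] (hω : ω ∈ S.tilings'' g) {p q : Tile × A}
    (hp : p ∈ ω.tiles) (hq : q ∈ ω.tiles) :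
    ∃ r ∈ ω.tiles, S.Desc r p ∧ S.Desc r q := by
  obtain ⟨P, rfl, hP⟩ := exists_ancestors hω.1 hp
  obtain ⟨n1, h1⟩ := exists_out_ancestors hω hP true q.1.x₂
  obtain ⟨n2, h2⟩ := exists_out_ancestors hω hP false (-q.1.x₁)
  obtain ⟨n3, h3⟩ := exists_lt_ancestors (fun n => (hP n).2) q.1.y₁
  let n := max n1 (max n2 n3)
  have h1 := h1 n (le_max_left _ _)
  have h2 := h2 n ((le_max_left _ _).trans (le_max_right _ _))
  have h3 := h3 n ((le_max_right _ _).trans (le_max_right _ _))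
  have hw := q.1.x₁_lt_x₂
  rw [Tile.out_true] at h1
  rw [Tile.out_false] at h2
  exact ⟨P n, (hP n).1, desc_of_ancestors (fun n => (hP n).2) (Nat.zero_le n),
    desc_of_overlap hω.1 hq (hP n).1 (by linarith) (by linarith) h3.le⟩

end WeightedSubstitution

/-! ### The closure -/

namespace Tile

theorem isBounded_toSet (R : Tile) : Bornology.IsBounded R.toSet :=
  (Metric.isBounded_Ioo _ _).reProdIm (Metric.isBounded_Ioo _ _)

theorem nonempty_toSet (R : Tile) : R.toSet.Nonempty := by
  obtain ⟨x, hx⟩ := exists_between R.x₁_lt_x₂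
  obtain ⟨y, hy⟩ := exists_between R.y₁_lt_y₂
  exact ⟨⟨x, y⟩, mem_toSet.2 ⟨hx, hy⟩⟩

theorem coord_le_of_hausdorffDist_lt {R R' : Tile} {ε : ℝ}
    (h : Metric.hausdorffDist R.toSet R'.toSet < ε) :
    R'.x₁ ≤ R.x₁ + ε ∧ R.x₂ - ε ≤ R'.x₂ ∧ R'.y₁ ≤ R.y₁ + ε ∧ R.y₂ - ε ≤ R'.y₂ := by
  have key : ∀ x ∈ Set.Ioo R.x₁ R.x₂, ∀ y ∈ Set.Ioo R.y₁ R.y₂,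
      (R'.x₁ < x + ε ∧ x - ε < R'.x₂) ∧ R'.y₁ < y + ε ∧ y - ε < R'.y₂ := by
    intro x hx y hy
    obtain ⟨z, hz, hd⟩ := Metric.exists_dist_lt_of_hausdorffDist_lt
      (x := (⟨x, y⟩ : ℂ)) (mem_toSet.2 ⟨hx, hy⟩) h
      (Metric.hausdorffEDist_ne_top_of_nonempty_of_bounded R.nonempty_toSet R'.nonempty_toSet
        R.isBounded_toSet R'.isBounded_toSet)
    obtain ⟨⟨h1, h2⟩, h3, h4⟩ := mem_toSet.1 hz
    rw [Complex.dist_eq] at hd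
    have hre := (Complex.abs_re_le_norm _).trans_lt hd
    have him := (Complex.abs_im_le_norm _).trans_lt hd
    rw [Complex.sub_re, abs_lt] at hre
    rw [Complex.sub_im, abs_lt] at him
    simp only at hre him
    refine ⟨⟨?_, ?_⟩, ?_, ?_⟩ <;> linarith
  obtain ⟨x, hx⟩ := exists_between R.x₁_lt_x₂
  obtain ⟨y, hy⟩ := exists_between R.y₁_lt_y₂
  refine ⟨?_, ?_, ?_, ?_⟩ <;> by_contra! hcon
  · obtain ⟨t, ht⟩ := exists_between (show R.x₁ < min x (R'.x₁ - ε) from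
      lt_min hx.1 (by linarith))
    rw [lt_min_iff] at ht
    have := (key t ⟨ht.1, by linarith⟩ y hy).1.1
    linarith
  · obtain ⟨t, ht⟩ := exists_between (show max x (R'.x₂ + ε) < R.x₂ from
      max_lt hx.2 (by linarith))
    rw [max_lt_iff] at ht
    have := (key t ⟨by linarith, ht.2⟩ y hy).1.2
    linarith
  · obtain ⟨t, ht⟩ := exists_between (show R.y₁ < min y (R'.y₁ - ε) from
      lt_min hy.1 (by linarith))
    rw [lt_min_iff] at ht
    have := (key x hx t ⟨ht.1, by linarith⟩).2.1
    linarith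
  · obtain ⟨t, ht⟩ := exists_between (show max y (R'.y₂ + ε) < R.y₂ from
      max_lt hy.2 (by linarith))
    rw [max_lt_iff] at ht
    have := (key x hx t ⟨by linarith, ht.2⟩).2.2
    linarith

theorem abs_sub_le_of_hausdorffDist_lt {R R' : Tile} {ε : ℝ}
    (h : Metric.hausdorffDist R.toSet R'.toSet < ε) :
    |R'.x₁ - R.x₁| ≤ ε ∧ |R'.x₂ - R.x₂| ≤ ε ∧ |R'.y₁ - R.y₁| ≤ ε ∧ |R'.y₂ - R.y₂| ≤ ε := by
  obtain ⟨h1, h2, h3, h4⟩ := coord_le_of_hausdorffDist_lt h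
  rw [Metric.hausdorffDist_comm] at h
  obtain ⟨h1', h2', h3', h4'⟩ := coord_le_of_hausdorffDist_lt h
  refine ⟨?_, ?_, ?_, ?_⟩ <;> rw [abs_le] <;> constructor <;> linarith

end Tile

namespace ColoredTiling

/-- Every neighborhood of a tiling contains tilings with tiles close to two given ones. -/
theorem exists_near_of_mem_closure {A : Type*} {X : Set (ColoredTiling A)} {ω : ColoredTiling A}
    (hω : ω ∈ closure X) {p q : Tile × A} (hp : p ∈ ω.tiles) (hq : q ∈ ω.tiles) {ε : ℝ}
    (hε : 0 < ε) :
    ∃ ω' ∈ X, ∃ R R' : Tile, (R, p.2) ∈ ω'.tiles ∧ (R', q.2) ∈ ω'.tiles ∧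
      (|R.x₁ - p.1.x₁| ≤ ε ∧ |R.x₂ - p.1.x₂| ≤ ε ∧ |R.y₁ - p.1.y₁| ≤ ε ∧ |R.y₂ - p.1.y₂| ≤ ε) ∧
      |R'.x₁ - q.1.x₁| ≤ ε ∧ |R'.x₂ - q.1.x₂| ≤ ε ∧ |R'.y₁ - q.1.y₁| ≤ ε ∧
        |R'.y₂ - q.1.y₂| ≤ ε := by
  have hU : ∀ p : Tile × A, IsOpen {ω' : ColoredTiling A | ∃ R' : Tile, (R', p.2) ∈ ω'.tiles ∧
      Metric.hausdorffDist p.1.toSet R'.toSet < ε} := fun p =>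
    TopologicalSpace.isOpen_generateFrom_of_mem ⟨p.1, p.2, ε, hε, rfl⟩
  obtain ⟨ω', ⟨⟨R, hR, hd⟩, R', hR', hd'⟩, hω'⟩ := mem_closure_iff.1 hω _ ((hU p).inter (hU q))
    ⟨⟨p.1, hp, by rwa [Metric.hausdorffDist_self_zero]⟩,
      ⟨q.1, hq, by rwa [Metric.hausdorffDist_self_zero]⟩⟩
  exact ⟨ω', hω', R, R', hR, hR', Tile.abs_sub_le_of_hausdorffDist_lt hd,
    Tile.abs_sub_le_of_hausdorffDist_lt hd'⟩

end ColoredTiling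

namespace WeightedSubstitution

variable {A : Type*} {S : WeightedSubstitution A} {g : A → RPos} {ω : ColoredTiling A}

theorem isClosed_baseSet (S : WeightedSubstitution A) : IsClosed (S.baseSet : Set RPos) := by
  rw [baseSet, Subgroup.coe_sInf]
  exact isClosed_biInter fun H hH => hH.1

/-- The heights pass to the limit because G is closed. For a child c, let q be a tile of ω over an
interior point of c. In nearby tilings the child of the tile near R and the tile near q overlap and
so coincide; hence c and q have the same color and arbitrarily close coordinates. -/
theorem tilingSpace_subset_tilings' : S.tilingSpace g ⊆ S.tilings' g := by
  intro ω hω R a hR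
  constructor
  · have hg := (g a).2
    have hcl : (⟨R.y₁ / g a, div_pos R.y₁_pos hg⟩ : RPos) ∈ closure (S.baseSet : Set RPos) := by
      rw [Metric.mem_closure_iff]
      intro ε hε
      obtain ⟨ω', hω', R', -, hR', -, hd, -⟩ := exists_near_of_mem_closure hω hR hR
        (half_pos (mul_pos hε hg))
      obtain ⟨⟨h, hh, hy⟩, -⟩ := hω'.1 R' a hR'
      refine ⟨h, hh, ?_⟩
      rw [Subtype.dist_eq, Real.dist_eq, abs_sub_comm]
      have h1 := hd.2.2.1
      rw [hy] at h1
      have h2 : |(h : ℝ) - R.y₁ / g a| * g a = |g a * h - R.y₁| := by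
        rw [← abs_of_pos hg, ← abs_mul, abs_of_pos hg, sub_mul, div_mul_cancel₀ _ hg.ne', mul_comm]
      have h3 : |(h : ℝ) - R.y₁ / g a| * g a < ε * g a := by
        rw [h2]
        exact h1.trans_lt (half_lt_self (mul_pos hε hg))
      exact lt_of_mul_lt_mul_right h3 hg.le
    rw [S.isClosed_baseSet.closure_eq] at hcl
    exact ⟨_, hcl, (mul_div_cancel₀ _ hg.ne').symm⟩
  · intro i
    obtain ⟨c, hc⟩ : ∃ c, c = S.childC (R, a) i := ⟨_, rfl⟩
    obtain ⟨x, hx1, hx2⟩ := exists_between c.1.x₁_lt_x₂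
    obtain ⟨y, hy1, hy2⟩ := exists_between c.1.y₁_lt_y₂
    obtain ⟨q, hq, hqx, hqy⟩ := ω.exists_mem_closure (x := x) (c.1.y₁_pos.trans hy1)
    -- The margin 4m absorbs the errors: at most 2ε for the sides of the approximating child and ε
    -- for those of the tile near q, with ε ≤ m.
    obtain ⟨m, hm, hm1, hm2, hm3, hm4⟩ : ∃ m : ℝ, 0 < m ∧ c.1.x₁ + 4 * m ≤ x ∧ x + 4 * m ≤ c.1.x₂ ∧
        c.1.y₁ + 4 * m ≤ y ∧ y + 4 * m ≤ c.1.y₂ := by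
      refine ⟨min (min (x - c.1.x₁) (c.1.x₂ - x)) (min (y - c.1.y₁) (c.1.y₂ - y)) / 4, ?_, ?_⟩
      · have := lt_min (lt_min (sub_pos.2 hx1) (sub_pos.2 hx2))
          (lt_min (sub_pos.2 hy1) (sub_pos.2 hy2))
        linarith
      · have h1 := min_le_left (min (x - c.1.x₁) (c.1.x₂ - x)) (min (y - c.1.y₁) (c.1.y₂ - y))
        have h2 := min_le_right (min (x - c.1.x₁) (c.1.x₂ - x)) (min (y - c.1.y₁) (c.1.y₂ - y))
        have h3 := min_le_left (x - c.1.x₁) (c.1.x₂ - x)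
        have h4 := min_le_right (x - c.1.x₁) (c.1.x₂ - x)
        have h5 := min_le_left (y - c.1.y₁) (c.1.y₂ - y)
        have h6 := min_le_right (y - c.1.y₁) (c.1.y₂ - y)
        refine ⟨?_, ?_, ?_, ?_⟩ <;> linarith
    have hnear : ∀ ε : ℝ, 0 < ε → ε ≤ m → S.σ a i = q.2 ∧ |q.1.x₁ - c.1.x₁| ≤ 3 * ε ∧
        |q.1.y₁ - c.1.y₁| ≤ 3 * ε ∧ |q.1.y₂ - c.1.y₂| ≤ 3 * ε := by
      intro ε hε hεm
      obtain ⟨ω', hω', R', Q, hR', hQ, ⟨hd1, hd2, hd3, hd4⟩, he1, he2, he3, he4⟩ :=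
        exists_near_of_mem_closure hω hR hq hε
      have hc' := childC_mem hω'.1 hR' i
      have hlin : ∀ t : ℝ, 0 ≤ t → t ≤ 1 → |R'.x₁ + R'.y₁ * t - (R.x₁ + R.y₁ * t)| ≤ 2 * ε := by
        intro t h0 h1
        rw [abs_le] at hd1 hd3 ⊢
        have e1 := mul_le_mul_of_nonneg_right hd3.1 h0
        have e2 := mul_le_mul_of_nonneg_right hd3.2 h0
        have e3 := mul_le_mul_of_nonneg_left h1 hε.le
        constructor <;> linarith
      have hsum1 := S.sum_Iic_le_one a i
      have hsum2 : ∑ j ∈ Finset.Iio i, S.τ a j ≤ ∑ j ∈ Finset.Iic i, S.τ a j :=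
        Finset.sum_le_sum_of_subset_of_nonneg
          (fun k hk => Finset.mem_Iic.2 (Finset.mem_Iio.1 hk).le) fun j _ _ => (S.τ_pos a j).le
      have hx1' : |(S.childC (R', a) i).1.x₁ - c.1.x₁| ≤ 2 * ε := by
        rw [hc, childC_x₁, childC_x₁]
        exact hlin _ (S.sum_Iio_nonneg a i) (hsum2.trans hsum1)
      have hx2' : |(S.childC (R', a) i).1.x₂ - c.1.x₂| ≤ 2 * ε := by
        rw [hc, childC_x₂, childC_x₂]
        exact hlin _ ((S.sum_Iio_nonneg a i).trans hsum2) hsum1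
      have hy1' : |(S.childC (R', a) i).1.y₁ - c.1.y₁| ≤ ε := by
        rw [hc, childC_y₁, childC_y₁, ← mul_sub, abs_mul, abs_of_pos (S.τ_pos a i)]
        exact (mul_le_of_le_one_left (abs_nonneg _) (S.τ_lt_one a i).le).trans hd3
      have hy2' : |(S.childC (R', a) i).1.y₂ - c.1.y₂| ≤ ε := by
        rw [hc, childC_y₂, childC_y₂]
        exact hd3
      rw [abs_le] at *
      have heq := eq_of_overlap hc' hQ (by dsimp only; linarith) (by dsimp only; linarith)
        (by dsimp only; linarith) (by dsimp only; linarith)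
      have h2 : S.σ a i = q.2 := congrArg Prod.snd heq
      rw [heq] at hx1' hy1' hy2'
      dsimp only at hx1' hy1' hy2'
      refine ⟨h2, ⟨?_, ?_⟩, abs_le.2 ⟨?_, ?_⟩, abs_le.2 ⟨?_, ?_⟩⟩ <;> linarith
    have hzero : ∀ d : ℝ, (∀ ε : ℝ, 0 < ε → ε ≤ m → |d| ≤ 3 * ε) → d = 0 := by
      intro d hd
      by_contra hne
      have hpos := abs_pos.2 hne
      have := hd (min m (|d| / 4)) (lt_min hm (by linarith)) (min_le_left _ _)
      have := min_le_right m (|d| / 4)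
      linarith
    have e1 := hzero _ fun ε h h' => (hnear ε h h').2.1
    have e2 := hzero _ fun ε h h' => (hnear ε h h').2.2.1
    have e3 := hzero _ fun ε h h' => (hnear ε h h').2.2.2
    have hcq : c = q := by
      refine Prod.ext (Tile.ext_out (s := false) ?_ (by linarith) (by linarith)) ?_
      · rw [Tile.out_false, Tile.out_false]
        linarith
      · rw [hc]
        exact (hnear m hm le_rfl).1
    show S.childC (R, a) i ∈ ω.tiles
    rw [← hc, hcq]
    exact hq

end WeightedSubstitution

end Kamae

namespace Kamae

open ColoredTiling

theorem exists_int_seq {X : Type*} {O : Set X} {r : X → X → Prop}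
    (h1 : ∀ p ∈ O, ∃ q ∈ O, r p q) (h2 : ∀ p ∈ O, ∃ q ∈ O, r q p) {p : X} (hp : p ∈ O) :
    ∃ t : ℤ → X, t 0 = p ∧ ∀ n, t n ∈ O ∧ r (t n) (t (n + 1)) := by
  choose f hf hfr using fun p : O => h1 p p.2
  choose b hb hbr using fun p : O => h2 p p.2
  obtain ⟨F, hF0, hF⟩ : ∃ F : ℕ → O, F 0 = ⟨p, hp⟩ ∧ ∀ n, F (n + 1) = ⟨f (F n), hf (F n)⟩ :=
    ⟨fun n => (fun q => ⟨f q, hf q⟩)^[n] ⟨p, hp⟩, rfl, fun n => Function.iterate_succ_apply' _ _ _⟩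
  obtain ⟨B, hB0, hB⟩ : ∃ B : ℕ → O, B 0 = ⟨p, hp⟩ ∧ ∀ n, B (n + 1) = ⟨b (B n), hb (B n)⟩ :=
    ⟨fun n => (fun q => ⟨b q, hb q⟩)^[n] ⟨p, hp⟩, rfl, fun n => Function.iterate_succ_apply' _ _ _⟩
  -- `Int.negSucc m` is -(m + 1), hence the index m + 1 in the backward sequence.
  let t : ℤ → O := fun n => Int.rec F (fun m => B (m + 1)) n
  have t1 : ∀ n : ℕ, t n = F n := fun _ => rfl
  have t2 : ∀ n : ℕ, t (-(n + 1)) = B (n + 1) := fun n => by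
    rw [← Int.negSucc_eq]
  refine ⟨fun n => (t n).1, congrArg Subtype.val hF0, fun n => ⟨(t n).2, ?_⟩⟩
  simp only
  obtain ⟨m, rfl | rfl⟩ := n.eq_nat_or_neg
  · have := t1 (m + 1)
    push_cast at this
    rw [this, t1, hF]
    exact hfr _
  · rcases m with _ | m
    · have h1 : t 1 = ⟨f (F 0), hf (F 0)⟩ := (t1 1).trans (hF 0)
      show r (t 0).1 (t 1).1
      rw [h1]
      exact hfr _
    · have h0 := t2 m
      push_cast
      rw [h0, show -((m : ℤ) + 1) + 1 = -m by ring, hB]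
      have h1 : t (-(m : ℤ)) = B m := by
        rcases m with _ | m
        · push_cast
          rw [neg_zero, hB0, ← hF0]
          exact t1 0
        · exact_mod_cast t2 m
      rw [h1]
      exact hbr _

namespace WeightedSubstitution

variable {A : Type*} {S : WeightedSubstitution A} {g : A → RPos} {ω : ColoredTiling A}

/-! ### The chain of the tiles which meet a vertical line -/

/-- The total weight of the letters of `σ(a)` on the left (`s = false`) or on the right
(`s = true`) of a given one. -/
noncomputable def Edge.off (s : Bool) (e : S.Edge) : ℝ :=
  bif s then 1 - ∑ j ∈ Finset.Iic e.2, S.τ e.1 j else ∑ j ∈ Finset.Iio e.2, S.τ e.1 j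

theorem Edge.off_nonneg (s : Bool) (e : S.Edge) : 0 ≤ e.off s := by
  cases s
  · exact S.sum_Iio_nonneg e.1 e.2
  · exact sub_nonneg.2 (S.sum_Iic_le_one e.1 e.2)

theorem Edge.off_add (e : S.Edge) : e.off false + e.wt + e.off true = 1 := by
  have := Finset.sum_Iio_add_eq_sum_Iic e.2 (f := S.τ e.1)
  simp only [off, cond_true, cond_false, wt]
  linarith

/-- The child of a tile which belongs to an edge. -/
def childE (p : Tile × A) (e : S.Edge) : Tile × A := (S.child p.1 e.1 e.2, e.tgt)

/-- `childE` takes an edge independent of the color of the tile, so that sequences of edges carry no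
dependent types; when the colors match it is `childC`. -/
theorem childE_eq {p : Tile × A} {e : S.Edge} (h : p.2 = e.1) :
    ∃ i, (⟨p.2, i⟩ : S.Edge) = e ∧ childE p e = S.childC p i := by
  obtain ⟨a, i⟩ := e
  simp only at h
  subst h
  exact ⟨i, rfl, rfl⟩

theorem Edge.off_pos {e : S.Edge} {s : Bool} (h : e.2 ≠ S.extIdx s e.1) : 0 < e.off s := by
  cases s
  · have hi0 : S.extIdx false e.1 < e.2 := by
      rw [Fin.lt_def]
      exact Nat.pos_of_ne_zero fun h' => h (Fin.ext h')
    have h1 := S.sum_add_le_sum (Finset.empty_subset (Finset.Iio e.2)) (Finset.mem_Iio.2 hi0)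
      (Finset.notMem_empty _)
    rw [Finset.sum_empty, zero_add] at h1
    exact (S.τ_pos _ _).trans_le h1
  · have hi0 : e.2 < S.extIdx true e.1 := by
      rw [Fin.lt_def]
      have h1 : (e.2 : ℕ) ≠ S.len e.1 - 1 := fun h' => h (Fin.ext h')
      have h2 := e.2.2
      show (e.2 : ℕ) < S.len e.1 - 1
      omega
    have h1 := S.sum_add_le_sum (Finset.subset_univ (Finset.Iic e.2)) (Finset.mem_univ
      (S.extIdx true e.1)) (by simpa using hi0)
    rw [S.τ_sum] at h1
    have := S.τ_pos e.1 (S.extIdx true e.1)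
    simp only [off, cond_true]
    linarith

theorem childE_y₁ (p : Tile × A) (e : S.Edge) : (childE p e).1.y₁ = e.wt * p.1.y₁ := rfl

theorem childE_y₂ (p : Tile × A) (e : S.Edge) : (childE p e).1.y₂ = p.1.y₁ := rfl

theorem childE_x₁ (p : Tile × A) (e : S.Edge) :
    (childE p e).1.x₁ = p.1.x₁ + p.1.y₁ * e.off false := by
  rw [← p.1.width_eq]; rfl

theorem desc_childE {p : Tile × A} {e : S.Edge} (h : p.2 = e.1) : S.Desc p (childE p e) := by
  obtain ⟨i, -, hi⟩ := childE_eq h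
  rw [hi]
  exact Desc.childC p i

theorem childE_scaleC (l : RPos) (p : Tile × A) (e : S.Edge) (h : p.2 = e.1) :
    childE (scaleC l p) e = scaleC l (childE p e) := by
  obtain ⟨a, i⟩ := e
  simp only at h
  subst h
  exact childC_scaleC S l p i

/-- The tiles `t n` form a chain of children along the edges `x n` and meet the line `x = 0`. -/
structure IsChain (x : ℤ → S.Edge) (t : ℤ → Tile × A) : Prop where
  color : ∀ n, (t n).2 = (x n).1
  child : ∀ n, t (n + 1) = childE (t n) (x n)
  x₁_neg : ∀ n, (t n).1.x₁ < 0
  x₂_pos : ∀ n, 0 < (t n).1.x₂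

/-- The condition `σ(a_n)_{i_n} = a_{n+1}` on a sequence of edges. -/
def IsPath (x : ℤ → S.Edge) : Prop := ∀ n, (x n).tgt = (x (n + 1)).1

namespace IsChain

variable {x : ℤ → S.Edge} {t : ℤ → Tile × A}

theorem isPath (h : S.IsChain x t) : S.IsPath x := fun n => by
  rw [← h.color, h.child]
  rfl

theorem comp_add (h : S.IsChain x t) (m : ℤ) :
    S.IsChain (fun n => x (n + m)) (fun n => t (n + m)) where
  color n := h.color _
  child n := by rw [← h.child, add_right_comm]
  x₁_neg n := h.x₁_neg _
  x₂_pos n := h.x₂_pos _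

theorem scaleC (h : S.IsChain x t) (l : RPos) : S.IsChain x (fun n => scaleC l (t n)) where
  color n := h.color n
  child n := by rw [childE_scaleC l _ _ (h.color n), h.child]
  x₁_neg n := mul_neg_of_pos_of_neg l.2 (h.x₁_neg n)
  x₂_pos n := mul_pos l.2 (h.x₂_pos n)

theorem y₁_succ (h : S.IsChain x t) (n : ℤ) : (t (n + 1)).1.y₁ = (x n).wt * (t n).1.y₁ := by
  rw [h.child, childE_y₁]

theorem y₂_succ (h : S.IsChain x t) (n : ℤ) : (t (n + 1)).1.y₂ = (t n).1.y₁ := by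
  rw [h.child, childE_y₂]

theorem y₁_add (h : S.IsChain x t) (n : ℤ) (k : ℕ) :
    (t (n + k)).1.y₁ = (∏ i ∈ Finset.range k, (x (n + i)).wt) * (t n).1.y₁ := by
  induction k with
  | zero => simp
  | succ k ih =>
    push_cast
    rw [← add_assoc, h.y₁_succ, ih, Finset.prod_range_succ]
    ring

theorem y₁_strictAnti (h : S.IsChain x t) : StrictAnti fun n => (t n).1.y₁ := by
  refine strictAnti_int_of_succ_lt fun n => ?_
  rw [h.y₁_succ]
  exact mul_lt_of_lt_one_left (t n).1.y₁_pos (x n).wt_lt_one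

theorem desc (h : S.IsChain x t) {m n : ℤ} (hmn : m ≤ n) : S.Desc (t m) (t n) := by
  induction n, hmn using Int.leInduction with
  | base => exact Desc.refl _
  | succ n _ ih =>
    rw [h.child]
    exact ih.trans (desc_childE (h.color n))

theorem exists_y₁_lt [Finite A] (h : S.IsChain x t) {ε : ℝ} (hε : 0 < ε) :
    ∃ n : ℕ, (t n).1.y₁ < ε := by
  obtain ⟨ρ, hρ, hρ1, hρe⟩ := S.exists_weight_le
  have h0 := (t 0).1.y₁_pos
  obtain ⟨n, hn⟩ := exists_pow_lt_of_lt_one (div_pos hε h0) hρ1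
  rw [lt_div_iff₀ h0] at hn
  refine ⟨n, lt_of_le_of_lt ?_ hn⟩
  have := h.y₁_add 0 n
  rw [zero_add] at this
  rw [this]
  refine mul_le_mul_of_nonneg_right ?_ h0.le
  calc _ ≤ ∏ _i ∈ Finset.range n, ρ :=
        Finset.prod_le_prod (fun _ _ => (Edge.wt_pos _).le) fun _ _ => hρe _
    _ = ρ ^ n := by simp

theorem exists_lt_y₁ [Finite A] (h : S.IsChain x t) (M : ℝ) : ∃ n : ℕ, M < (t (-n)).1.y₁ := by
  have hP : ∀ n : ℕ, ∃ i, t (-n) = S.childC (t (-(n + 1 : ℕ))) i := fun n => by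
    obtain ⟨i, -, hi⟩ := childE_eq (h.color (-(n + 1 : ℕ)))
    refine ⟨i, ?_⟩
    rw [← hi, ← h.child]
    congr 1
    push_cast
    ring
  obtain ⟨n, hn⟩ := exists_lt_ancestors (P := fun n : ℕ => t (-n)) hP M
  exact ⟨n, hn n le_rfl⟩

/-- The chain is determined by the edges up to scaling. -/
theorem eq_scaleC [Finite A] {t' : ℤ → Tile × A} (h : S.IsChain x t) (h' : S.IsChain x t')
    {l : RPos} (hl : (t' 0).1.y₁ = l * (t 0).1.y₁) (n : ℤ) :
    t' n = ColoredTiling.scaleC l (t n) := by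
  have hl0 : (0 : ℝ) < l := l.2
  have hy : ∀ n, (t' n).1.y₁ = l * (t n).1.y₁ := by
    intro n
    induction n with
    | zero => exact hl
    | succ n ih => rw [h.y₁_succ, h'.y₁_succ, ih]; ring
    | pred n ih =>
      have e1 := h.y₁_succ (-n - 1)
      have e2 := h'.y₁_succ (-n - 1)
      rw [sub_add_cancel] at e1 e2
      rw [e1, e2] at ih
      have := (x (-n - 1)).wt_pos
      refine mul_left_cancel₀ this.ne' ?_
      linarith
  -- This difference is constant along the chain. Both tiles contain 0 in their base, so it is
  -- bounded by l·y₁, which tends to 0.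
  have hx : ∀ n, (t' n).1.x₁ - l * (t n).1.x₁ = (t' 0).1.x₁ - l * (t 0).1.x₁ := by
    have hs : ∀ n, (t' (n + 1)).1.x₁ - l * (t (n + 1)).1.x₁ = (t' n).1.x₁ - l * (t n).1.x₁ := by
      intro n
      rw [h.child, h'.child, childE_x₁, childE_x₁, hy]
      ring
    intro n
    induction n with
    | zero => rfl
    | succ n ih => rw [hs, ih]
    | pred n ih =>
      have := hs (-n - 1)
      rw [sub_add_cancel] at this
      rw [← this, ih]
  have hx0 : (t' 0).1.x₁ - l * (t 0).1.x₁ = 0 := by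
    by_contra hne
    have hpos := abs_pos.2 hne
    obtain ⟨n, hn⟩ := h.exists_y₁_lt (ε := |(t' 0).1.x₁ - l * (t 0).1.x₁| / l) (div_pos hpos hl0)
    rw [lt_div_iff₀ hl0, ← hx n] at hn
    have a1 := h.x₁_neg n
    have a2 := h.x₂_pos n
    have a3 := h'.x₁_neg n
    have a4 := h'.x₂_pos n
    have a5 := (t n).1.width_eq
    have a6 := (t' n).1.width_eq
    have a7 := hy n
    have a8 := mul_neg_of_pos_of_neg hl0 a1
    have a9 := mul_pos hl0 a2
    have a10 : (l : ℝ) * (t n).1.x₂ - l * (t n).1.x₁ = (t n).1.y₁ * l := by rw [← a5]; ring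
    have : |(t' n).1.x₁ - l * (t n).1.x₁| ≤ (t n).1.y₁ * l := by
      rw [abs_le]
      constructor <;> linarith
    linarith
  refine Prod.ext (Tile.ext_out (s := false) ?_ (hy n) ?_) ?_
  · have := hx n
    rw [hx0] at this
    show -(t' n).1.x₁ = -(l * (t n).1.x₁)
    linarith
  · have e1 := h.y₂_succ (n - 1)
    have e2 := h'.y₂_succ (n - 1)
    rw [sub_add_cancel] at e1 e2
    show (t' n).1.y₂ = l * (t n).1.y₂
    rw [e1, e2, hy]
  · show (t' n).2 = (t n).2
    rw [h.color, h'.color]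

/-- Two chains of a tiling are equal up to a shift. -/
theorem eq_shift [Finite A] {x' : ℤ → S.Edge} {t' : ℤ → Tile × A}
    (h : S.IsChain x t) (h' : S.IsChain x' t') (hm : ∀ n, t n ∈ ω.tiles)
    (hm' : ∀ n, t' n ∈ ω.tiles) : ∃ m, ∀ n, t' n = t (n + m) ∧ x' n = x (n + m) := by
  -- m is the first index at which the chain t comes down to the lower side of t' 0.
  obtain ⟨m, hm1, hm2⟩ : ∃ m, (t m).1.y₁ ≤ (t' 0).1.y₁ ∧ (t' 0).1.y₁ < (t (m - 1)).1.y₁ := by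
    have hex : ∃ n, (t n).1.y₁ ≤ (t' 0).1.y₁ := by
      obtain ⟨n, hn⟩ := h.exists_y₁_lt (t' 0).1.y₁_pos
      exact ⟨n, hn.le⟩
    have hbd : ∃ b : ℤ, ∀ n, (t n).1.y₁ ≤ (t' 0).1.y₁ → b ≤ n := by
      obtain ⟨b, hb⟩ := h.exists_lt_y₁ (t' 0).1.y₁
      refine ⟨-b, fun n hn => ?_⟩
      exact le_of_lt (by_contra fun hc =>
        (h.y₁_strictAnti.antitone (not_lt.1 hc)).not_gt (hn.trans_lt hb))
    obtain ⟨m, hm1, hm2⟩ := Int.exists_least_of_bdd hbd hex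
    refine ⟨m, hm1, ?_⟩
    by_contra! hc
    have := hm2 _ hc
    omega
  have hover : ∀ i j, (t' i).1.y₁ < (t j).1.y₂ → (t j).1.y₁ < (t' i).1.y₂ → t' i = t j :=
    fun i j e1 e2 => eq_of_overlap (hm' i) (hm j) ((h'.x₁_neg i).trans (h.x₂_pos j))
      ((h.x₁_neg j).trans (h'.x₂_pos i)) e1 e2
  -- At most one child of a given tile crosses the axis, so equal tiles are followed by equal edges.
  have hx : ∀ n, t' n = t (n + m) → x' n = x (n + m) := by
    intro n hn
    obtain ⟨i, hi, hci⟩ := childE_eq (h.color (n + m))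
    obtain ⟨j, hj, hcj⟩ := childE_eq (h'.color n)
    rw [← h.child] at hci
    rw [← h'.child] at hcj
    have key : ∀ p q : Tile × A, p = q → ∀ i j, (S.childC p i).1.x₁ < 0 → 0 < (S.childC p i).1.x₂ →
        (S.childC q j).1.x₁ < 0 → 0 < (S.childC q j).1.x₂ →
        (⟨p.2, i⟩ : S.Edge) = ⟨q.2, j⟩ := by
      rintro p _ rfl i j e1 e2 e3 e4
      rw [eq_of_childC_overlap p (e1.trans e4) (e3.trans e2)]
    rw [← hi, ← hj]
    refine key _ _ hn j i ?_ ?_ ?_ ?_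
    · rw [← hcj]; exact h'.x₁_neg _
    · rw [← hcj]; exact h'.x₂_pos _
    · rw [← hci]; exact h.x₁_neg _
    · rw [← hci]; exact h.x₂_pos _
  have ht : ∀ n, t' n = t (n + m) := by
    intro n
    induction n with
    | zero =>
      rw [zero_add]
      refine hover 0 m ?_ ?_
      · have := h.y₂_succ (m - 1)
        rw [sub_add_cancel] at this
        rwa [this]
      · exact hm1.trans_lt (t' 0).1.y₁_lt_y₂
    | succ n ih =>
      rw [h'.child, ih, hx _ ih, ← h.child, add_right_comm]
    | pred n ih =>
      have e1 := h'.y₂_succ (-n - 1)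
      have e2 := h.y₂_succ (-n - 1 + m)
      rw [sub_add_cancel, ih] at e1
      rw [show -(n : ℤ) - 1 + m + 1 = -n + m by ring] at e2
      have e3 := (t' (-n - 1)).1.y₁_lt_y₂
      have e4 := (t (-n - 1 + m)).1.y₁_lt_y₂
      refine hover _ _ ?_ ?_ <;> linarith
  exact ⟨m, fun n => ⟨ht n, hx n (ht n)⟩⟩

end IsChain

/-- A multiplicatively periodic tiling has a chain, if one of its tiles meets the line `x = 0`. -/
theorem exists_isChain [Finite A] (hω : ω ∈ S.tilings' g) {l : RPos} (hl : 1 < (l : ℝ))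
    (hlω : ω.scale l = ω) {p : Tile × A} (hp : p ∈ ω.tiles) (h1 : p.1.x₁ < 0) (h2 : 0 < p.1.x₂) :
    ∃ (x : ℤ → S.Edge) (t : ℤ → Tile × A), S.IsChain x t ∧ ∀ n, t n ∈ ω.tiles := by
  let O : Set (Tile × A) := {p | p ∈ ω.tiles ∧ p.1.x₁ < 0 ∧ 0 < p.1.x₂}
  -- The axis might run between two children of p. It does not: l⁻¹p is a lower tile of ω crossing
  -- the axis, hence a proper descendant of p, and the child through which it descends also crosses.
  have hdown : ∀ p ∈ O, ∃ q ∈ O, ∃ e : S.Edge, p.2 = e.1 ∧ q = childE p e := by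
    rintro p ⟨hp, h1, h2⟩
    have hl' : ((l⁻¹ : RPos) : ℝ) < 1 := by
      rw [Positive.coe_inv]
      exact inv_lt_one_of_one_lt₀ hl
    have hq := scaleC_mem (scale_inv_eq hlω) hp
    have hq1 : (scaleC l⁻¹ p).1.x₁ < 0 := mul_neg_of_pos_of_neg (l⁻¹ : RPos).2 h1
    have hq2 : 0 < (scaleC l⁻¹ p).1.x₂ := mul_pos (l⁻¹ : RPos).2 h2
    have hq3 : (scaleC l⁻¹ p).1.y₁ < p.1.y₁ := mul_lt_of_lt_one_left p.1.y₁_pos hl'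
    have hD := desc_of_overlap hω hq hp (hq1.trans h2) (h1.trans hq2) hq3.le
    rcases hD.eq_or_exists_childC with heq | ⟨i, hi⟩
    · rw [← heq] at hq3
      exact absurd hq3 (lt_irrefl _)
    · exact ⟨S.childC p i, ⟨childC_mem hω hp i, hi.x₁_le.trans_lt hq1, hq2.trans_le hi.x₂_le⟩,
        ⟨p.2, i⟩, rfl, rfl⟩
  have hup : ∀ p ∈ O, ∃ q ∈ O, ∃ e : S.Edge, q.2 = e.1 ∧ p = childE q e := by
    rintro p ⟨hp, h1, h2⟩
    obtain ⟨q, hq, i, rfl⟩ := exists_parent hω hp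
    have hD := Desc.childC q i
    exact ⟨q, ⟨hq, hD.x₁_le.trans_lt h1, h2.trans_le hD.x₂_le⟩, ⟨q.2, i⟩, rfl, rfl⟩
  obtain ⟨t, -, ht⟩ := exists_int_seq hdown hup (p := p) ⟨hp, h1, h2⟩
  choose x hx1 hx2 using fun n => (ht n).2
  exact ⟨x, t, ⟨hx1, hx2, fun n => (ht n).1.2.1, fun n => (ht n).1.2.2⟩, fun n => (ht n).1.1⟩

end WeightedSubstitution

end Kamae

namespace Kamae

open ColoredTiling

namespace WeightedSubstitution

variable {A : Type*} {S : WeightedSubstitution A} {g : A → RPos} {ω : ColoredTiling A}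

/-! ### Weights of closed paths -/

/-- The product of the first `k` weights along a sequence of edges. -/
def pathWt (x : ℤ → S.Edge) (k : ℕ) : RPos := ∏ i ∈ Finset.range k, S.weight (x i).1 (x i).2

theorem coe_pathWt (x : ℤ → S.Edge) (k : ℕ) :
    (pathWt x k : ℝ) = ∏ i ∈ Finset.range k, (x i).wt := by
  induction k with
  | zero => rfl
  | succ k ih =>
    rw [pathWt, Finset.prod_range_succ, Finset.prod_range_succ, ← ih, Positive.val_mul]
    rfl

theorem pathWt_lt_one (x : ℤ → S.Edge) {k : ℕ} (hk : 0 < k) : (pathWt x k : ℝ) < 1 := by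
  obtain ⟨k, rfl⟩ := Nat.exists_eq_succ_of_ne_zero hk.ne'
  rw [coe_pathWt, Finset.prod_range_succ]
  exact mul_lt_one_of_nonneg_of_lt_one_right
    (Finset.prod_le_one (fun _ _ => (Edge.wt_pos _).le) fun _ _ => (Edge.wt_lt_one _).le)
    (Edge.wt_pos _).le (Edge.wt_lt_one _)

theorem mem_iterWord_pathWt {x : ℤ → S.Edge} (hx : S.IsPath x) (k : ℕ) :
    ((x k).1, pathWt x k) ∈ S.iterWord k (x 0).1 := by
  induction k generalizing x with
  | zero => simp [iterWord, pathWt]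
  | succ k ih =>
    have h := ih (x := fun n => x (n + 1)) fun n => hx (n + 1)
    rw [iterWord, List.mem_flatMap]
    rw [← hx 0] at h
    refine ⟨((x 0).tgt, S.weight (x 0).1 (x 0).2), ?_, ?_⟩
    · rw [List.mem_ofFn]
      exact ⟨(x 0).2, rfl⟩
    · rw [List.mem_map]
      refine ⟨_, h, Prod.ext ?_ ?_⟩
      · simp
      · simp only [pathWt, Finset.prod_range_succ' _ k]
        rw [mul_comm]
        push_cast
        rfl

theorem pathWt_mem_baseSet {x : ℤ → S.Edge} (hx : S.IsPath x) {k : ℕ}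
    (hk : ∀ n, x (n + k) = x n) : pathWt x k ∈ S.baseSet := by
  have h := mem_iterWord_pathWt hx k
  have h0 := hk 0
  rw [zero_add] at h0
  rw [h0] at h
  rw [baseSet, Subgroup.mem_sInf]
  exact fun H hH => hH.2 _ _ _ h

/-! ### Compatibility -/

theorem IsCompatible.exists_mul_eq (hg : S.IsCompatible g) (e : S.Edge) {h : RPos}
    (hh : h ∈ S.baseSet) :
    ∃ h' ∈ S.baseSet, g e.1 * S.weight e.1 e.2 * h = g e.tgt * h' := by
  have : (g e.1 * S.weight e.1 e.2) * h ∈ g e.tgt • (S.baseSet : Set RPos) := by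
    rw [Edge.tgt, hg e.1 e.2]
    exact ⟨h, hh, rfl⟩
  obtain ⟨h', hh', he⟩ := this
  exact ⟨h', hh', he.symm⟩

theorem IsCompatible.exists_eq_mul (hg : S.IsCompatible g) (e : S.Edge) {h : RPos}
    (hh : h ∈ S.baseSet) :
    ∃ h' ∈ S.baseSet, g e.tgt * h = g e.1 * S.weight e.1 e.2 * h' := by
  have : g e.tgt * h ∈ (g e.1 * S.weight e.1 e.2) • (S.baseSet : Set RPos) := by
    rw [← hg e.1 e.2]
    exact ⟨h, hh, rfl⟩
  obtain ⟨h', hh', he⟩ := this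
  exact ⟨h', hh', he.symm⟩

theorem Desc.exists_y₁_eq (hg : S.IsCompatible g) {p q : Tile × A} (h : S.Desc p q)
    (hp : ∃ h ∈ S.baseSet, p.1.y₁ = g p.2 * h) : ∃ h ∈ S.baseSet, q.1.y₁ = g q.2 * h := by
  induction h with
  | refl => exact hp
  | @tail b c _ hc ih =>
    obtain ⟨i, rfl⟩ := hc
    obtain ⟨h, hh, he⟩ := ih
    obtain ⟨h', hh', he'⟩ := hg.exists_mul_eq ⟨b.2, i⟩ hh
    refine ⟨h', hh', ?_⟩
    have e1 := congrArg Subtype.val he'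
    simp only [Positive.val_mul] at e1
    rw [childC_y₁, he]
    refine Eq.trans ?_ e1
    simp only [weight]
    ring

/-! ### Periodic chains -/

namespace IsChain

variable {x : ℤ → S.Edge} {t : ℤ → Tile × A} {k : ℕ}

theorem apply_add_period [Finite A] (h : S.IsChain x t) (hx : ∀ n, x (n + k) = x n) (n : ℤ) :
    t (n + k) = ColoredTiling.scaleC (pathWt x k) (t n) := by
  have h' := h.comp_add k
  simp only [hx] at h'
  refine h.eq_scaleC h' ?_ n
  have := h.y₁_add 0 k
  simp only [zero_add] at this ⊢
  rw [this, coe_pathWt]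

/-- Going back one period divides all coordinates by the path weight, which is less than 1. The
chain therefore exhausts the half plane, and its descendants are the whole tiling. -/
theorem exists_lt [Finite A] (h : S.IsChain x t) (hk : 0 < k) (hx : ∀ n, x (n + k) = x n)
    (X : ℝ) : ∃ n, X < -(t n).1.x₁ ∧ X < (t n).1.x₂ ∧ X < (t n).1.y₁ := by
  obtain ⟨w, hw⟩ : ∃ w, w = pathWt x k := ⟨_, rfl⟩
  have hw0 : (0 : ℝ) < w := w.2
  have hw1 : (w : ℝ) < 1 := hw ▸ pathWt_lt_one x hk
  have key : ∀ j : ℕ, -(t 0).1.x₁ = (w : ℝ) ^ j * -(t (-(j * k : ℤ))).1.x₁ ∧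
      (t 0).1.x₂ = (w : ℝ) ^ j * (t (-(j * k : ℤ))).1.x₂ ∧
      (t 0).1.y₁ = (w : ℝ) ^ j * (t (-(j * k : ℤ))).1.y₁ := by
    intro j
    induction j with
    | zero => simp
    | succ j ih =>
      have := h.apply_add_period hx (-((j + 1 : ℕ) * k : ℤ))
      rw [show -((j + 1 : ℕ) * k : ℤ) + k = -(j * k : ℤ) by push_cast; ring, ← hw] at this
      rw [this] at ih
      refine ⟨ih.1.trans ?_, ih.2.1.trans ?_, ih.2.2.trans ?_⟩ <;>
        simp only [ColoredTiling.scaleC, Tile.scale] <;> ring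
  have hpos : 0 < min (-(t 0).1.x₁) (min (t 0).1.x₂ (t 0).1.y₁) :=
    lt_min (neg_pos.2 (h.x₁_neg 0)) (lt_min (h.x₂_pos 0) (t 0).1.y₁_pos)
  obtain ⟨j, hj⟩ := exists_pow_lt_of_lt_one (div_pos hpos (show 0 < |X| + 1 by positivity)) hw1
  rw [lt_div_iff₀ (by positivity), lt_min_iff, lt_min_iff] at hj
  obtain ⟨k1, k2, k3⟩ := key j
  rw [k1, k2, k3] at hj
  have hwj := pow_pos hw0 j
  rw [mul_lt_mul_iff_right₀ hwj, mul_lt_mul_iff_right₀ hwj, mul_lt_mul_iff_right₀ hwj] at hj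
  have := le_abs_self X
  exact ⟨-(j * k : ℤ), by linarith, by linarith, by linarith⟩

theorem exists_desc [Finite A] (h : S.IsChain x t) (hk : 0 < k) (hx : ∀ n, x (n + k) = x n)
    (hω : ω ∈ S.tilings' g) (hm : ∀ n, t n ∈ ω.tiles) {p : Tile × A} (hp : p ∈ ω.tiles) :
    ∃ n, S.Desc (t n) p := by
  obtain ⟨n, h1, h2, h3⟩ := h.exists_lt hk hx (max (-p.1.x₁) (max p.1.x₂ p.1.y₁))
  rw [max_lt_iff, max_lt_iff] at h1 h2 h3
  have := p.1.x₁_lt_x₂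
  exact ⟨n, desc_of_overlap hω hp (hm n) (by linarith) (by linarith) h3.2.2.le⟩

/-- A tiling with a periodic chain is determined by the chain. -/
theorem eq_of_mem [Finite A] (h : S.IsChain x t) (hk : 0 < k) (hx : ∀ n, x (n + k) = x n)
    {ω' : ColoredTiling A} (hω : ω ∈ S.tilings' g) (hm : ∀ n, t n ∈ ω.tiles)
    (hω' : ω' ∈ S.tilings' g) (hm' : ∀ n, t n ∈ ω'.tiles) : ω = ω' := by
  refine eq_of_subset fun p hp => ?_
  obtain ⟨n, hn⟩ := h.exists_desc hk hx hω hm hp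
  exact hn.mem hω' (hm' n)

theorem scale_eq [Finite A] (h : S.IsChain x t) (hk : 0 < k) (hx : ∀ n, x (n + k) = x n)
    (hω : ω ∈ S.tilings' g) (hm : ∀ n, t n ∈ ω.tiles) : ω.scale (pathWt x k)⁻¹ = ω := by
  refine h.eq_of_mem hk hx
    (scale_mem_tilings' hω (inv_mem (pathWt_mem_baseSet h.isPath hx))) (fun n => ?_) hω hm
  refine ⟨t (n + k), hm _, ?_⟩
  show ColoredTiling.scaleC _ _ = _
  rw [h.apply_add_period hx, ← scaleC_mul, inv_mul_cancel, scaleC_one]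

/-- The multiplicative periods of a tiling with a chain come from the periods of the chain. -/
theorem exists_of_scale_eq [Finite A] (h : S.IsChain x t) (hm : ∀ n, t n ∈ ω.tiles) {l : RPos}
    (hl : 1 < (l : ℝ)) (hlω : ω.scale l = ω) :
    ∃ k : ℕ, 0 < k ∧ (∀ n, x (n + k) = x n) ∧ l = (pathWt x k)⁻¹ := by
  -- The scaled chain is again a chain of ω, so it is a shift by some m; its tiles are larger, so m
  -- < 0 and -m is a period of the edges.
  obtain ⟨m, hmt⟩ := h.eq_shift (h.scaleC l) hm fun n => scaleC_mem hlω (hm n)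
  have hy : (l : ℝ) * (t 0).1.y₁ = (t m).1.y₁ := by
    have := congrArg (fun p => p.1.y₁) (hmt 0).1
    simpa [ColoredTiling.scaleC, Tile.scale] using this
  have hm0 : m < 0 := by
    by_contra! hc
    have h1 : (t m).1.y₁ ≤ (t 0).1.y₁ := h.y₁_strictAnti.antitone hc
    have := lt_mul_of_one_lt_left (t 0).1.y₁_pos hl
    linarith
  obtain ⟨k, rfl⟩ : ∃ k : ℕ, m = -k := ⟨m.natAbs, by omega⟩
  have hx : ∀ n, x (n + k) = x n := fun n => by
    have := (hmt (n + k)).2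
    rwa [add_neg_cancel_right] at this
  refine ⟨k, by omega, hx, ?_⟩
  have h2 := h.apply_add_period hx (-k)
  rw [neg_add_cancel] at h2
  have h3 : (t 0).1.y₁ = pathWt x k * (t (-k)).1.y₁ := congrArg (fun p => p.1.y₁) h2
  rw [h3] at hy
  refine eq_inv_of_mul_eq_one_left (Subtype.ext ?_)
  rw [Positive.val_mul]
  refine mul_right_cancel₀ (t (-k)).1.y₁_pos.ne' ?_
  rw [mul_assoc, hy]
  exact (one_mul _).symm

end IsChain

/-! ### Construction of tilings with periodic chains -/

/-- Applied to the relative distances θ and 1 - θ of the axis from the two sides: one non-extremal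
edge further along the path makes the distance positive. -/
theorem pos_of_eq_add_mul {v o w : ℤ → ℝ} (hv : ∀ n, 0 ≤ v n) (ho : ∀ n, 0 ≤ o n)
    (hw : ∀ n, 0 < w n) (h : ∀ n, v n = o n + w n * v (n + 1)) {n : ℤ} {j : ℕ}
    (hj : 0 < o (n + j)) : 0 < v n := by
  induction j generalizing n with
  | zero =>
    rw [Nat.cast_zero, add_zero] at hj
    rw [h]
    have := mul_nonneg (hw n).le (hv (n + 1))
    linarith
  | succ j ih =>
    have := ih (n := n + 1) (by push_cast at hj; rwa [add_assoc, add_comm 1 (j : ℤ)])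
    rw [h]
    have := mul_pos (hw n) this
    linarith [ho n]

/-- θ n is the position of the axis inside the n-th tile relative to its width, given by the series
of the left offsets scaled by the weights already passed. -/
theorem exists_offset (x : ℤ → S.Edge) :
    ∃ θ : ℤ → ℝ, (∀ n, 0 ≤ θ n ∧ θ n ≤ 1) ∧
      ∀ n, θ n = (x n).off false + (x n).wt * θ (n + 1) := by
  obtain ⟨f, hf⟩ : ∃ f : ℤ → ℕ → ℝ, f = fun n (j : ℕ) =>
    (x (n + j)).off false * ∏ i ∈ Finset.range j, (x (n + i)).wt := ⟨_, rfl⟩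
  have hf0 : ∀ n j, 0 ≤ f n j := fun n j => by
    rw [hf]
    exact mul_nonneg (Edge.off_nonneg _ _) (Finset.prod_nonneg fun _ _ => (Edge.wt_pos _).le)
  have hsum : ∀ n N, ∑ j ∈ Finset.range N, f n j + ∏ i ∈ Finset.range N, (x (n + i)).wt ≤ 1 := by
    intro n N
    induction N with
    | zero => simp
    | succ N ih =>
      rw [Finset.sum_range_succ, Finset.prod_range_succ]
      have h1 := (x (n + N)).off_add
      have h2 := (x (n + N)).off_nonneg true
      have h3 : 0 ≤ ∏ i ∈ Finset.range N, (x (n + i)).wt :=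
        Finset.prod_nonneg fun _ _ => (Edge.wt_pos _).le
      have h4 : f n N = (x (n + N)).off false * ∏ i ∈ Finset.range N, (x (n + i)).wt := by rw [hf]
      rw [h4]
      nlinarith
  have hle : ∀ n N, ∑ j ∈ Finset.range N, f n j ≤ 1 := fun n N => by
    have := hsum n N
    have h3 : 0 ≤ ∏ i ∈ Finset.range N, (x (n + i)).wt :=
      Finset.prod_nonneg fun _ _ => (Edge.wt_pos _).le
    linarith
  refine ⟨fun n => ∑' j, f n j, fun n => ⟨tsum_nonneg (hf0 n),
    Real.tsum_le_of_sum_range_le (hf0 n) (hle n)⟩, fun n => ?_⟩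
  have hs := summable_of_sum_range_le (hf0 n) (hle n)
  show ∑' j, f n j = _ + _ * ∑' j, f (n + 1) j
  rw [hs.tsum_eq_zero_add, ← tsum_mul_left]
  congr 1
  · simp [hf]
  · refine tsum_congr fun j => ?_
    simp only [hf, Finset.prod_range_succ' _ j]
    push_cast
    rw [show n + ((j : ℤ) + 1) = n + 1 + j by ring, add_zero]
    simp only [show ∀ i : ℕ, n + ((i : ℤ) + 1) = n + 1 + i from fun i => by ring]
    ring

/-- Some edges of the sequence are not leftmost, and some are not rightmost. -/
def IsTwoSided (x : ℤ → S.Edge) : Prop := ∀ s, ∃ n, (x n).2 ≠ S.extIdx s (x n).1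

/-- Along a path extremal on one side, that side would stay at a fixed positive distance from the
axis, although the widths tend to 0. -/
theorem IsChain.isTwoSided [Finite A] {x : ℤ → S.Edge} {t : ℤ → Tile × A} (h : S.IsChain x t) :
    S.IsTwoSided x := by
  intro s
  by_contra! hc
  have hout : ∀ n : ℕ, (t n).1.out s = (t 0).1.out s := by
    intro n
    induction n with
    | zero => rfl
    | succ n ih =>
      obtain ⟨i, hi, hci⟩ := childE_eq (h.color n)
      have h1 := hc n
      rw [← hi] at h1
      rw [← ih]
      push_cast
      rw [h.child, hci, show i = S.extIdx s (t n).2 from h1, out_childC_extIdx]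
  have hpos : 0 < (t 0).1.out s := by
    cases s
    · exact neg_pos.2 (h.x₁_neg 0)
    · exact h.x₂_pos 0
  obtain ⟨n, hn⟩ := h.exists_y₁_lt hpos
  have h1 := hout n
  have h2 := (t n).1.out_add_out_not s
  have h3 : 0 < (t n).1.out (!s) := by
    cases s
    · exact h.x₂_pos n
    · exact neg_pos.2 (h.x₁_neg n)
  linarith

theorem exists_isChain_of_path (hg : S.IsCompatible g) {x : ℤ → S.Edge} (hx : S.IsPath x)
    {k : ℕ} (hk : 0 < k) (hxk : ∀ n, x (n + k) = x n) (hx2 : S.IsTwoSided x) :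
    ∃ t, S.IsChain x t ∧ ∀ n, ∃ h ∈ S.baseSet, (t n).1.y₁ = g (t n).2 * h := by
  obtain ⟨θ, hθ, hθr⟩ := exists_offset x
  have hper : ∀ s n, ∃ j : ℕ, 0 < (x (n + j)).off s := by
    intro s n
    obtain ⟨m, hm⟩ := hx2 s
    have hmul : ∀ (j : ℕ) (i : ℤ), x (i + j * k) = x i := by
      intro j i
      induction j with
      | zero => simp
      | succ j ih => rw [← ih, ← hxk (i + j * k)]; congr 1; push_cast; ring
    have hge : (0 : ℤ) ≤ m - n + (m - n).natAbs * k := by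
      have h1 : (1 : ℤ) ≤ k := by exact_mod_cast hk
      have h2 : (((m - n).natAbs : ℕ) : ℤ) = |m - n| := Int.natCast_natAbs _
      have h3 := neg_abs_le (m - n)
      have h4 := abs_nonneg (m - n)
      rw [h2]
      nlinarith
    refine ⟨(m - n + (m - n).natAbs * k).toNat, ?_⟩
    rw [Int.toNat_of_nonneg hge, show n + (m - n + (m - n).natAbs * k) =
      m + (m - n).natAbs * k by ring, hmul]
    exact Edge.off_pos hm
  have hθ0 : ∀ n, 0 < θ n := fun n =>
    pos_of_eq_add_mul (fun n => (hθ n).1) (fun n => (x n).off_nonneg false)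
      (fun n => (x n).wt_pos) hθr (hper false n).choose_spec
  have hθ1 : ∀ n, 0 < 1 - θ n := fun n =>
    pos_of_eq_add_mul (v := fun n => 1 - θ n) (fun n => sub_nonneg.2 (hθ n).2)
      (fun n => (x n).off_nonneg true) (fun n => (x n).wt_pos) (fun n => by
        have := (x n).off_add
        rw [hθr n]
        linarith) (hper true n).choose_spec
  -- The lower ordinates are built in both directions as a sequence of pairs (index, height), with
  -- the height in g(a)G at each index; compatibility of g provides both steps.
  obtain ⟨O, hO⟩ : ∃ O : Set (ℤ × RPos),
    O = {p | ∃ h ∈ S.baseSet, p.2 = g (x p.1).1 * h} := ⟨_, rfl⟩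
  obtain ⟨r, hr⟩ : ∃ r : ℤ × RPos → ℤ × RPos → Prop,
    r = fun p q => q.1 = p.1 + 1 ∧ q.2 = S.weight (x p.1).1 (x p.1).2 * p.2 := ⟨_, rfl⟩
  have h1 : ∀ p ∈ O, ∃ q ∈ O, r p q := by
    subst hO hr
    rintro ⟨n, w⟩ ⟨h, hh, hw⟩
    obtain ⟨h', hh', he⟩ := hg.exists_mul_eq (x n) hh
    refine ⟨(n + 1, S.weight (x n).1 (x n).2 * w), ⟨h', hh', ?_⟩, rfl, rfl⟩
    simp only at hw ⊢
    rw [hw, ← hx n, ← he]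
    ac_rfl
  have h2 : ∀ p ∈ O, ∃ q ∈ O, r q p := by
    subst hO hr
    rintro ⟨n, w⟩ ⟨h, hh, hw⟩
    obtain ⟨h', hh', he⟩ := hg.exists_eq_mul (x (n - 1)) hh
    refine ⟨(n - 1, (S.weight (x (n - 1)).1 (x (n - 1)).2)⁻¹ * w), ⟨h', hh', ?_⟩,
      (sub_add_cancel n 1).symm, (mul_inv_cancel_left _ _).symm⟩
    have hp := hx (n - 1)
    rw [sub_add_cancel] at hp
    simp only at hw ⊢
    rw [inv_mul_eq_iff_eq_mul, hw, ← hp, he]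
    ac_rfl
  obtain ⟨V, hV0, hV⟩ := exists_int_seq h1 h2 (p := (0, g (x 0).1))
    (hO ▸ ⟨1, one_mem _, (mul_one _).symm⟩)
  subst hO hr
  have hVn : ∀ n, (V n).1 = n := by
    intro n
    induction n with
    | zero => rw [hV0]
    | succ n ih => rw [(hV n).2.1, ih]
    | pred n ih =>
      have := (hV (-n - 1)).2.1
      rw [sub_add_cancel, ih] at this
      omega
  obtain ⟨W, hW⟩ : ∃ W : ℤ → ℝ, ∀ n, W n = (V n).2 := ⟨_, fun _ => rfl⟩
  have hW0 : ∀ n, 0 < W n := fun n => by rw [hW]; exact (V n).2.2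
  have hWs : ∀ n, W (n + 1) = (x n).wt * W n := fun n => by
    rw [hW, hW, (hV n).2.2, hVn, Positive.val_mul]
    rfl
  have hWp : ∀ n, W n = (x (n - 1)).wt * W (n - 1) := fun n => by
    rw [← hWs, sub_add_cancel]
  -- The tile of width W n is placed so that the axis divides it in the ratio θ n : 1 - θ n; its top
  -- is the lower side of the preceding tile.
  refine ⟨fun n => (⟨-θ n * W n, (1 - θ n) * W n, W n, W (n - 1), hW0 n, ?_, by ring⟩, (x n).1),
    ⟨fun n => rfl, fun n => ?_, fun n => ?_, fun n => ?_⟩, fun n => ?_⟩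
  · rw [hWp n]
    exact mul_lt_of_lt_one_left (hW0 _) (Edge.wt_lt_one _)
  · refine Prod.ext (Tile.ext_out (s := false) ?_ ?_ ?_) ?_
    · rw [Tile.out_false, Tile.out_false, childE_x₁]
      show -(-θ (n + 1) * W (n + 1)) = -(-θ n * W n + W n * (x n).off false)
      rw [hWs, hθr n]
      ring
    · rw [childE_y₁]
      exact hWs n
    · rw [childE_y₂]
      simp
    · exact (hx n).symm
  · exact mul_neg_of_neg_of_pos (neg_neg_of_pos (hθ0 n)) (hW0 n)
  · exact mul_pos (hθ1 n) (hW0 n)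
  · obtain ⟨h, hh, he⟩ := (hV n).1
    refine ⟨h, hh, ?_⟩
    rw [hVn] at he
    show W n = _
    rw [hW, he, Positive.val_mul]

/-- The descendants of the tiles of a periodic chain form a tiling. -/
theorem IsChain.exists_tiling [Finite A] (hg : S.IsCompatible g) {x : ℤ → S.Edge}
    {t : ℤ → Tile × A} (h : S.IsChain x t) {k : ℕ} (hk : 0 < k) (hx : ∀ n, x (n + k) = x n)
    (ht : ∀ n, ∃ h ∈ S.baseSet, (t n).1.y₁ = g (t n).2 * h) :
    ∃ ω ∈ S.tilings'' g, ∀ n, t n ∈ ω.tiles := by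
  let ω : ColoredTiling A :=
    { tiles := {q | ∃ n, S.Desc (t n) q}
      disjoint := by
        -- Both tiles descend from the chain tile of index min m n.
        rintro p ⟨m, hm⟩ q ⟨n, hn⟩ hne
        exact (((h.desc (min_le_left m n)).trans hm).eq_or_disjoint
          ((h.desc (min_le_right m n)).trans hn)).resolve_left hne
      cover := by
        ext z
        simp only [Set.mem_iUnion, exists_prop, Set.mem_ofPred_eq, Tile.mem_closure_toSet]
        constructor
        · rintro ⟨p, -, -, hp, -⟩
          exact p.1.y₁_pos.trans_le hp
        · intro hz
          obtain ⟨n, h1, h2, h3⟩ := h.exists_lt hk hx (max |z.re| z.im)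
          rw [max_lt_iff] at h1 h2 h3
          obtain ⟨q, hq, hq'⟩ := exists_desc_mem_closure (S := S) (t n) (x := z.re) (y := z.im)
            (by linarith [neg_abs_le z.re]) (by linarith [le_abs_self z.re]) hz
            (by linarith [(t n).1.y₁_lt_y₂])
          exact ⟨q, ⟨n, hq⟩, hq'⟩ }
  refine ⟨ω, ⟨fun R a => ?_, ?_⟩, fun n => ⟨n, Desc.refl _⟩⟩
  · rintro ⟨n, hn⟩
    exact ⟨hn.exists_y₁_eq hg (ht n), fun i => ⟨n, hn.trans (Desc.childC (R, a) i)⟩⟩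
  · rintro ⟨c, hc⟩
    obtain ⟨n, h1, h2, -⟩ := h.exists_lt hk hx |c|
    have := hc (t n) ⟨n, Desc.refl _⟩
    obtain ⟨y, hy⟩ := exists_between (t n).1.y₁_lt_y₂
    rw [Set.disjoint_left] at this
    refine this (a := ⟨c, y⟩) (Tile.mem_toSet.2 ⟨⟨?_, ?_⟩, hy⟩) rfl
    · show _ < c
      linarith [neg_abs_le c]
    · show c < _
      linarith [le_abs_self c]

end WeightedSubstitution

end Kamae

namespace Kamae

open ColoredTiling

/-- A tile of the tiling meets the line `x = 0`. -/
def ColoredTiling.HasCrossing {A : Type*} (ω : ColoredTiling A) : Prop :=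
  ∃ p ∈ ω.tiles, p.1.x₁ < 0 ∧ 0 < p.1.x₂

namespace WeightedSubstitution

variable {A : Type*} {S : WeightedSubstitution A} {g : A → RPos} {ω ω' : ColoredTiling A}

/-! ### Orbits -/

theorem mem_orbit_self (ω : ColoredTiling A) : ω ∈ S.orbit ω :=
  ⟨1, one_mem _, (scale_one ω).symm⟩

theorem orbit_scale {l : RPos} (hl : l ∈ S.baseSet) (ω : ColoredTiling A) :
    S.orbit (ω.scale l) = S.orbit ω := by
  ext ω'
  constructor
  · rintro ⟨m, hm, rfl⟩
    exact ⟨m * l, mul_mem hm hl, (scale_mul _ _ _).symm⟩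
  · rintro ⟨m, hm, rfl⟩
    exact ⟨m * l⁻¹, mul_mem hm (inv_mem hl), by rw [← scale_mul, inv_mul_cancel_right]⟩

theorem hasCrossing_scale {l : RPos} (h : ω.HasCrossing) : (ω.scale l).HasCrossing := by
  obtain ⟨p, hp, h1, h2⟩ := h
  exact ⟨_, scaleC_mem_scale hp, mul_neg_of_pos_of_neg l.2 h1, mul_pos l.2 h2⟩

theorem mem_cycles_orbit_iff {l : ℝ} : l ∈ S.cycles (S.orbit ω) ↔
    1 < l ∧ ∃ m ∈ S.baseSet, (m : ℝ) = l ∧ ω.scale m = ω := by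
  constructor
  · rintro ⟨h1, m, hm, hml, h⟩
    exact ⟨h1, m, hm, hml, h ω (mem_orbit_self ω)⟩
  · rintro ⟨h1, m, hm, hml, h⟩
    refine ⟨h1, m, hm, hml, ?_⟩
    rintro _ ⟨n, -, rfl⟩
    rw [← scale_mul, mul_comm, scale_mul, h]

/-! ### Cyclic paths and closed orbits -/

theorem apply_emod {E : Type*} {f : ℤ → E} {k : ℤ} (h : Function.Periodic f k) (n : ℤ) :
    f (n % k) = f n := by
  have := h.int_mul (n / k) (n % k)
  rw [← this]
  congr 1
  simp only [Int.cast_id]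
  rw [mul_comm]
  exact Int.emod_add_mul_ediv n k

/-- The cyclic sequence of edges consists of consecutive edges. -/
def IsCyclicPath (γ : CyclicSeq S.Edge) : Prop := S.IsPath γ.out.1

/-- The weight of a cyclic sequence of edges. -/
noncomputable def cyclicPathWt (γ : CyclicSeq S.Edge) : RPos :=
  pathWt γ.out.1 (Function.minimalPeriod PeriodicSeq.shift γ.out)

theorem cyclicPathWt_lt_one (γ : CyclicSeq S.Edge) : (cyclicPathWt γ : ℝ) < 1 :=
  pathWt_lt_one _ (PeriodicSeq.minimalPeriod_pos _)

theorem apply_add_minimalPeriod (x : PeriodicSeq S.Edge) (n : ℤ) :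
    x.1 (n + (Function.minimalPeriod PeriodicSeq.shift x : ℕ)) = x.1 n :=
  PeriodicSeq.isPeriodicPt_iff.1 (Function.isPeriodicPt_minimalPeriod _ x) n

theorem ofReal_prod_cpow {ι : Type*} (s : Finset ι) {f : ι → ℝ} (hf : ∀ i, 0 < f i) (α : ℂ) :
    ((∏ i ∈ s, f i : ℝ) : ℂ) ^ α = ∏ i ∈ s, (f i : ℂ) ^ α := by
  classical
  induction s using Finset.induction_on with
  | empty => simp
  | insert i s hi ih =>
    rw [Finset.prod_insert hi, Finset.prod_insert hi, Complex.ofReal_mul,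
      Complex.mul_cpow_ofReal_nonneg (hf i).le (Finset.prod_nonneg fun j _ => (hf j).le), ih]

theorem weight_edgeWeight_of_isCyclicPath [DecidableEq A] {γ : CyclicSeq S.Edge}
    (h : IsCyclicPath γ) (α : ℂ) :
    CyclicSeq.weight (S.edgeWeight α) γ = (cyclicPathWt γ : ℂ) ^ α := by
  conv_lhs => rw [← Quotient.out_eq γ]
  obtain ⟨k, hk⟩ : ∃ k, Function.minimalPeriod PeriodicSeq.shift γ.out = k + 1 :=
    Nat.exists_eq_succ_of_ne_zero (PeriodicSeq.minimalPeriod_pos _).ne'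
  have hper := apply_add_minimalPeriod γ.out
  rw [CyclicSeq.weight_mk, cyclicPathWt, coe_pathWt, ofReal_prod_cpow _ fun i => Edge.wt_pos _,
    PeriodicSeq.weight]
  rw [hk] at hper ⊢
  have h1 : ∀ i : ℕ, S.edgeWeight α (γ.out.1 i) (γ.out.1 (i + 1)) =
      ((γ.out.1 ((i + 1 : ℕ) : ℤ)).wt : ℂ) ^ α := fun i => by
    rw [edgeWeight, if_pos (h i)]
    push_cast
    rfl
  -- A transition carries the weight of its target, so the product runs over the indices 1, …, p
  -- instead of 0, …, p - 1; periodicity identifies the two ends.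
  rw [Finset.prod_congr rfl fun i _ => h1 i, Finset.prod_range_succ, Finset.prod_range_succ']
  congr 3
  have := hper 0
  rw [zero_add] at this
  rw [this]
  rfl

theorem weight_edgeWeight_eq_zero [DecidableEq A] {γ : CyclicSeq S.Edge}
    (h : ¬ IsCyclicPath γ) (α : ℂ) : CyclicSeq.weight (S.edgeWeight α) γ = 0 := by
  conv_lhs => rw [← Quotient.out_eq γ]
  rw [CyclicSeq.weight_mk, PeriodicSeq.weight, Finset.prod_eq_zero_iff]
  rw [IsCyclicPath, IsPath] at h
  push Not at h
  obtain ⟨n, hn⟩ := h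
  have hk := PeriodicSeq.minimalPeriod_pos γ.out
  have hper := apply_add_minimalPeriod γ.out
  generalize Function.minimalPeriod PeriodicSeq.shift γ.out = k at hk hper
  have hk0 : (0 : ℤ) < k := by exact_mod_cast hk
  have hmod := Int.emod_nonneg n hk0.ne'
  have hP : Function.Periodic γ.out.1 k := hper
  have hP1 : Function.Periodic (fun n => γ.out.1 (n + 1)) k := fun n => by
    show γ.out.1 (n + k + 1) = _
    rw [add_right_comm]
    exact hper _
  refine ⟨(n % k).toNat, ?_, ?_⟩
  · rw [Finset.mem_range, Int.toNat_lt hmod]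
    exact Int.emod_lt_of_pos n hk0
  · rw [Int.toNat_of_nonneg hmod, edgeWeight, if_neg]
    have e1 := apply_emod hP1 n
    rw [apply_emod hP, e1]
    exact hn

/-- The multiplicative periods of ω are exactly the inverse path weights over the periods of x, and
these increase with the period because all weights are below 1. -/
theorem minCycle_orbit [Finite A] (hω : ω ∈ S.tilings' g) {x : PeriodicSeq S.Edge}
    {t : ℤ → Tile × A} (h : S.IsChain x.1 t) (hm : ∀ n, t n ∈ ω.tiles) :
    S.minCycle (S.orbit ω) =
      ((pathWt x.1 (Function.minimalPeriod PeriodicSeq.shift x))⁻¹ : RPos) := by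
  refine IsLeast.csInf_eq ⟨?_, ?_⟩
  · rw [mem_cycles_orbit_iff]
    refine ⟨?_, _, inv_mem (pathWt_mem_baseSet h.isPath (apply_add_minimalPeriod x)), rfl,
      h.scale_eq (PeriodicSeq.minimalPeriod_pos x) (apply_add_minimalPeriod x) hω hm⟩
    rw [Positive.coe_inv]
    exact (one_lt_inv₀ (pathWt _ _).2).2 (pathWt_lt_one _ (PeriodicSeq.minimalPeriod_pos x))
  · intro l hl
    rw [mem_cycles_orbit_iff] at hl
    obtain ⟨h1, l, hl, rfl, hlω⟩ := hl
    obtain ⟨k, hk, hxk, rfl⟩ := h.exists_of_scale_eq hm h1 hlω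
    rw [Positive.coe_inv, Positive.coe_inv]
    refine inv_anti₀ (pathWt _ _).2 ?_
    rw [coe_pathWt, coe_pathWt]
    have hle := (PeriodicSeq.isPeriodicPt_iff.2 hxk).minimalPeriod_le hk
    obtain ⟨j, rfl⟩ := Nat.exists_eq_add_of_le hle
    rw [Finset.prod_range_add]
    exact mul_le_of_le_one_right (Finset.prod_nonneg fun _ _ => (Edge.wt_pos _).le)
      (Finset.prod_le_one (fun _ _ => (Edge.wt_pos _).le) fun _ _ => (Edge.wt_lt_one _).le)

theorem isPath_shift_zpow {x : PeriodicSeq S.Edge} (h : S.IsPath x.1) (m : ℤ) :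
    S.IsPath ((PeriodicSeq.shift ^ m) x).1 := fun n => by
  rw [PeriodicSeq.shift_zpow_apply, PeriodicSeq.shift_zpow_apply, add_right_comm]
  exact h _

theorem isTwoSided_shift_zpow {x : PeriodicSeq S.Edge} (h : S.IsTwoSided x.1) (m : ℤ) :
    S.IsTwoSided ((PeriodicSeq.shift ^ m) x).1 := fun s => by
  obtain ⟨n, hn⟩ := h s
  refine ⟨n - m, ?_⟩
  rwa [PeriodicSeq.shift_zpow_apply, sub_add_cancel]

theorem exists_orbit_of_isCyclicPath [Finite A] (hg : S.IsCompatible g) {γ : CyclicSeq S.Edge}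
    (h : IsCyclicPath γ) (h2 : S.IsTwoSided γ.out.1) :
    ∃ ω ∈ S.tilings'' g, ∃ t, S.IsChain γ.out.1 t ∧ ∀ n, t n ∈ ω.tiles := by
  have hk := PeriodicSeq.minimalPeriod_pos γ.out
  have hper := apply_add_minimalPeriod γ.out
  obtain ⟨t, ht, hty⟩ := exists_isChain_of_path hg h hk hper h2
  obtain ⟨ω, hω, hm⟩ := ht.exists_tiling hg hk hper hty
  exact ⟨ω, hω, t, ht, hm⟩

/-- The cyclic paths which are neither leftmost nor rightmost correspond to the closed orbits of
the tilings with a tile which meets the line `x = 0`. -/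
theorem exists_equiv_closedOrbits [Finite A] (hg : S.IsCompatible g) :
    ∃ e : {γ : CyclicSeq S.Edge | IsCyclicPath γ ∧ S.IsTwoSided γ.out.1} ≃
      {ξ : S.closedOrbits g | ∃ ω ∈ ξ.1, ω.HasCrossing},
      ∀ γ, S.minCycle (e γ).1.1 = ((cyclicPathWt γ.1)⁻¹ : RPos) := by
  have hex := fun γ : {γ : CyclicSeq S.Edge | IsCyclicPath γ ∧ S.IsTwoSided γ.out.1} =>
    exists_orbit_of_isCyclicPath hg γ.2.1 γ.2.2
  choose W hW t ht hm using hex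
  have hWs : ∀ γ, W γ ∈ S.tilingSpace g := fun γ => subset_closure (hW γ)
  have hcl : ∀ γ, S.orbit (W γ) ∈ S.closedOrbits g := fun γ => by
    have hk := PeriodicSeq.minimalPeriod_pos γ.1.out
    have hper := apply_add_minimalPeriod γ.1.out
    refine ⟨W γ, hWs γ, ⟨_, inv_mem (pathWt_mem_baseSet (ht γ).isPath hper), ?_,
      (ht γ).scale_eq hk hper (hW γ).1 (hm γ)⟩, rfl⟩
    rw [Positive.coe_inv]
    exact (one_lt_inv₀ (pathWt _ _).2).2 (pathWt_lt_one _ hk)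
  let F : {γ : CyclicSeq S.Edge | IsCyclicPath γ ∧ S.IsTwoSided γ.out.1} →
      {ξ : S.closedOrbits g | ∃ ω ∈ ξ.1, ω.HasCrossing} := fun γ =>
    ⟨⟨S.orbit (W γ), hcl γ⟩, W γ, mem_orbit_self _, t γ 0, hm γ 0, (ht γ).x₁_neg 0,
      (ht γ).x₂_pos 0⟩
  have hF : Function.Bijective F := by
    constructor
    · intro γ γ' he
      have he' : S.orbit (W γ) = S.orbit (W γ') := congrArg (fun ξ => ξ.1.1) he
      obtain ⟨l, -, hl⟩ : W γ' ∈ S.orbit (W γ) := he' ▸ mem_orbit_self _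
      -- Both paths are read along the axis of one tiling, so they differ by a shift.
      obtain ⟨m, hmt⟩ := ((ht γ).scaleC l).eq_shift (ht γ')
        (fun n => hl ▸ scaleC_mem_scale (hm γ n)) (hm γ')
      refine Subtype.ext ?_
      rw [← Quotient.out_eq γ.1, ← Quotient.out_eq γ'.1]
      refine Quotient.sound ⟨m, Subtype.ext (funext fun n => ?_)⟩
      rw [PeriodicSeq.shift_zpow_apply]
      exact (hmt n).2.symm
    · rintro ⟨⟨ξ, ω, hω, ⟨l, hl, hl1, hlω⟩, rfl⟩, ω', ⟨m, hm', rfl⟩, hcr⟩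
      obtain ⟨p, hp, hp1, hp2⟩ : ω.HasCrossing := by
        have := hasCrossing_scale (l := m⁻¹) hcr
        rwa [← scale_mul, inv_mul_cancel, scale_one] at this
      have hω' := tilingSpace_subset_tilings' hω
      obtain ⟨x, u, hu, hum⟩ := exists_isChain hω' hl1 hlω hp hp1 hp2
      obtain ⟨k, hk, hxk, -⟩ := hu.exists_of_scale_eq hum hl1 hlω
      obtain ⟨y, hy⟩ : ∃ y : PeriodicSeq S.Edge, y.1 = x := ⟨⟨x, k, hk, hxk⟩, rfl⟩
      subst hy
      obtain ⟨j, hj⟩ : ∃ j : ℤ, (PeriodicSeq.shift ^ j) y =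
          (Quotient.mk _ y : CyclicSeq S.Edge).out :=
        Equiv.Perm.SameCycle.symm (Quotient.mk_out (s := Equiv.Perm.SameCycle.setoid _) y)
      refine ⟨⟨Quotient.mk _ y, ?_, ?_⟩, Subtype.ext (Subtype.ext ?_)⟩
      · rw [IsCyclicPath, ← hj]
        exact isPath_shift_zpow hu.isPath j
      · rw [← hj]
        exact isTwoSided_shift_zpow hu.isTwoSided j
      · simp only [F]
        generalize_proofs h1
        obtain ⟨γ, hγ⟩ : ∃ γ : {γ : CyclicSeq S.Edge | IsCyclicPath γ ∧ S.IsTwoSided γ.out.1},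
          γ = ⟨Quotient.mk _ y, h1⟩ := ⟨_, rfl⟩
        rw [← hγ]
        have hyγ : γ.1.out.1 = fun n => y.1 (n + j) := by
          rw [hγ]
          simp only
          rw [← hj]
          exact funext fun n => PeriodicSeq.shift_zpow_apply _ _ _
        have hu' := hu.comp_add j
        rw [← hyγ] at hu'
        have hum' : ∀ n, u (n + j) ∈ ω.tiles := fun n => hum _
        -- The two chain tiles have the same color a and heights in g(a)G, so their ratio is in G;
        -- scaling ω by it makes the chains equal, and then the tilings.
        obtain ⟨⟨h, hh, hhy⟩, -⟩ := (hW γ).1 _ _ (hm γ 0)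
        obtain ⟨⟨h', hh', hhy'⟩, -⟩ := hω' _ _ (hum' 0)
        have hcol : (t γ 0).2 = (u (0 + j)).2 := by rw [(ht γ).color, hu'.color]
        have hlm : h * h'⁻¹ ∈ S.baseSet := mul_mem hh (inv_mem hh')
        have hsc := hu'.eq_scaleC (ht γ) (l := h * h'⁻¹) (by
          rw [hhy, hhy', hcol, Positive.val_mul, Positive.coe_inv]
          have := h'.2.ne'
          field_simp)
        rw [← orbit_scale hlm ω]
        congr 1
        refine (ht γ).eq_of_mem (PeriodicSeq.minimalPeriod_pos γ.1.out)
          (apply_add_minimalPeriod γ.1.out) (hW γ).1 (hm γ) (scale_mem_tilings' hω' hlm) fun n => ?_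
        rw [hsc]
        exact scaleC_mem_scale (hum' n)
  exact ⟨Equiv.ofBijective F hF, fun γ => minCycle_orbit (hW γ).1 (ht γ) (hm γ)⟩

/-! ### Extremal cyclic paths -/

/-- Always taking the first (or the last) letter is a deterministic rule, so the side and the edge
at index 0 determine the path. -/
theorem finite_extremal_cyclicPaths [Finite A] :
    {γ : CyclicSeq S.Edge | IsCyclicPath γ ∧ ¬ S.IsTwoSided γ.out.1}.Finite := by
  have hex : ∀ γ : {γ : CyclicSeq S.Edge | IsCyclicPath γ ∧ ¬ S.IsTwoSided γ.out.1},
      ∃ s, ∀ n, (γ.1.out.1 n).2 = S.extIdx s (γ.1.out.1 n).1 := fun γ => by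
    have := γ.2.2
    rw [IsTwoSided] at this
    push Not at this
    exact this
  choose s hs using hex
  refine Set.finite_coe_iff.1 (Finite.of_injective (fun γ => (s γ, γ.1.out.1 0)) ?_)
  intro γ γ' he
  obtain ⟨he1, he2⟩ := Prod.mk.inj he
  have hnat : ∀ n : ℕ, γ.1.out.1 n = γ'.1.out.1 n := by
    intro n
    induction n with
    | zero => exact he2
    | succ n ih =>
      have h1 := γ.2.1 n
      have h2 := γ'.2.1 n
      rw [ih, h2] at h1
      have h3 := hs γ (n + 1)
      have h4 := hs γ' (n + 1)
      rw [← he1] at h4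
      push_cast
      have key : ∀ e f : S.Edge, f.1 = e.1 → e.2 = S.extIdx (s γ) e.1 → f.2 = S.extIdx (s γ) f.1 →
          e = f := by
        rintro ⟨a, i⟩ ⟨b, j⟩ h h' h''
        simp only at h h' h''
        subst h
        rw [h', h'']
      exact key _ _ h1 h3 h4
  obtain ⟨k, hk, hper⟩ := γ.1.out.2
  obtain ⟨k', hk', hper'⟩ := γ'.1.out.2
  refine Subtype.ext (Quotient.out_injective (Subtype.ext (funext fun n => ?_)))
  have hP : Function.Periodic γ.1.out.1 ((k * k' : ℕ) : ℤ) := by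
    have := Function.Periodic.nat_mul (f := γ.1.out.1) (c := (k : ℤ)) hper k'
    rw [mul_comm k k']
    exact_mod_cast this
  have hP' : Function.Periodic γ'.1.out.1 ((k * k' : ℕ) : ℤ) := by
    have := Function.Periodic.nat_mul (f := γ'.1.out.1) (c := (k' : ℤ)) hper' k
    exact_mod_cast this
  have hpos : (0 : ℤ) < (k * k' : ℕ) := by exact_mod_cast Nat.mul_pos hk hk'
  rw [← apply_emod hP, ← apply_emod hP', ← Int.toNat_of_nonneg (Int.emod_nonneg n hpos.ne')]
  exact hnat _

end WeightedSubstitution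

end Kamae

namespace Kamae

open ColoredTiling

/-- A set of positive reals whose logarithms lie in an arithmetic progression is locally finite. -/
theorem finite_log_progression {n x L : ℝ} (hn : 0 < n) (hL : 0 < L) (hx : 0 < x) (y C : ℝ) :
    {u : ℝ | (x ≤ u ∧ u ≤ y) ∧ ∃ z : ℤ, n * Real.log u = C + z * L}.Finite := by
  refine ((Set.finite_Icc ⌈(n * Real.log x - C) / L⌉ ⌊(n * Real.log y - C) / L⌋).image
    fun z : ℤ => Real.exp ((C + z * L) / n)).subset ?_
  rintro u ⟨⟨h1, h2⟩, z, hz⟩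
  have hu := hx.trans_le h1
  refine ⟨z, ⟨?_, ?_⟩, ?_⟩
  · rw [Int.ceil_le, div_le_iff₀ hL]
    have := mul_le_mul_of_nonneg_left (Real.log_le_log hx h1) hn.le
    linarith
  · rw [Int.le_floor, le_div_iff₀ hL]
    have := mul_le_mul_of_nonneg_left (Real.log_le_log hu h2) hn.le
    linarith
  · simp only
    rw [← hz, mul_div_cancel_left₀ _ hn.ne', Real.exp_log hu]

namespace WeightedSubstitution

variable {A : Type*} {S : WeightedSubstitution A} {g : A → RPos} {ω ω' : ColoredTiling A}

/-! ### Tilings which are separated by the line `x = 0` -/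

theorem desc_of_overlap_out [Finite A] (hω : ω ∈ S.tilings' g) {p q : Tile × A}
    (hp : p ∈ ω.tiles) (hq : q ∈ ω.tiles) (s : Bool) (h1 : 0 < p.1.out s + q.1.out (!s))
    (h2 : 0 < p.1.out (!s) + q.1.out s) (h3 : p.1.y₁ ≤ q.1.y₁) : S.Desc q p := by
  cases s <;> simp at h1 h2 <;> exact desc_of_overlap hω hp hq (by linarith) (by linarith) h3

theorem out_nonpos_or (h : ¬ ω.HasCrossing) {p : Tile × A} (hp : p ∈ ω.tiles) (s : Bool) :
    p.1.out s ≤ 0 ∨ p.1.out (!s) ≤ 0 := by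
  by_contra! hc
  refine h ⟨p, hp, ?_⟩
  cases s <;> simp at hc
  · exact hc
  · exact hc.symm

theorem exists_mem_out (ω : ColoredTiling A) (s : Bool) (e : ℝ) :
    ∃ p ∈ ω.tiles, -e ≤ p.1.out s ∧ e ≤ p.1.out (!s) ∧ p.1.y₁ ≤ 1 ∧ 1 ≤ p.1.y₂ := by
  cases s
  · obtain ⟨p, hp, h1, h2⟩ := ω.exists_mem_closure (x := e) one_pos
    exact ⟨p, hp, neg_le_neg h1.1, h1.2, h2⟩
  · obtain ⟨p, hp, h1, h2⟩ := ω.exists_mem_closure (x := -e) one_pos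
    exact ⟨p, hp, h1.2, le_neg.2 h1.1, h2⟩

/-- Take p close to the axis, and a tall ancestor of a tile q which is closer still. The ancestor
does not cross the axis, and p descends from it. If p is an extremal descendant, its side is at
least as close as that of q; otherwise it is farther away than p was chosen to be. -/
theorem exists_out_eq_zero [Finite A] (hω : ω ∈ S.tilings' g) (hc : ¬ ω.HasCrossing) (s : Bool) :
    ∃ p ∈ ω.tiles, p.1.out s = 0 := by
  obtain ⟨δ, hδ0, hδ⟩ := S.exists_le_weight
  -- The parent of p has lower side at height at least 1, so y₁ ≥ δ for p; a non-extremal p would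
  -- then be at distance at least δ² from the axis, which δ²/2 excludes.
  obtain ⟨p, hp, h1, h2, h3, h4⟩ := exists_mem_out ω s (δ ^ 2 / 2)
  have hp0 : p.1.out s ≤ 0 := (out_nonpos_or hc hp s).resolve_right (by
    have : 0 < δ ^ 2 / 2 := by positivity
    linarith)
  by_contra! hne
  have hlt := lt_of_le_of_ne hp0 (hne p hp)
  have hy : δ ≤ p.1.y₁ := by
    obtain ⟨r, -, i, rfl⟩ := exists_parent hω hp
    rw [childC_y₁]
    rw [childC_y₂] at h4
    have : δ ≤ S.τ r.2 i := hδ ⟨r.2, i⟩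
    nlinarith
  obtain ⟨q, hq, k1, k2, -, -⟩ := exists_mem_out ω s (-p.1.out s / 2)
  obtain ⟨P, rfl, hP⟩ := exists_ancestors hω hq
  obtain ⟨n, hn⟩ := exists_lt_ancestors (fun n => (hP n).2) (max 1 (-p.1.out s))
  have hn := hn n le_rfl
  rw [max_lt_iff] at hn
  have hD := desc_of_ancestors (fun n => (hP n).2) (Nat.zero_le n)
  have e1 := hD.out_le s
  have e2 := hD.out_le (!s)
  have hn0 : (P n).1.out s ≤ 0 := (out_nonpos_or hc (hP n).1 s).resolve_right (by linarith)
  have e3 := (P n).1.out_add_out_not s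
  have e4 := p.1.out_add_out_not s
  have hDp : S.Desc (P n) p :=
    desc_of_overlap_out hω hp (hP n).1 s (by linarith) (by linarith) (by linarith)
  rcases hDp.extDesc_or hδ0 hδ s with ⟨k, hk⟩ | h
  · rw [hk, extDesc_out] at k1 hlt
    linarith
  · have := mul_le_mul_of_nonneg_left hy hδ0.le
    nlinarith

/-- Both p and lp touch the axis, so p is an extremal descendant of lp. The extremal letters thus
return to the color of p, with loop weight 1/l. -/
theorem exists_extWeight_mul_eq_one [Finite A] (hω : ω ∈ S.tilings' g) {l : RPos}
    (hl : 1 < (l : ℝ)) (hlω : ω.scale l = ω) {p : Tile × A} (hp : p ∈ ω.tiles) {s : Bool}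
    (hs : p.1.out s = 0) :
    ∃ k, 0 < k ∧ (S.extLetter s)^[k] p.2 = p.2 ∧ S.extWeight s k p.2 * l = 1 := by
  obtain ⟨δ, hδ0, hδ⟩ := S.exists_le_weight
  have h0 := p.1.y₁_pos
  have hq := scaleC_mem hlω hp
  have hout : ∀ s, (scaleC l p).1.out s = l * p.1.out s := fun s => Tile.out_scale l p.1 s
  have hy : (scaleC l p).1.y₁ = l * p.1.y₁ := rfl
  have hlt : p.1.y₁ < l * p.1.y₁ := lt_mul_of_one_lt_left h0 hl
  have e := p.1.out_add_out_not s
  rw [hs, zero_add] at e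
  have hD : S.Desc (scaleC l p) p :=
    desc_of_overlap_out hω hp hq s (by rw [hout, hs, e]; linarith)
      (by rw [hout, hs, e]; linarith) (hlt.le.trans_eq hy.symm)
  rcases hD.extDesc_or hδ0 hδ s with ⟨k, hk⟩ | h
  · have hk1 := congrArg (fun p => p.2) hk
    have hk2 := congrArg (fun p => p.1.y₁) hk
    simp only [extDesc_snd, extDesc_y₁, hy] at hk1 hk2
    have hc : (scaleC l p).2 = p.2 := rfl
    rw [hc] at hk1 hk2
    refine ⟨k, Nat.pos_of_ne_zero ?_, hk1.symm, ?_⟩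
    · rintro rfl
      have : S.extWeight s 0 p.2 = 1 := by simp [extWeight]
      rw [this, one_mul] at hk2
      linarith
    · refine mul_right_cancel₀ h0.ne' ?_
      rw [one_mul, mul_assoc]
      exact hk2.symm
  · rw [hout, hs, mul_zero, zero_add] at h
    have := mul_pos hδ0 h0
    linarith

theorem iterate_mul_eq {s : Bool} {k : ℕ} {a : A} (ha : (S.extLetter s)^[k] a = a) (j : ℕ) :
    (S.extLetter s)^[k * j] a = a := by
  rw [Function.iterate_mul]
  exact Function.iterate_fixed ha j

theorem extWeight_mul {s : Bool} {k : ℕ} {a : A} (ha : (S.extLetter s)^[k] a = a) (j : ℕ) :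
    S.extWeight s (k * j) a = S.extWeight s k a ^ j := by
  induction j with
  | zero => simp [extWeight]
  | succ j ih => rw [Nat.mul_succ, extWeight_add, iterate_mul_eq ha, ih, pow_succ]

/-- A periodic tiling separated by the line `x = 0` is determined by the heights and the colors of
two tiles along the line. -/
theorem eq_of_sides [Finite A] (hω : ω ∈ S.tilings' g) (hω' : ω' ∈ S.tilings' g)
    (hc : ¬ ω.HasCrossing) {l l' : RPos} (hl : 1 < (l : ℝ)) (hlω : ω.scale l = ω)
    (hl' : 1 < (l' : ℝ)) (hlω' : ω'.scale l' = ω')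
    (h : ∀ s, ∃ p ∈ ω.tiles, ∃ p' ∈ ω'.tiles, p.1.out s = 0 ∧ p'.1.out s = 0 ∧ p.2 = p'.2 ∧
      p.1.y₁ = p'.1.y₁) : ω = ω' := by
  refine eq_of_subset fun q hq => ?_
  obtain ⟨s, hs⟩ : ∃ s, q.1.out s ≤ 0 := by
    rcases out_nonpos_or hc hq true with h | h
    · exact ⟨_, h⟩
    · exact ⟨_, h⟩
  obtain ⟨p, hp, p', hp', h0, h0', hcol, hy⟩ := h s
  obtain ⟨k, hk, hk1, hk2⟩ := exists_extWeight_mul_eq_one hω hl hlω hp h0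
  obtain ⟨k', hk', hk1', hk2'⟩ := exists_extWeight_mul_eq_one hω' hl' hlω' hp' h0'
  rw [← hcol] at hk1' hk2'
  -- Both are the inverse of the weight of k·k' extremal steps from the same letter; this is a
  -- common multiplicative period of ω and ω'.
  have hpow : l ^ k' = l' ^ k := by
    refine Subtype.ext ?_
    have e1 := extWeight_mul hk1 k'
    have e2 := extWeight_mul hk1' k
    rw [mul_comm k' k, e1, eq_inv_of_mul_eq_one_left hk2, eq_inv_of_mul_eq_one_left hk2',
      inv_pow, inv_pow, inv_inj] at e2
    simpa using e2
  -- The tops of p and p' may differ, but their extremal children have the same top as well.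
  have hchild : S.childC p (S.extIdx s p.2) = S.childC p' (S.extIdx s p'.2) := by
    refine Prod.ext (Tile.ext_out (s := s) ?_ ?_ ?_) ?_
    · rw [out_childC_extIdx, out_childC_extIdx, h0, h0']
    · rw [childC_y₁, childC_y₁, hcol, hy]
    · rw [childC_y₂, childC_y₂, hy]
    · show S.extLetter s p.2 = S.extLetter s p'.2
      rw [hcol]
  obtain ⟨c, hcdef⟩ : ∃ c, c = S.childC p (S.extIdx s p.2) := ⟨_, rfl⟩
  have hcω : c ∈ ω.tiles := hcdef ▸ childC_mem hω hp _
  have hcω' : c ∈ ω'.tiles := by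
    rw [hcdef, hchild]
    exact childC_mem hω' hp' _
  have hc0 : c.1.out s = 0 := by rw [hcdef, out_childC_extIdx, h0]
  have hcy := c.1.y₁_pos
  -- Enlarged by a high power of the common period, the shared tile c extends over the column of q
  -- and above it, so q descends from a tile of both tilings.
  obtain ⟨M, hM⟩ := pow_unbounded_of_one_lt ((|q.1.out s| + q.1.y₁) / c.1.y₁)
    (one_lt_pow₀ hl hk'.ne')
  rw [div_lt_iff₀ hcy] at hM
  obtain ⟨m, hm⟩ : ∃ m : RPos, m = (l ^ k') ^ M := ⟨_, rfl⟩
  have hmv : (m : ℝ) = ((l : ℝ) ^ k') ^ M := by rw [hm]; simp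
  rw [← hmv] at hM
  have hmω : scaleC m c ∈ ω.tiles :=
    scaleC_mem (hm ▸ scale_pow_eq (scale_pow_eq hlω _) _) hcω
  have hmω' : scaleC m c ∈ ω'.tiles :=
    scaleC_mem (by rw [hm, hpow]; exact scale_pow_eq (scale_pow_eq hlω' _) _) hcω'
  have hout : ∀ s, (scaleC m c).1.out s = m * c.1.out s := fun s => Tile.out_scale m c.1 s
  have e1 := c.1.out_add_out_not s
  have e2 := q.1.out_add_out_not s
  rw [hc0, zero_add] at e1
  have e3 := q.1.y₁_pos
  have e4 := neg_abs_le (q.1.out s)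
  have e5 := abs_nonneg (q.1.out s)
  refine (desc_of_overlap_out hω hq hmω s ?_ ?_ ?_).mem hω' hmω'
  · rw [hout, e1]
    linarith
  · rw [hout, hc0]
    linarith
  · show q.1.y₁ ≤ m * c.1.y₁
    linarith

/-- The possible quotients of the widths of the tiles on both sides of a point of the boundary
between two tiles. -/
def boundaryRatios (S : WeightedSubstitution A) (a b : A) : Set ℝ :=
  {u | ∃ (e f : S.Edge) (m n : ℕ), (S.extLetter true)^[m] e.tgt = b ∧
    (S.extLetter false)^[n] f.tgt = a ∧
    u = e.wt * S.extWeight true m e.tgt / (f.wt * S.extWeight false n f.tgt)}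

/-- Follow the common line of descent until p and q enter different children. Their horizontal gap
is too small for any non-extremal step, so q is a rightmost and p a leftmost descendant of these
children. -/
theorem mem_boundaryRatios {δ : ℝ} (hδ0 : 0 < δ) (hδ : ∀ e : S.Edge, δ ≤ e.wt)
    {r q p : Tile × A} (hq : S.Desc r q) (hp : S.Desc r p) (h1 : q.1.x₁ < p.1.x₁)
    (h2 : q.1.x₂ < p.1.x₂) (h3 : p.1.x₁ < q.1.x₂ + δ * q.1.y₁) (h4 : p.1.x₁ < q.1.x₂ + δ * p.1.y₁) :
    q.1.y₁ / p.1.y₁ ∈ S.boundaryRatios p.2 q.2 := by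
  induction hq using Relation.ReflTransGen.head_induction_on with
  | refl => exact absurd hp.x₂_le (not_le.2 h2)
  | @head r c hrc hc ih =>
    obtain ⟨i, rfl⟩ := hrc
    rcases hp.eq_or_exists_childC with rfl | ⟨j, hj⟩
    · exact absurd ((Desc.childC r i).trans hc).x₁_le (not_le.2 h1)
    · have hi : S.Desc (S.childC r i) q := hc
      rcases lt_trichotomy i j with hij | rfl | hij
      · have hx := childC_x₂_le_x₁ r hij
        have hj1 := hj.x₁_le
        have hi1 := hi.x₂_le
        obtain ⟨m, hm⟩ := (hi.extDesc_or hδ0 hδ true).resolve_right (by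
          rw [Tile.out_true, Tile.out_true]
          linarith)
        obtain ⟨n, hn⟩ := (hj.extDesc_or hδ0 hδ false).resolve_right (by
          rw [Tile.out_false, Tile.out_false]
          linarith)
        refine ⟨⟨r.2, i⟩, ⟨r.2, j⟩, m, n, ?_, ?_, ?_⟩
        · rw [hm, extDesc_snd]
          rfl
        · rw [hn, extDesc_snd]
          rfl
        · rw [hm, hn, extDesc_y₁, extDesc_y₁, childC_y₁, childC_y₁]
          have := r.1.y₁_pos.ne'
          rw [← mul_assoc, ← mul_assoc, mul_div_mul_right _ _ this]
          simp only [Edge.wt, Edge.tgt]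
          rw [mul_comm, mul_comm (S.τ r.2 j)]
          rfl
      · exact ih hj
      · have := childC_x₂_le_x₁ r hij
        have := hj.x₂_le
        have := hi.x₁_le
        have := p.1.x₁_lt_x₂
        linarith

/-- Approximating tilings without separating line provide a common ancestor for the tiles close to p
and q; their ratios tend to the given one. -/
theorem div_mem_closure_boundaryRatios [Finite A] (hω : ω ∈ S.tilingSpace g) {p q : Tile × A}
    (hp : p ∈ ω.tiles) (hq : q ∈ ω.tiles) (hp0 : p.1.out false = 0) (hq0 : q.1.out true = 0) :
    q.1.y₁ / p.1.y₁ ∈ closure (S.boundaryRatios p.2 q.2) := by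
  obtain ⟨δ, hδ0, hδ⟩ := S.exists_le_weight
  have hδ1 : δ < 1 := (hδ ⟨p.2, S.extIdx true p.2⟩).trans_lt (Edge.wt_lt_one _)
  rw [Metric.mem_closure_iff]
  intro ε hε
  have hpy := p.1.y₁_pos
  have hqy := q.1.y₁_pos
  have hcont : ContinuousAt (fun z : ℝ × ℝ => z.1 / z.2) (q.1.y₁, p.1.y₁) :=
    continuousAt_fst.div continuousAt_snd hpy.ne'
  obtain ⟨η, hη, hηc⟩ := Metric.continuousAt_iff.1 hcont ε hε
  obtain ⟨m, hm⟩ : ∃ m, m = min (η / 2) (min (δ * p.1.y₁ / 4) (δ * q.1.y₁ / 4)) := ⟨_, rfl⟩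
  have hm0 : 0 < m := by rw [hm]; positivity
  have hm1 : m ≤ η / 2 := hm ▸ min_le_left _ _
  have hm2 : m ≤ δ * p.1.y₁ / 4 := hm ▸ (min_le_right _ _).trans (min_le_left _ _)
  have hm3 : m ≤ δ * q.1.y₁ / 4 := hm ▸ (min_le_right _ _).trans (min_le_right _ _)
  have hd1 : δ * p.1.y₁ ≤ p.1.y₁ := mul_le_of_le_one_left hpy.le hδ1.le
  have hd2 : δ * q.1.y₁ ≤ q.1.y₁ := mul_le_of_le_one_left hqy.le hδ1.le
  have hd3 : δ * m ≤ m := mul_le_of_le_one_left hm0.le hδ1.le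
  obtain ⟨ω', hω', R, R', hR, hR', ⟨a1, a2, a3, -⟩, b1, b2, b3, -⟩ :=
    exists_near_of_mem_closure hω hp hq hm0
  obtain ⟨r, -, hrp, hrq⟩ := exists_common_ancestor hω' hR hR'
  have hdist : dist (R'.y₁, R.y₁) (q.1.y₁, p.1.y₁) < η := by
    rw [Prod.dist_eq, max_lt_iff, Real.dist_eq, Real.dist_eq]
    exact ⟨by linarith, by linarith⟩
  have hfin := hηc hdist
  rw [Tile.out_false, neg_eq_zero] at hp0
  rw [Tile.out_true] at hq0
  have w1 := p.1.width_eq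
  have w2 := q.1.width_eq
  rw [hp0] at a1 w1
  rw [hq0] at b2 w2
  rw [abs_le] at a1
  rw [abs_le] at a2
  rw [abs_le] at a3
  rw [abs_le] at b1
  rw [abs_le] at b2
  rw [abs_le] at b3
  have c1 : δ * (q.1.y₁ - m) ≤ δ * R'.y₁ := mul_le_mul_of_nonneg_left (by linarith) hδ0.le
  have c2 : δ * (p.1.y₁ - m) ≤ δ * R.y₁ := mul_le_mul_of_nonneg_left (by linarith) hδ0.le
  refine ⟨R'.y₁ / R.y₁, mem_boundaryRatios hδ0 hδ hrq hrp ?_ ?_ ?_ ?_, ?_⟩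
  · dsimp only
    linarith
  · dsimp only
    linarith
  · dsimp only
    linarith
  · dsimp only
    linarith
  · rw [dist_comm]
    exact hfin

/-- After the first arrival at b only returns to b remain. A return of i steps has weight v with vᵏ
= l⁻ⁱ, since both sides are the weight of i·k steps from b. -/
theorem exists_log_extWeight_eq {s : Bool} {b : A} {k : ℕ} {l : ℝ}
    (hb : (S.extLetter s)^[k] b = b) (hw : S.extWeight s k b * l = 1) (a : A) :
    ∃ C : ℝ, ∀ m, (S.extLetter s)^[m] a = b →
      ∃ z : ℤ, k * Real.log (S.extWeight s m a) = C + z * Real.log l := by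
  classical
  by_cases hex : ∃ m, (S.extLetter s)^[m] a = b
  swap
  · exact ⟨0, fun m hm => absurd ⟨m, hm⟩ hex⟩
  refine ⟨k * Real.log (S.extWeight s (Nat.find hex) a), fun m hm => ?_⟩
  obtain ⟨i, rfl⟩ := Nat.exists_eq_add_of_le (Nat.find_min' hex hm)
  have h0 := Nat.find_spec hex
  rw [add_comm, Function.iterate_add_apply, h0] at hm
  rw [extWeight_add, h0, Real.log_mul (S.extWeight_pos _ _ _).ne' (S.extWeight_pos _ _ _).ne']
  refine ⟨-i, ?_⟩
  have h1 := extWeight_mul hm k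
  rw [mul_comm, extWeight_mul hb, eq_inv_of_mul_eq_one_left hw] at h1
  have h2 := congrArg Real.log h1
  rw [Real.log_pow, Real.log_pow, Real.log_inv] at h2
  push_cast
  linarith

/-- For each pair of edges, k·n times the logarithm of the ratio lies in one progression of step log
l; the loops on both sides have the same weight 1/l. -/
theorem finite_boundaryRatios [Finite A] {a b : A} {k n : ℕ} (hk : 0 < k) (hn : 0 < n) {l : ℝ}
    (hl : 1 < l) (hb : (S.extLetter true)^[k] b = b) (hbw : S.extWeight true k b * l = 1)
    (ha : (S.extLetter false)^[n] a = a) (haw : S.extWeight false n a * l = 1) {x : ℝ} (hx : 0 < x)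
    (y : ℝ) : (S.boundaryRatios a b ∩ Set.Icc x y).Finite := by
  choose C hC using exists_log_extWeight_eq hb hbw
  choose D hD using exists_log_extWeight_eq ha haw
  have hkn : (0 : ℝ) < k * n := by positivity
  refine (Set.finite_iUnion fun q : S.Edge × S.Edge => finite_log_progression hkn (Real.log_pos hl)
    hx y (k * n * (Real.log q.1.wt - Real.log q.2.wt) + n * C q.1.tgt - k * D q.2.tgt)).subset ?_
  rintro _ ⟨⟨e, f, i, j, hi, hj, rfl⟩, hxy⟩
  refine Set.mem_iUnion.2 ⟨(e, f), hxy, ?_⟩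
  obtain ⟨z, hz⟩ := hC _ _ hi
  obtain ⟨w, hw⟩ := hD _ _ hj
  refine ⟨n * z - k * w, ?_⟩
  have he := e.wt_pos.ne'
  have hf := f.wt_pos.ne'
  have h1 := (S.extWeight_pos true i e.tgt).ne'
  have h2 := (S.extWeight_pos false j f.tgt).ne'
  rw [Real.log_div (mul_ne_zero he h1) (mul_ne_zero hf h2), Real.log_mul he h1, Real.log_mul hf h2]
  push_cast
  linear_combination (n : ℝ) * hz - (k : ℝ) * hw

theorem exists_extDesc_mem (hω : ω ∈ S.tilings' g) {p : Tile × A} (hp : p ∈ ω.tiles) {s : Bool}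
    {k : ℕ} {l : ℝ} (hk : (S.extLetter s)^[k] p.2 = p.2)
    (hw : S.extWeight s k p.2 * l = 1) (j : ℕ) :
    ∃ q ∈ ω.tiles, q.1.out s = p.1.out s ∧ q.2 = p.2 ∧ p.1.y₁ = l ^ j * q.1.y₁ := by
  refine ⟨S.extDesc s (k * j) p, (S.desc_extDesc s _ p).mem hω hp, S.extDesc_out s _ p, ?_, ?_⟩
  · rw [extDesc_snd, iterate_mul_eq hk]
  · rw [extDesc_y₁, extWeight_mul hk, ← mul_assoc, ← mul_pow, mul_comm l, hw, one_pow, one_mul]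

/-- There are finitely many closed orbits of tilings separated by the line `x = 0`. -/
theorem finite_closedOrbits_not_hasCrossing [Finite A] :
    {ξ : S.closedOrbits g | ¬ ∃ ω ∈ ξ.1, ω.HasCrossing}.Finite := by
  let B : A × A → Set (S.closedOrbits g) := fun c =>
    {ξ | ∃ ω ∈ S.tilingSpace g, ¬ ω.HasCrossing ∧
      (∃ l : RPos, 1 < (l : ℝ) ∧ ω.scale l = ω) ∧ ξ.1 = S.orbit ω ∧
      ∃ p ∈ ω.tiles, ∃ q ∈ ω.tiles, p.1.out false = 0 ∧ q.1.out true = 0 ∧ p.2 = c.1 ∧ q.2 = c.2}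
  have hsub : {ξ : S.closedOrbits g | ¬ ∃ ω ∈ ξ.1, ω.HasCrossing} ⊆ ⋃ c, B c := by
    rintro ⟨ξ, ω, hω, ⟨l, hl, hl1, hlω⟩, rfl⟩ hc
    have hc' : ¬ ω.HasCrossing := fun h => hc ⟨ω, mem_orbit_self ω, h⟩
    have hω' := tilingSpace_subset_tilings' hω
    obtain ⟨p, hp, hp0⟩ := exists_out_eq_zero hω' hc' false
    obtain ⟨q, hq, hq0⟩ := exists_out_eq_zero hω' hc' true
    exact Set.mem_iUnion.2 ⟨(p.2, q.2), ω, hω, hc', ⟨l, hl1, hlω⟩, rfl, p, hp, q, hq, hp0, hq0,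
      rfl, rfl⟩
  refine (Set.finite_iUnion fun c => ?_).subset hsub
  rcases Set.eq_empty_or_nonempty (B c) with hB | ⟨ξ₀, ω₀, hω₀, -, ⟨l, hl, hlω⟩, -, p₀, hp₀, q₀, hq₀,
    hp₀0, hq₀0, hpc, hqc⟩
  · rw [hB]
    exact Set.finite_empty
  -- Loop weights depend only on the letters, so the period l of one reference tiling serves for all
  -- tilings with the same two colors at the axis.
  obtain ⟨n, hn, ha, haw⟩ := exists_extWeight_mul_eq_one (tilingSpace_subset_tilings' hω₀) hl hlω
    hp₀ hp₀0
  obtain ⟨k, hk, hb, hbw⟩ := exists_extWeight_mul_eq_one (tilingSpace_subset_tilings' hω₀) hl hlω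
    hq₀ hq₀0
  rw [hpc] at ha haw
  rw [hqc] at hb hbw
  have hl0 : (0 : ℝ) < l := l.2
  have hfin := finite_boundaryRatios hk hn hl hb hbw ha haw (x := 1 / 2) (by norm_num) (l + 1)
  have key : ∀ ξ : B c, ∃ ω ∈ S.tilingSpace g, ¬ ω.HasCrossing ∧
      (∃ l : RPos, 1 < (l : ℝ) ∧ ω.scale l = ω) ∧ ξ.1.1 = S.orbit ω ∧
      ∃ p ∈ ω.tiles, ∃ q ∈ ω.tiles, p.1.out false = 0 ∧ q.1.out true = 0 ∧ p.2 = c.1 ∧ q.2 = c.2 ∧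
        q.1.y₁ / p.1.y₁ ∈ S.boundaryRatios c.1 c.2 ∩ Set.Icc (1 / 2) (l + 1) := by
    rintro ⟨ξ, ω, hω, hc, hlω, hξ, p, hp, q, hq, hp0, hq0, hpc, hqc⟩
    have hω' := tilingSpace_subset_tilings' hω
    obtain ⟨p', hp', q', hq', hp0', hq0', hpc', hqc', h1, h2⟩ : ∃ p' ∈ ω.tiles, ∃ q' ∈ ω.tiles,
        p'.1.out false = 0 ∧ q'.1.out true = 0 ∧ p'.2 = c.1 ∧ q'.2 = c.2 ∧
        1 ≤ q'.1.y₁ / p'.1.y₁ ∧ q'.1.y₁ / p'.1.y₁ < l := by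
      -- Replacing one of the tiles by an extremal descendant changes the ratio by a power of l and
      -- brings it into [1, l).
      obtain ⟨z, hz1, hz2⟩ := exists_mem_Ico_zpow (div_pos q.1.y₁_pos p.1.y₁_pos) hl
      rw [← hpc] at ha haw
      rw [← hqc] at hb hbw
      rw [zpow_add_one₀ hl0.ne'] at hz2
      rw [le_div_iff₀ p.1.y₁_pos] at hz1
      rw [div_lt_iff₀ p.1.y₁_pos] at hz2
      obtain ⟨j, rfl | rfl⟩ := z.eq_nat_or_neg
      · obtain ⟨q', hq', e1, e2, e3⟩ := exists_extDesc_mem hω' hq hb hbw j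
        have hj := pow_pos hl0 j
        rw [zpow_natCast, e3] at hz1 hz2
        rw [mul_le_mul_iff_right₀ hj] at hz1
        rw [mul_assoc, mul_lt_mul_iff_right₀ hj] at hz2
        exact ⟨p, hp, q', hq', hp0, e1.trans hq0, hpc, e2.trans hqc,
          (one_le_div p.1.y₁_pos).2 hz1, (div_lt_iff₀ p.1.y₁_pos).2 hz2⟩
      · obtain ⟨p', hp', e1, e2, e3⟩ := exists_extDesc_mem hω' hp ha haw j
        have hj := (pow_pos hl0 j).ne'
        rw [zpow_neg, zpow_natCast, e3] at hz1 hz2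
        rw [inv_mul_cancel_left₀ hj] at hz1
        rw [show ((l : ℝ) ^ j)⁻¹ * l * (l ^ j * p'.1.y₁) = l * p'.1.y₁ by field_simp] at hz2
        exact ⟨p', hp', q, hq, e1.trans hp0, hq0, e2.trans hpc, hqc,
          (one_le_div p'.1.y₁_pos).2 hz1, (div_lt_iff₀ p'.1.y₁_pos).2 hz2⟩
    refine ⟨ω, hω, hc, hlω, hξ, p', hp', q', hq', hp0', hq0', hpc', hqc', ?_, by linarith,
      by linarith⟩
    have hcl := div_mem_closure_boundaryRatios hω hp' hq' hp0' hq0'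
    rw [hpc', hqc'] at hcl
    -- An open window around [1, l) meets the set of ratios in a finite, hence closed set, so the
    -- limit ratio is itself one of them.
    have hI : q'.1.y₁ / p'.1.y₁ ∈ Set.Ioo (1 / 2 : ℝ) (l + 1) := ⟨by linarith, by linarith⟩
    have hmem : q'.1.y₁ / p'.1.y₁ ∈
        closure (Set.Ioo (1 / 2 : ℝ) (l + 1) ∩ S.boundaryRatios c.1 c.2) :=
      isOpen_Ioo.inter_closure ⟨hI, hcl⟩
    have hfin' : (Set.Ioo (1 / 2 : ℝ) (l + 1) ∩ S.boundaryRatios c.1 c.2).Finite :=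
      hfin.subset fun u hu => ⟨hu.2, Set.Ioo_subset_Icc_self hu.1⟩
    rw [hfin'.isClosed.closure_eq] at hmem
    exact hmem.2
  choose W hW hWc hWl hWξ p hp q hq hp0 hq0 hpc' hqc' hr using key
  have hfc := hfin.to_subtype
  refine Set.finite_coe_iff.1 (Finite.of_injective (β := ↑(S.boundaryRatios c.1 c.2 ∩
    Set.Icc (1 / 2) ((l : ℝ) + 1))) (fun ξ => ⟨(q ξ).1.y₁ / (p ξ).1.y₁, hr ξ⟩) ?_)
  intro ξ ξ' he
  have he' : (q ξ).1.y₁ / (p ξ).1.y₁ = (q ξ').1.y₁ / (p ξ').1.y₁ := congrArg Subtype.val he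
  have hT := fun ξ => tilingSpace_subset_tilings' (hW ξ)
  obtain ⟨⟨h, hh, hy⟩, -⟩ := hT ξ _ _ (hp ξ)
  obtain ⟨⟨h', hh', hy'⟩, -⟩ := hT ξ' _ _ (hp ξ')
  rw [hpc'] at hy hy'
  obtain ⟨m, hm⟩ : ∃ m, m = h * h'⁻¹ := ⟨_, rfl⟩
  have hmG : m ∈ S.baseSet := hm ▸ mul_mem hh (inv_mem hh')
  have hyy : (p ξ).1.y₁ = m * (p ξ').1.y₁ := by
    rw [hy, hy', hm, Positive.val_mul, Positive.coe_inv]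
    have := h'.2.ne'
    field_simp
  have hqq : (q ξ).1.y₁ = m * (q ξ').1.y₁ := by
    rw [div_eq_div_iff (p ξ).1.y₁_pos.ne' (p ξ').1.y₁_pos.ne', hyy] at he'
    refine mul_right_cancel₀ (p ξ').1.y₁_pos.ne' ?_
    rw [he']
    ring
  refine Subtype.ext (Subtype.ext ?_)
  rw [hWξ ξ, hWξ ξ', ← orbit_scale hmG (W ξ')]
  congr 1
  obtain ⟨l₁, hl₁, hlω₁⟩ := hWl ξ
  obtain ⟨l₂, hl₂, hlω₂⟩ := hWl ξ'
  -- Scaling by m matches the heights on the right of the axis; equality of the ratios then matches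
  -- those on the left.
  refine eq_of_sides (hT ξ) (scale_mem_tilings' (hT ξ') hmG) (hWc ξ) hl₁ hlω₁ hl₂
    (by rw [← scale_mul, mul_comm, scale_mul, hlω₂]) ?_
  rintro (_ | _)
  · refine ⟨p ξ, hp ξ, _, scaleC_mem_scale (hp ξ'), hp0 ξ, ?_, ?_, hyy⟩
    · show ((p ξ').1.scale m).out false = 0
      rw [Tile.out_scale, hp0, mul_zero]
    · show (p ξ).2 = (p ξ').2
      rw [hpc', hpc']
  · refine ⟨q ξ, hq ξ, _, scaleC_mem_scale (hq ξ'), hq0 ξ, ?_, ?_, hqq⟩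
    · show ((q ξ').1.scale m).out true = 0
      rw [Tile.out_scale, hq0, mul_zero]
    · show (q ξ).2 = (q ξ').2
      rw [hqc', hqc']

theorem extWeight_le_of_pos {ρ : ℝ} (hρ : ∀ e : S.Edge, e.wt ≤ ρ) (s : Bool) {k : ℕ}
    (hk : 0 < k) (a : A) : S.extWeight s k a ≤ ρ := by
  obtain ⟨k, rfl⟩ := Nat.exists_eq_succ_of_ne_zero hk.ne'
  rw [extWeight, Finset.prod_range_succ]
  have h1 : ∏ i ∈ Finset.range k, S.τ ((S.extLetter s)^[i] a) (S.extIdx s ((S.extLetter s)^[i] a))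
      ≤ 1 := Finset.prod_le_one (fun _ _ => (S.τ_pos _ _).le) fun _ _ => (S.τ_lt_one _ _).le
  exact (mul_le_of_le_one_left (S.τ_pos _ _).le h1).trans
    (hρ ⟨_, S.extIdx s ((S.extLetter s)^[k] a)⟩)

/-- Every cycle is the inverse of the weight of a nonempty extremal loop, hence at least 1/ρ; the
infimum need not be shown to be attained. -/
theorem one_lt_minCycle_of_not_hasCrossing [Finite A] {ξ : S.closedOrbits g}
    (hξ : ¬ ∃ ω ∈ ξ.1, ω.HasCrossing) : 1 < S.minCycle ξ.1 := by
  obtain ⟨ρ, hρ, hρ1, hρe⟩ := S.exists_weight_le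
  obtain ⟨ξ, ω, hω, ⟨l, hl, hl1, hlω⟩, rfl⟩ := ξ
  have hc : ¬ ω.HasCrossing := fun h => hξ ⟨ω, mem_orbit_self ω, h⟩
  have hω' := tilingSpace_subset_tilings' hω
  obtain ⟨p, hp, hp0⟩ := exists_out_eq_zero hω' hc true
  refine ((one_lt_inv₀ hρ).2 hρ1).trans_le (le_csInf ⟨l, ?_⟩ ?_)
  · exact mem_cycles_orbit_iff.2 ⟨hl1, l, hl, rfl, hlω⟩
  · intro x hx
    obtain ⟨hx1, m, -, rfl, hmω⟩ := mem_cycles_orbit_iff.1 hx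
    obtain ⟨k, hk, -, hkw⟩ := exists_extWeight_mul_eq_one hω' hx1 hmω hp hp0
    rw [eq_inv_of_mul_eq_one_right hkw]
    exact inv_anti₀ (S.extWeight_pos _ _ _) (extWeight_le_of_pos hρe true hk _)

end WeightedSubstitution

end Kamae

namespace Kamae

/-! ### Meromorphic continuation -/

/-- Identity principle: the difference has infinite order at a point of the half plane, hence at
every point of the connected plane. -/
theorem eventuallyEq_nhdsNE_of_eq {F Z : ℂ → ℂ} (hF : MeromorphicOn F Set.univ)
    (hZ : MeromorphicOn Z Set.univ) {c : ℝ} (h : ∀ z : ℂ, c < z.re → F z = Z z) (z : ℂ) :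
    F =ᶠ[nhdsWithin z {z}ᶜ] Z := by
  have hsub : MeromorphicOn (F - Z) Set.univ := hF.sub hZ
  have htop : meromorphicOrderAt (F - Z) ((c + 1 : ℝ) : ℂ) = ⊤ := by
    rw [meromorphicOrderAt_eq_top_iff]
    refine Filter.Eventually.filter_mono nhdsWithin_le_nhds ?_
    have ho : IsOpen {z : ℂ | c < z.re} := isOpen_lt continuous_const Complex.continuous_re
    filter_upwards [ho.mem_nhds (show ((c + 1 : ℝ) : ℂ) ∈ {z : ℂ | c < z.re} by simp)] with w hw
    exact sub_eq_zero.2 (h w hw)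
  have hz : meromorphicOrderAt (F - Z) z = ⊤ := by
    by_contra hne
    exact hsub.meromorphicOrderAt_ne_top_of_isPreconnected isPreconnected_univ (Set.mem_univ z)
      (Set.mem_univ _) hne htop
  rw [meromorphicOrderAt_eq_top_iff] at hz
  filter_upwards [hz] with w hw
  exact sub_eq_zero.1 hw

theorem eq_of_meromorphicNFOn {Z Z' : ℂ → ℂ} (hZ : MeromorphicNFOn Z Set.univ)
    (hZ' : MeromorphicNFOn Z' Set.univ) {c : ℝ} (h : ∀ z : ℂ, c < z.re → Z z = Z' z) : Z = Z' := by
  funext z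
  have := eventuallyEq_nhdsNE_of_eq hZ.meromorphicOn hZ'.meromorphicOn h z
  rw [(hZ (Set.mem_univ z)).eventuallyEq_nhdsNE_iff_eventuallyEq_nhds (hZ' (Set.mem_univ z))] at this
  exact this.eq_of_nhds

theorem toMeromorphicNFOn_eq_of_analyticAt {F : ℂ → ℂ} (hF : MeromorphicOn F Set.univ) {z : ℂ}
    (hz : AnalyticAt ℂ F z) : toMeromorphicNFOn F Set.univ z = F z := by
  rw [toMeromorphicNFOn_eq_toMeromorphicNFAt hF (Set.mem_univ z),
    toMeromorphicNFAt_eq_self.2 hz.meromorphicNFAt]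

/-! ### The zeta function -/

theorem one_sub_cpow_ne_zero {w : ℝ} (hw : 0 < w) (hw1 : w ≠ 1) {z : ℂ} (hz : z.re ≠ 0) :
    1 - (w : ℂ) ^ z ≠ 0 := by
  intro h
  have h1 := congrArg norm (sub_eq_zero.1 h)
  rw [norm_one, Complex.norm_cpow_eq_rpow_re_of_pos hw] at h1
  have h2 := congrArg Real.log h1
  rw [Real.log_one, Real.log_rpow hw] at h2
  exact mul_ne_zero hz (Real.log_ne_zero_of_pos_of_ne_one hw hw1) h2.symm

theorem differentiable_prod_one_sub_cpow {ι : Type*} (s : Finset ι) {w : ι → ℝ}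
    (hw : ∀ i ∈ s, 0 < w i) {f : ℂ → ℂ} (hf : Differentiable ℂ f) :
    Differentiable ℂ fun z : ℂ => ∏ i ∈ s, (1 - (w i : ℂ) ^ f z) := fun z =>
  DifferentiableAt.fun_finsetProd fun i hi => (differentiableAt_const _).sub
    ((hf z).const_cpow (Or.inl (Complex.ofReal_ne_zero.2 (hw i hi).ne')))

namespace WeightedSubstitution

variable {A : Type*}

/-- The factors of the extremal cyclic paths, which do not correspond to closed orbits. -/
noncomputable def extremalFactor [Finite A] (S : WeightedSubstitution A) (z : ℂ) : ℂ :=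
  ∏ γ ∈ (finite_extremal_cyclicPaths (S := S)).toFinset, (1 - (cyclicPathWt γ : ℂ) ^ z)

/-- The inverse factors of the closed orbits of the tilings separated by the line `x = 0`. -/
noncomputable def separatedFactor [Finite A] (S : WeightedSubstitution A) (g : A → RPos) (z : ℂ) :
    ℂ :=
  ∏ ξ ∈ (finite_closedOrbits_not_hasCrossing (S := S) (g := g)).toFinset,
    (1 - (S.minCycle ξ.1 : ℂ) ^ (-z))

variable {S : WeightedSubstitution A} {g : A → RPos}

theorem differentiable_extremalFactor [Finite A] : Differentiable ℂ S.extremalFactor :=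
  differentiable_prod_one_sub_cpow _ (fun γ _ => (cyclicPathWt γ).2) differentiable_id

theorem differentiable_separatedFactor [Finite A] : Differentiable ℂ (S.separatedFactor g) :=
  differentiable_prod_one_sub_cpow _
    (fun _ hξ => zero_lt_one.trans (one_lt_minCycle_of_not_hasCrossing
      ((Set.Finite.mem_toFinset _).1 hξ))) differentiable_neg

theorem extremalFactor_ne_zero [Finite A] {z : ℂ} (hz : z.re ≠ 0) : S.extremalFactor z ≠ 0 :=
  Finset.prod_ne_zero_iff.2 fun γ _ =>
    one_sub_cpow_ne_zero (cyclicPathWt γ).2 (cyclicPathWt_lt_one γ).ne hz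

theorem separatedFactor_ne_zero [Finite A] {z : ℂ} (hz : z.re ≠ 0) : S.separatedFactor g z ≠ 0 :=
  Finset.prod_ne_zero_iff.2 fun _ hξ => by
    have := one_lt_minCycle_of_not_hasCrossing ((Set.Finite.mem_toFinset _).1 hξ)
    exact one_sub_cpow_ne_zero (zero_lt_one.trans this) this.ne' (by simpa using hz)

theorem cpow_neg_inv (w : RPos) (α : ℂ) :
    (((w⁻¹ : RPos) : ℝ) : ℂ) ^ (-α) = ((w : ℝ) : ℂ) ^ α := by
  rw [Positive.coe_inv, Complex.ofReal_inv, Complex.inv_cpow, Complex.cpow_neg, inv_inv]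
  rw [Complex.arg_ofReal_of_nonneg w.2.le]
  exact Real.pi_pos.ne

/-- Cyclic sequences that are not paths contribute 1 to the Euler product, extremal paths are
cancelled by `extremalFactor`, the other paths are the orbits crossing the axis, and the separated
orbits are adjoined at the end. -/
theorem hasProd_closedOrbits [Fintype A] [DecidableEq A] (hg : S.IsCompatible g) {α : ℂ}
    (hα : 1 < α.re) :
    HasProd (fun ξ : S.closedOrbits g => (1 - (S.minCycle ξ.1 : ℂ) ^ (-α))⁻¹)
      ((1 - S.matrix α).det⁻¹ * S.extremalFactor α * (S.separatedFactor g α)⁻¹) := by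
  classical
  obtain ⟨ρ, hρ, hρ1, hρe⟩ := S.exists_weight_le
  have hc0 : 0 ≤ ρ ^ (α.re - 1) := (Real.rpow_pos_of_pos hρ _).le
  have hc1 : ρ ^ (α.re - 1) < 1 := Real.rpow_lt_one hρ.le hρ1 (by linarith)
  have h1 := hasProd_cyclicSeq hc0 hc1 (S.sum_norm_edgeWeight_le hρe hα.le)
  rw [det_one_sub_edgeWeight] at h1
  have hE := finite_extremal_cyclicPaths (S := S)
  have h2 : HasProd (fun γ : CyclicSeq S.Edge => if γ ∈ hE.toFinset then
      1 - (cyclicPathWt γ : ℂ) ^ α else 1) (S.extremalFactor α) := by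
    have := hasProd_prod_of_ne_finset_one (L := SummationFilter.unconditional _)
      (f := fun γ : CyclicSeq S.Edge => if γ ∈ hE.toFinset then
        1 - (cyclicPathWt γ : ℂ) ^ α else 1) (s := hE.toFinset) fun γ hγ => if_neg hγ
    rwa [Finset.prod_congr rfl fun γ hγ => if_pos hγ] at this
  have h3 := h1.mul h2
  obtain ⟨e, he⟩ := exists_equiv_closedOrbits hg
  have h4 : HasProd ((fun ξ : S.closedOrbits g => (1 - (S.minCycle ξ.1 : ℂ) ^ (-α))⁻¹) ∘
      (Subtype.val : {ξ : S.closedOrbits g | ∃ ω ∈ ξ.1, ω.HasCrossing} → _))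
      ((1 - S.matrix α).det⁻¹ * S.extremalFactor α) := by
    rw [← e.hasProd_iff]
    have hcongr : (((fun ξ : S.closedOrbits g => (1 - (S.minCycle ξ.1 : ℂ) ^ (-α))⁻¹) ∘
        Subtype.val) ∘ e) = (fun γ : CyclicSeq S.Edge =>
          (1 - CyclicSeq.weight (S.edgeWeight α) γ)⁻¹) ∘ Subtype.val := by
      funext γ
      simp only [Function.comp_apply]
      rw [he, cpow_neg_inv, weight_edgeWeight_of_isCyclicPath γ.2.1]
    rw [hcongr, hasProd_subtype_iff_mulIndicator]
    convert h3 using 1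
    funext γ
    by_cases hγ : IsCyclicPath γ
    · by_cases hγ2 : S.IsTwoSided γ.out.1
      · have hmem : γ ∈ {γ : CyclicSeq S.Edge | IsCyclicPath γ ∧ S.IsTwoSided γ.out.1} :=
          ⟨hγ, hγ2⟩
        rw [Set.mulIndicator_of_mem hmem, if_neg, mul_one]
        exact fun h => (hE.mem_toFinset.1 h).2 hγ2
      · rw [Set.mulIndicator_of_notMem (fun h => hγ2 h.2),
          if_pos (hE.mem_toFinset.2 ⟨hγ, hγ2⟩), weight_edgeWeight_of_isCyclicPath hγ,
          inv_mul_cancel₀]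
        exact one_sub_cpow_ne_zero (cyclicPathWt γ).2 (cyclicPathWt_lt_one γ).ne (by linarith)
    · rw [Set.mulIndicator_of_notMem (fun h => hγ h.1),
        if_neg (fun h => hγ (hE.mem_toFinset.1 h).1), weight_edgeWeight_eq_zero hγ]
      simp
  refine h4.mul_compl ?_
  rw [hasProd_subtype_iff_mulIndicator]
  have hB := finite_closedOrbits_not_hasCrossing (S := S) (g := g)
  have h5 := hasProd_prod_of_ne_finset_one (L := SummationFilter.unconditional _)
    (f := ({ξ : S.closedOrbits g | ∃ ω ∈ ξ.1, ω.HasCrossing}ᶜ).mulIndicator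
      fun ξ : S.closedOrbits g => (1 - (S.minCycle ξ.1 : ℂ) ^ (-α))⁻¹) (s := hB.toFinset)
    fun ξ hξ => Set.mulIndicator_of_notMem (fun h => hξ ((Set.Finite.mem_toFinset _).2 h)) _
  rw [Finset.prod_congr rfl fun ξ hξ => Set.mulIndicator_of_mem
    (show ξ ∈ {ξ : S.closedOrbits g | ∃ ω ∈ ξ.1, ω.HasCrossing}ᶜ from
      (Set.Finite.mem_toFinset _).1 hξ) _, Finset.prod_inv_distrib] at h5
  exact h5

/-- The meromorphic continuation of the product over the closed orbits. -/
noncomputable def zetaFun [Fintype A] [DecidableEq A] (S : WeightedSubstitution A) (g : A → RPos)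
    (z : ℂ) : ℂ :=
  (1 - S.matrix z).det⁻¹ * S.extremalFactor z * (S.separatedFactor g z)⁻¹

section

variable [Fintype A] [DecidableEq A]

theorem meromorphicOn_zetaFun : MeromorphicOn (S.zetaFun g) Set.univ := fun z _ =>
  ((S.differentiable_det.analyticAt z).meromorphicAt.inv.mul
    (differentiable_extremalFactor.analyticAt z).meromorphicAt).mul
    (differentiable_separatedFactor.analyticAt z).meromorphicAt.inv

theorem analyticAt_zetaFun {z : ℂ} (hz : 1 < z.re) : AnalyticAt ℂ (S.zetaFun g) z :=
  (((S.differentiable_det.analyticAt z).inv (S.det_one_sub_matrix_ne_zero hz)).mul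
    (differentiable_extremalFactor.analyticAt z)).mul
    ((differentiable_separatedFactor.analyticAt z).inv
      (separatedFactor_ne_zero (zero_lt_one.trans hz).ne'))

theorem meromorphicOrderAt_zetaFun {z : ℂ} (hz : z.re ≠ 0) :
    meromorphicOrderAt (S.zetaFun g) z =
      -(analyticOrderAt (fun z : ℂ => (1 - S.matrix z).det) z).map (Nat.cast : ℕ → ℤ) := by
  have hD := S.differentiable_det.analyticAt z
  have hP := (differentiable_extremalFactor (S := S)).analyticAt z
  have hQ := (differentiable_separatedFactor (S := S) (g := g)).analyticAt z
  have hP0 : meromorphicOrderAt S.extremalFactor z = 0 := by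
    rw [hP.meromorphicOrderAt_eq, hP.analyticOrderAt_eq_zero.2 (extremalFactor_ne_zero hz)]
    rfl
  have hQ0 : meromorphicOrderAt (S.separatedFactor g) z = 0 := by
    rw [hQ.meromorphicOrderAt_eq, hQ.analyticOrderAt_eq_zero.2 (separatedFactor_ne_zero hz)]
    rfl
  have hEq : S.zetaFun g = (fun z : ℂ => (1 - S.matrix z).det)⁻¹ * S.extremalFactor *
      (S.separatedFactor g)⁻¹ := rfl
  rw [hEq, meromorphicOrderAt_mul (hD.meromorphicAt.inv.mul hP.meromorphicAt) hQ.meromorphicAt.inv,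
    meromorphicOrderAt_mul hD.meromorphicAt.inv hP.meromorphicAt, meromorphicOrderAt_inv,
    meromorphicOrderAt_inv, hP0, hQ0, hD.meromorphicOrderAt_eq]
  simp

theorem analyticOrderAt_det_ne_top (z : ℂ) :
    analyticOrderAt (fun z : ℂ => (1 - S.matrix z).det) z ≠ ⊤ := by
  intro h
  have hA : AnalyticOnNhd ℂ (fun z : ℂ => (1 - S.matrix z).det) Set.univ := fun z _ =>
    S.differentiable_det.analyticAt z
  have := hA.eqOn_zero_of_preconnected_of_eventuallyEq_zero isPreconnected_univ (Set.mem_univ z)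
    (analyticOrderAt_eq_top.1 h) (Set.mem_univ (2 : ℂ))
  exact S.det_one_sub_matrix_ne_zero (α := 2) (by norm_num) this

theorem isZeta_toMeromorphicNFOn (hg : S.IsCompatible g) :
    S.IsZeta g (toMeromorphicNFOn (S.zetaFun g) Set.univ) where
  hasProd α hα := by
    rw [toMeromorphicNFOn_eq_of_analyticAt meromorphicOn_zetaFun (analyticAt_zetaFun hα)]
    exact hasProd_closedOrbits hg hα
  meromorphic := meromorphicNFOn_toMeromorphicNFOn _ _

theorem IsZeta.meromorphicOrderAt_eq (hg : S.IsCompatible g) {ζ : ℂ → ℂ} (hζ : S.IsZeta g ζ)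
    {z : ℂ} (hz : z.re ≠ 0) : ∃ n : ℕ,
      analyticOrderAt (fun z : ℂ => (1 - S.matrix z).det) z = n ∧
      meromorphicOrderAt ζ z = ((-(n : ℤ) : ℤ) : WithTop ℤ) := by
  obtain ⟨n, hn⟩ := ENat.ne_top_iff_exists.1 (analyticOrderAt_det_ne_top (S := S) z)
  refine ⟨n, hn.symm, ?_⟩
  rw [meromorphicOrderAt_congr (eventuallyEq_nhdsNE_of_eq (c := 1) hζ.meromorphic.meromorphicOn
    (meromorphicOn_zetaFun (S := S) (g := g))
    (fun α hα => (hζ.hasProd α hα).unique (hasProd_closedOrbits hg hα)) z),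
    meromorphicOrderAt_zetaFun hz, ← hn]
  rfl

end

end WeightedSubstitution

end Kamae

/-! ### Conclusion -/

theorem theorem4p2 {A : Type*} [Fintype A] [DecidableEq A] [Nonempty A]
    (S : Kamae.WeightedSubstitution A) (hS : S.IsPrimitive)
    (g : A → Kamae.RPos) (hg : S.IsCompatible g) :
    -- the product converges for `Re α > 1` and has a unique meromorphic extension to the plane
    (∃! Z : ℂ → ℂ, S.IsZeta g Z) ∧
    ∀ ζ : ℂ → ℂ, S.IsZeta g ζ →
      -- no zeros (positive order) off the imaginary axis
      (∀ α : ℂ, α.re ≠ 0 → meromorphicOrderAt ζ α ≤ 0) ∧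
      -- poles of multiplicity `k` are the zeros of multiplicity `k` of the determinant
      (∀ α : ℂ, α.re ≠ 0 → ∀ k : ℕ, 1 ≤ k →
        (meromorphicOrderAt ζ α = ((-(k : ℤ) : ℤ) : WithTop ℤ) ↔
          analyticOrderAt (fun z : ℂ => (1 - S.matrix z).det) α = (k : ℕ∞))) ∧
      -- a simple pole at `1`
      meromorphicOrderAt ζ 1 = ((-1 : ℤ) : WithTop ℤ) := by
  refine ⟨⟨_, Kamae.WeightedSubstitution.isZeta_toMeromorphicNFOn hg, fun Z hZ => ?_⟩,
    fun ζ hζ => ⟨fun α hα => ?_, fun α hα k _ => ?_, ?_⟩⟩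
  · have hZ' := Kamae.WeightedSubstitution.isZeta_toMeromorphicNFOn hg
    exact Kamae.eq_of_meromorphicNFOn hZ.meromorphic hZ'.meromorphic fun α hα =>
      (hZ.hasProd α hα).unique (hZ'.hasProd α hα)
  · obtain ⟨n, -, hn⟩ := hζ.meromorphicOrderAt_eq hg hα
    rw [hn]
    exact_mod_cast neg_nonpos.2 (Int.natCast_nonneg n)
  · obtain ⟨n, hn, hn'⟩ := hζ.meromorphicOrderAt_eq hg hα
    rw [hn, hn', WithTop.coe_inj, neg_inj, Nat.cast_inj, Nat.cast_inj]
  · obtain ⟨n, hn, hn'⟩ := hζ.meromorphicOrderAt_eq (z := 1) hg (by simp)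
    rw [S.analyticOrderAt_det_one hS] at hn
    obtain rfl : 1 = n := by exact_mod_cast hn
    rw [hn']
    rfl
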